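/- For $a=(a_1,a_2)$ with $a_1,a_2>0$ and $\Re(w)>0$ let $\Gamma_2(w\,|\,a)=\exp\bigl(\partial_s\zeta_2(s,w\,|\,a)|_{s=0}\bigr)$ be the double gamma function, where $\zeta_2(s,w\,|\,a)=\frac1{\Gamma(s)}\int_0^\infty \frac{t^{s-1}e^{-wt}}{(1-e^{-a_1t})(1-e^{-a_2t})}\,dt$ for $\Re(s)>2$, continued analytically to a neighbourhood of $s=0$; write $\Gamma_2(w\,|\,\tau)$ for $a=(1,\tau)$. Let $G$ be the Barnes $G$-function (entire, $G(1)=1$, $G(z+1)=\Gamma(z)G(z)$), defined by its Weierstrass product. For $b=(b_0,b_1,b_2)$ with $b_0,b_1,b_2>0$, $\beta_{2,2}(a,b)$ denotes the probability law on $(0,1]$ with Mellin transform, for $\Re(q)>-b_0$, $$\frac{\Gamma_2(q+b_0|a)}{\Gamma_2(b_0|a)}\frac{\Gamma_2(b_0+b_1|a)}{\Gamma_2(q+b_0+b_1|a)}\frac{\Gamma_2(b_0+b_2|a)}{\Gamma_2(q+b_0+b_2|a)}\frac{\Gamma_2(q+b_0+b_1+b_2|a)}{\Gamma_2(b_0+b_1+b_2|a)}.$$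 **Theorem.** For every $\tau>1$ there is exactly one probability law $M_{(\tau,0,0)}$ on $(0,\infty)$ with, for $\Re(q)<\tau$, $$\mathbf E\bigl[M_{(\tau,0,0)}^q\bigr]=\tau^{q/\tau}(2\pi)^q\,\Gamma(1-1/\tau)^{-q}\,\frac{\Gamma_2(1-q+\tau|\tau)^2}{\Gamma_2(1+\tau|\tau)^2}\,\frac{\Gamma_2(\tau-q|\tau)}{\Gamma_2(\tau|\tau)}\,\frac{\Gamma_2(2-q+2\tau|\tau)}{\Gamma_2(2-2q+2\tau|\tau)}.$$ As $\tau\downarrow1$, the law of $M_{(\tau,0,0)}/(1-1/\tau)$ converges weakly to a probability law $M_c$ on $(0,\infty)$ with the following properties. 1. For $\Re(q)<1$, $\mathbf E[M_c^q]$ converges absolutely and $$\mathbf E[M_c^q]=\frac{G(4-2q)}{G(1-q)\,G(2-q)^2\,G(4-q)}.$$ The right-hand side is meromorphic on $\mathbb C$. It has zeros exactly at $q=n+5/2$, $n=0,1,2,\dots$, of multiplicity $2n+2$, and poles exactly at $q=1$ (order $1$), $q=2$ (order $3$) and $q=n$, $n=3,4,5,\dots$ (order $2n-2$). 2. For $\Re(q)<1$,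 $$\mathbf E[M_c^q]=\frac{\Gamma(1-q)\Gamma(2-q)^2\Gamma(4-q)}{\Gamma(4-2q)\Gamma(5-2q)}\,\mathbf E[M_c^{q-1}],$$ and, with (unconditionally) convergent product, $$\mathbf E[M_c^q]=\frac{\Gamma(1-q)\Gamma(3-2q)}{\Gamma(3-q)}\prod_{m=1}^\infty m^{2q}\,\frac{\Gamma(1-q+m)^3}{\Gamma(1+m)^3}\,\frac{\Gamma(2-q+m)}{\Gamma(2-2q+m)}.$$ Both identities hold as well for the meromorphic continuation at every $q\in\mathbb C$ with $2q\notin\{2,3,4,\dots\}$. 3. For $l=0,1,2,\dots$, $\mathbf E[M_c^{-l}]$ is finite and $$\mathbf E[M_c^{-l}]=\prod_{k=0}^{l-1}\frac{(3+l+k)!}{((k+1)!)^2\,k!}.$$ 4. $M_c\overset{\rm law}{=}\frac{\pi}{32}\,L\,X_2\,X_3\,Y$ with $L,X_2,X_3,Y$ independent, where $L=\exp(\mathcal N(0,4\log2))$ (mean $0$, variance $4\log 2$), $X_2=\beta_{2,2}^{-1}\bigl(a=(1,1),\,b=(2,\tfrac12,\tfrac12)\bigr)$ (this law $\beta_{2,2}$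 exists), $X_3$ has density $2y^{-3}$ on $y>1$ (Pareto), and $Y$ has density $y^{-2}e^{-1/y}$ on $y>0$ (Fréchet). 5. The law of $\log M_c$ is infinitely divisible and absolutely continuous with respect to Lebesgue measure. -/

import Mathlib

open MeasureTheory ProbabilityTheory Filter Topology

/-- `Z` is the analytic continuation in `s` of the double zeta function
`ζ₂(s, w | a₁, a₂) = Γ(s)⁻¹ ∫₀^∞ t^(s-1) e^(-wt) (1 - e^(-a₁t))⁻¹ (1 - e^(-a₂t))⁻¹ dt`, `Re s > 2`,
to the connected open set `{Re s > -1} ∖ {1, 2}`, which contains `s = 0` (the continuation is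
meromorphic in `ℂ` with poles only at `1` and `2`; by the identity theorem it is unique, and only
its germ at `0` is used below). -/
def IsDoubleZeta (a₁ a₂ : ℝ) (w : ℂ) (Z : ℂ → ℂ) : Prop :=
  DifferentiableOn ℂ Z ({s : ℂ | -1 < s.re} \ {1, 2}) ∧
  ∀ s : ℂ, 2 < s.re →
    Z s = (Complex.Gamma s)⁻¹ * ∫ t in Set.Ioi (0 : ℝ),
      (t : ℂ) ^ (s - 1) * Complex.exp (-w * t) /
        ((1 - Complex.exp (-(a₁ : ℂ) * t)) * (1 - Complex.exp (-(a₂ : ℂ) * t)))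

open Classical in
/-- The double zeta function `s ↦ ζ₂(s, w | a₁, a₂)`, continued to a neighbourhood of `s = 0`. -/
noncomputable def doubleZeta (a₁ a₂ : ℝ) (w : ℂ) : ℂ → ℂ :=
  if h : ∃ Z : ℂ → ℂ, IsDoubleZeta a₁ a₂ w Z then h.choose else 0

/-- Barnes' double gamma function `Γ₂(w | a₁, a₂) = exp (∂ₛ ζ₂(s, w | a₁, a₂) |_{s = 0})`,
for `a₁, a₂ > 0` and `Re w > 0`. -/
noncomputable def doubleGamma (a₁ a₂ : ℝ) (w : ℂ) : ℂ :=
  Complex.exp (deriv (doubleZeta a₁ a₂ w) 0)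

/-- The Barnes `G` function (entire, `G 1 = 1`, `G (z + 1) = Γ(z) G(z)`), by its Weierstrass product
`G(1 + u) = (2π)^(u/2) exp(-(u + (1 + γ) u²)/2) ∏_{k ≥ 1} (1 + u/k)^k exp(u²/(2k) - u)`. -/
noncomputable def barnesG (z : ℂ) : ℂ :=
  (2 * Real.pi : ℂ) ^ ((z - 1) / 2) *
    Complex.exp (-((z - 1) + (1 + (Real.eulerMascheroniConstant : ℂ)) * (z - 1) ^ 2) / 2) *
    ∏' k : ℕ, (1 + (z - 1) / ((k : ℂ) + 1)) ^ (k + 1) *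
      Complex.exp ((z - 1) ^ 2 / (2 * ((k : ℂ) + 1)) - (z - 1))

/-- The Mellin transform `E[X^q] = ∫ x^q dμ` of the law `μ` of a positive random variable `X`. -/
noncomputable def mellinOf (μ : ProbabilityMeasure ℝ) (q : ℂ) : ℂ :=
  ∫ x : ℝ, (x : ℂ) ^ q ∂(μ : Measure ℝ)

/-- `μ` is a probability law on `(0, ∞)` such that, for all `q ∈ S`, `E[X^q]` exists (as an
absolutely convergent integral) and equals `F q`. -/
def HasMellinOn (μ : ProbabilityMeasure ℝ) (S : Set ℂ) (F : ℂ → ℂ) : Prop :=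
  (μ : Measure ℝ) (Set.Iic 0) = 0 ∧
  ∀ q ∈ S, Integrable (fun x : ℝ => (x : ℂ) ^ q) (μ : Measure ℝ) ∧ mellinOf μ q = F q

/-- The function `η_{2,2}(q | a, b)`, `a = (a₁, a₂)`, `b = (b₀, b₁, b₂)`. -/
noncomputable def barnesEta (a₁ a₂ b₀ b₁ b₂ : ℝ) (q : ℂ) : ℂ :=
  doubleGamma a₁ a₂ (q + b₀) / doubleGamma a₁ a₂ b₀ *
  (doubleGamma a₁ a₂ (b₀ + b₁) / doubleGamma a₁ a₂ (q + b₀ + b₁)) *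
  (doubleGamma a₁ a₂ (b₀ + b₂) / doubleGamma a₁ a₂ (q + b₀ + b₂)) *
  (doubleGamma a₁ a₂ (q + b₀ + b₁ + b₂) / doubleGamma a₁ a₂ (b₀ + b₁ + b₂))

/-- `μ` is the Barnes beta law `β_{2,2}(a, b)`: the probability law on `(0, 1]` whose Mellin
transform is `η_{2,2}(q | a, b)` for `Re q > -b₀`. -/
def IsBarnesBeta (a₁ a₂ b₀ b₁ b₂ : ℝ) (μ : ProbabilityMeasure ℝ) : Prop :=
  (μ : Measure ℝ) (Set.Ioc 0 1)ᶜ = 0 ∧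
  HasMellinOn μ {q : ℂ | -b₀ < q.re} (barnesEta a₁ a₂ b₀ b₁ b₂)

/-- The Mellin transform of the Selberg integral distribution `M_{(τ, l₁, l₂)}`, `Re q < τ`;
here `Γ₂(w | τ) = Γ₂(w | 1, τ)`. -/
noncomputable def selbergMellin (τ l₁ l₂ : ℝ) (q : ℂ) : ℂ :=
  (τ : ℂ) ^ (q / τ) * (2 * Real.pi : ℂ) ^ q * ((Real.Gamma (1 - 1 / τ) : ℝ) : ℂ) ^ (-q) *
  (doubleGamma 1 τ (1 - q + τ * (1 + l₁)) / doubleGamma 1 τ (1 + τ * (1 + l₁))) *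
  (doubleGamma 1 τ (1 - q + τ * (1 + l₂)) / doubleGamma 1 τ (1 + τ * (1 + l₂))) *
  (doubleGamma 1 τ (-q + τ) / doubleGamma 1 τ τ) *
  (doubleGamma 1 τ (2 - q + τ * (2 + l₁ + l₂)) /
    doubleGamma 1 τ (2 - 2 * q + τ * (2 + l₁ + l₂)))

/-- `μ` is the Selberg integral distribution `M_{(τ, l₁, l₂)}`: the probability law on `(0, ∞)`
with the above Mellin transform for `Re q < τ`. -/
def IsSelbergLaw (τ l₁ l₂ : ℝ) (μ : ProbabilityMeasure ℝ) : Prop :=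
  HasMellinOn μ {q : ℂ | q.re < τ} (selbergMellin τ l₁ l₂)

/-- The law of `X / c`, where `μ` is the law of `X`. -/
noncomputable def lawDiv (μ : ProbabilityMeasure ℝ) (c : ℝ) : ProbabilityMeasure ℝ :=
  μ.map (f := fun x : ℝ => x / c) (measurable_id.div_const c).aemeasurable

/-- `G(4 - 2q) / (G(1 - q) G(2 - q)² G(4 - q))`, as a meromorphic function on `ℂ`. -/
noncomputable def criticalMellin (q : ℂ) : ℂ :=
  barnesG (4 - 2 * q) / (barnesG (1 - q) * barnesG (2 - q) ^ 2 * barnesG (4 - q))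

/-- The lognormal law of `exp(N(0, v))`. -/
noncomputable def lognormalLaw (v : ℝ) : Measure ℝ :=
  (gaussianReal 0 v.toNNReal).map Real.exp

/-- The Fréchet law with density `y⁻² e^(-1/y)`, `y > 0`. -/
noncomputable def frechetLaw : Measure ℝ :=
  (volume.restrict (Set.Ioi (0 : ℝ))).withDensity
    (fun y => ENNReal.ofReal (1 / y ^ 2 * Real.exp (-1 / y)))

/-- A law on `ℝ` is infinitely divisible if, for every `n ≥ 1`, it is the law of a sum of `n`
independent identically distributed random variables. -/
def IsInfinitelyDivisible (μ : Measure ℝ) : Prop :=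
  ∀ n : ℕ, 1 ≤ n → ∃ ν : Measure ℝ, IsProbabilityMeasure ν ∧
    μ = (Measure.pi (fun _ : Fin n => ν)).map (fun x => ∑ i, x i)

/-! Everything rests on an integral formula for log Γ₂. Subtracting from the kernel e^{-wt} / ((1 -
e^{-at})(1 - e^{-bt})) its terms of order t⁻², t⁻¹, 1 continues ζ₂ past s = 0, and the derivative
there is the integral of the regularized kernel against dt/t plus elementary terms. The subtracted
coefficients are polynomials in w of degree at most two, so a combination Σ αᵢ log Γ₂(wᵢ) whose
weights annihilate 1, w and w² is the integral of Σ αᵢ kernel(wᵢ) against dt/t, with nothing left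
over (`sum_mul_logDoubleGamma_of_sq`).

For a = b = 1 this yields the classical theory. The second difference of log Γ₂ is a Frullani
integral equal to -log w; Newton interpolation gives asymptotics with error terms; Gauss-type limits
then identify Γ₂(w)/Γ₂(w+1) with Γ(w)/√(2π), and Γ₂(z)/Γ₂(1) with (2π)^{(z-1)/2}/G(z)
(`exp_logGammaDiff`, `exp_logDoubleGamma_mul_barnesG`). Zeros, poles, functional equation, moments
and infinite product are properties of G.

For the laws, the duplication formula `logDoubleGamma_two_mul` breaks Γ₂(2(1+τ-q)) into four values
at half-period shifts, times the exponential of a quadratic polynomial in q. The quadratic part is a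
Gaussian of variance 4 log 2 / τ. What remains is a ratio of six double gamma functions, and its
Lévy density turns out to be nonnegative. So the logarithm of the Mellin transform, without the
factor Γ(1-1/τ)^{-q}, is a Lévy-Khintchine exponent for every τ > 0. This gives existence, infinite
divisibility and, because of the Gaussian part, absolute continuity; the value τ = 1 gives the limit
law directly.

The omitted factor is a rescaling, and (1-1/τ)Γ(1-1/τ) = Γ(2-1/τ) → 1 shows that division by 1-1/τ
is the right normalization. The kernel bounds are uniform in the periods and in w, so log Γ₂ is
continuous in τ by dominated convergence; Mellin transforms then converge on the imaginary axis,
which is convergence of the characteristic functions of the logarithms. The factorization into four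
independent factors compares Mellin transforms on that axis, again using duplication. -/

/-! ### Expansion and uniform bounds of the double zeta kernel -/

/-- The generating function `u / (1 - e^(-u))` of the Bernoulli numbers. -/
noncomputable def bernoulliGen (u : ℝ) : ℝ := u / (1 - Real.exp (-u))

theorem one_sub_exp_neg_pos {u : ℝ} (hu : 0 < u) : 0 < 1 - Real.exp (-u) := by
  have := Real.exp_lt_exp.2 (show -u < 0 by linarith)
  rw [Real.exp_zero] at this
  linarith

theorem bernoulliGen_le {u : ℝ} (hu : 0 < u) : bernoulliGen u ≤ 1 + u := by
  unfold bernoulliGen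
  rw [div_le_iff₀ (one_sub_exp_neg_pos hu)]
  have h1 := Real.add_one_le_exp u
  have h2 : Real.exp (-u) * (1 + u) ≤ 1 := by
    rw [Real.exp_neg, inv_mul_le_iff₀ (Real.exp_pos u)]; linarith
  nlinarith

theorem bernoulliGen_nonneg {u : ℝ} (hu : 0 < u) : 0 ≤ bernoulliGen u :=
  div_nonneg hu.le (one_sub_exp_neg_pos hu).le

/-- For u ≤ 1 the quotient is cleared and e^{-u} replaced by its cubic Taylor polynomial; for u > 1
every term is already dominated by u³. The constant 4 is far from sharp. -/
theorem abs_bernoulliGen_sub_le {u : ℝ} (hu : 0 < u) :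
    |bernoulliGen u - (1 + u / 2 + u ^ 2 / 12)| ≤ 4 * u ^ 3 := by
  have hpos := one_sub_exp_neg_pos hu
  rcases le_or_gt u 1 with h1 | h1
  · have hb := Real.exp_bound (x := -u) (by rw [abs_neg, abs_of_pos hu]; exact h1) (n := 4)
      (by norm_num)
    rw [abs_neg, abs_of_pos hu] at hb
    simp only [Finset.sum_range_succ, Finset.sum_range_zero, Nat.factorial] at hb
    norm_num at hb
    set r := Real.exp (-u) with hr
    have hr' : |r - (1 - u + u ^ 2 / 2 - u ^ 3 / 6)| ≤ u ^ 4 * (5 / 96) := by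
      convert hb using 2; ring
    have hlow : u / 2 ≤ 1 - r := by
      have := (abs_le.1 hr').2
      nlinarith [pow_pos hu 3, pow_le_one₀ hu.le h1 (n := 3), pow_pos hu 2, pow_pos hu 4]
    -- The quadratic polynomial times u - u²/2 + u³/6 equals u + u⁴/24 + u⁵/72, so only fourth order
    -- terms survive; division by 1 - r ≥ u/2 then costs one power of u.
    have key : u - (1 + u / 2 + u ^ 2 / 12) * (1 - r)
        = (1 + u / 2 + u ^ 2 / 12) * (r - (1 - u + u ^ 2 / 2 - u ^ 3 / 6))
          - (u ^ 4 / 24 + u ^ 5 / 72) := by ring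
    have : bernoulliGen u - (1 + u / 2 + u ^ 2 / 12)
        = (u - (1 + u / 2 + u ^ 2 / 12) * (1 - r)) / (1 - r) := by
      unfold bernoulliGen; rw [← hr]; field_simp
    rw [this, abs_div, abs_of_pos hpos, div_le_iff₀ hpos, key]
    have hu2 : u ^ 2 ≤ 1 := pow_le_one₀ hu.le h1
    have hc : |1 + u / 2 + u ^ 2 / 12| ≤ 2 := by
      rw [abs_of_pos (by positivity)]; linarith
    have h5 : u ^ 5 ≤ u ^ 4 := pow_le_pow_of_le_one hu.le h1 (by norm_num)
    calc _ ≤ |(1 + u / 2 + u ^ 2 / 12) * (r - (1 - u + u ^ 2 / 2 - u ^ 3 / 6))|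
          + |u ^ 4 / 24 + u ^ 5 / 72| := abs_sub _ _
      _ ≤ 2 * (u ^ 4 * (5 / 96)) + (u ^ 4 / 24 + u ^ 4 / 72) := by
          rw [abs_mul, abs_of_pos (show 0 < u ^ 4 / 24 + u ^ 5 / 72 by positivity)]
          gcongr
      _ ≤ 4 * u ^ 3 * (u / 2) := by nlinarith [pow_pos hu 4]
      _ ≤ _ := by gcongr
  · have h2 := bernoulliGen_le hu
    have h3 := bernoulliGen_nonneg hu
    have : u ≤ u ^ 3 := le_self_pow₀ h1.le (by norm_num)
    have : u ^ 2 ≤ u ^ 3 := pow_le_pow_right₀ h1.le (by norm_num)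
    have : 1 ≤ u ^ 3 := one_le_pow₀ h1.le
    rw [abs_le]; constructor <;> nlinarith

/-- The kernel `e^(-wt) / ((1 - e^(-at)) (1 - e^(-bt)))` of the double zeta function. -/
noncomputable def zetaKernel (a b : ℝ) (w : ℂ) (t : ℝ) : ℂ :=
  Complex.exp (-w * t) / ((1 - Complex.exp (-(a : ℂ) * t)) * (1 - Complex.exp (-(b : ℂ) * t)))

/-- The coefficient of `t⁻¹` in the expansion of `zetaKernel a b w` at `0`. -/
noncomputable def kernelCoeffOne (a b : ℝ) (w : ℂ) : ℂ :=
  ((a : ℂ)⁻¹ + (b : ℂ)⁻¹) / 2 - w * ((a : ℂ)⁻¹ * (b : ℂ)⁻¹)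

/-- The constant coefficient in the expansion of `zetaKernel a b w` at `0`. -/
noncomputable def kernelCoeffZero (a b : ℝ) (w : ℂ) : ℂ :=
  w ^ 2 * ((a : ℂ)⁻¹ * (b : ℂ)⁻¹) / 2 - w * ((a : ℂ)⁻¹ + (b : ℂ)⁻¹) / 2 + 1 / 4
    + (a * (b : ℂ)⁻¹ + b * (a : ℂ)⁻¹) / 12

/-- The polar part subtracted from `zetaKernel`. -/
noncomputable def kernelPolar (a b : ℝ) (w : ℂ) (t : ℝ) : ℂ :=
  (((a : ℂ)⁻¹ * (b : ℂ)⁻¹) / (t : ℂ) ^ 2 + kernelCoeffOne a b (w - 1) / t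
    + kernelCoeffZero a b (w - 1)) * Complex.exp (-t)

/-- The regularized kernel, which is `O(t)` at `0`. -/
noncomputable def zetaKernelReg (a b : ℝ) (w : ℂ) (t : ℝ) : ℂ :=
  zetaKernel a b w t - kernelPolar a b w t

theorem zetaKernel_eq {a b : ℝ} (ha : 0 < a) (hb : 0 < b) (w : ℂ) {t : ℝ} (ht : 0 < t) :
    zetaKernel a b w t = Complex.exp (-w * t) *
      ((bernoulliGen (a * t) * a⁻¹ : ℝ) : ℂ) * ((bernoulliGen (b * t) * b⁻¹ : ℝ) : ℂ)
        / (t : ℂ) ^ 2 := by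
  have h1 := one_sub_exp_neg_pos (mul_pos ha ht)
  have h2 := one_sub_exp_neg_pos (mul_pos hb ht)
  have h1' : (1 - Complex.exp (-(a : ℂ) * t)) = ((1 - Real.exp (-(a * t)) : ℝ) : ℂ) := by
    push_cast; ring_nf
  have h2' : (1 - Complex.exp (-(b : ℂ) * t)) = ((1 - Real.exp (-(b * t)) : ℝ) : ℂ) := by
    push_cast; ring_nf
  unfold zetaKernel bernoulliGen
  rw [h1', h2']
  have e1 : ((1 - Real.exp (-(a * t)) : ℝ) : ℂ) ≠ 0 := by exact_mod_cast h1.ne'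
  have e2 : ((1 - Real.exp (-(b * t)) : ℝ) : ℂ) ≠ 0 := by exact_mod_cast h2.ne'
  have ha' : (a : ℂ) ≠ 0 := by exact_mod_cast ha.ne'
  have hb' : (b : ℂ) ≠ 0 := by exact_mod_cast hb.ne'
  have ht' : (t : ℂ) ≠ 0 := by exact_mod_cast ht.ne'
  push_cast at e1 e2 ⊢
  field_simp

theorem norm_triple_product_sub_le {E P Q e p q : ℂ} {B ε : ℝ} (hP : ‖P‖ ≤ B) (hQ : ‖Q‖ ≤ B)
    (he : ‖e‖ ≤ B) (hp : ‖p‖ ≤ B) (h1 : ‖E - e‖ ≤ ε) (h2 : ‖P - p‖ ≤ ε) (h3 : ‖Q - q‖ ≤ ε) :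
    ‖E * P * Q - e * p * q‖ ≤ 3 * B ^ 2 * ε := by
  have hB : 0 ≤ B := (norm_nonneg _).trans hP
  have : E * P * Q - e * p * q = (E - e) * P * Q + e * (P - p) * Q + e * p * (Q - q) := by ring
  rw [this]
  calc _ ≤ ‖(E - e) * P * Q‖ + ‖e * (P - p) * Q‖ + ‖e * p * (Q - q)‖ := norm_add₃_le
    _ ≤ ε * B * B + B * ε * B + B * B * ε := by
        simp only [norm_mul]
        have := (norm_nonneg _).trans h1
        gcongr
    _ = _ := by ring

theorem norm_scaled_bernoulliGen_sub_le {a A δ t : ℝ} (hδ : 0 < δ) (ha : a ∈ Set.Icc δ A)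
    (ht : 0 < t) :
    ‖((bernoulliGen (a * t) * a⁻¹ : ℝ) : ℂ) - ((a : ℂ)⁻¹ + t / 2 + a * t ^ 2 / 12)‖
      ≤ 4 * A ^ 2 * t ^ 3 := by
  have ha0 : 0 < a := hδ.trans_le ha.1
  have h := abs_bernoulliGen_sub_le (mul_pos ha0 ht)
  have : ((bernoulliGen (a * t) * a⁻¹ : ℝ) : ℂ) - ((a : ℂ)⁻¹ + t / 2 + a * t ^ 2 / 12)
      = (((bernoulliGen (a * t) - (1 + a * t / 2 + (a * t) ^ 2 / 12)) * a⁻¹ : ℝ) : ℂ) := by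
    have : (a : ℂ) ≠ 0 := by exact_mod_cast ha0.ne'
    push_cast; field_simp
  rw [this, Complex.norm_real, Real.norm_eq_abs, abs_mul, abs_of_pos (inv_pos.2 ha0)]
  calc _ ≤ 4 * (a * t) ^ 3 * a⁻¹ := by gcongr
    _ = 4 * a ^ 2 * t ^ 3 := by field_simp
    _ ≤ _ := by have := ha.2; gcongr

/-- The difference is exactly t³ times a polynomial in a, b, a⁻¹, b⁻¹, v, t. Treating the inverses
as independent variables makes that polynomial continuous on a compact box, and K is its bound
there. -/
theorem exists_norm_kernel_expansion_le (δ A : ℝ) :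
    ∃ K : ℝ, 0 ≤ K ∧ ∀ a ∈ Set.Icc δ A, ∀ b ∈ Set.Icc δ A, ∀ v : ℂ, ‖v‖ ≤ A → ∀ t ∈ Set.Icc (0 : ℝ) 1,
      0 < δ → ‖(1 + (-v * t) + (-v * t) ^ 2 / 2) * ((a : ℂ)⁻¹ + t / 2 + a * t ^ 2 / 12)
        * ((b : ℂ)⁻¹ + t / 2 + b * t ^ 2 / 12)
        - ((a : ℂ)⁻¹ * (b : ℂ)⁻¹ + kernelCoeffOne a b v * t + kernelCoeffZero a b v * t ^ 2)‖
          ≤ K * t ^ 3 := by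
  let T : ℝ × ℝ × ℝ × ℝ × ℂ × ℝ → ℂ := fun x =>
    let a : ℂ := x.1; let b : ℂ := x.2.1; let p : ℂ := x.2.2.1; let q : ℂ := x.2.2.2.1
    let v : ℂ := x.2.2.2.2.1; let t : ℂ := x.2.2.2.2.2
    let s1 := (p + q) / 2; let s2 := 1 / 4 + p * b / 12 + q * a / 12; let s3 := (a + b) / 24
    let s4 := a * b / 144
    (s3 - v * s2 + v ^ 2 / 2 * s1) + (s4 - v * s3 + v ^ 2 / 2 * s2) * t
      + (- v * s4 + v ^ 2 / 2 * s3) * t ^ 2 + v ^ 2 / 2 * s4 * t ^ 3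
  have hT : Continuous T := by fun_prop
  have hK : IsCompact (Set.Icc δ A ×ˢ Set.Icc δ A ×ˢ Set.Icc 0 δ⁻¹ ×ˢ Set.Icc 0 δ⁻¹ ×ˢ
      Metric.closedBall (0 : ℂ) A ×ˢ Set.Icc (0 : ℝ) 1) :=
    isCompact_Icc.prod <| isCompact_Icc.prod <| isCompact_Icc.prod <| isCompact_Icc.prod <|
      (isCompact_closedBall _ _).prod isCompact_Icc
  obtain ⟨K, hK⟩ := hK.exists_bound_of_continuousOn hT.continuousOn
  refine ⟨max K 0, le_max_right _ _, fun a ha b hb v hv t ht hδ => ?_⟩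
  have ha0 : 0 < a := hδ.trans_le ha.1
  have hb0 : 0 < b := hδ.trans_le hb.1
  have h := hK (a, b, a⁻¹, b⁻¹, v, t) ⟨ha, hb, ⟨(inv_pos.2 ha0).le, inv_anti₀ hδ ha.1⟩,
    ⟨(inv_pos.2 hb0).le, inv_anti₀ hδ hb.1⟩, by simpa using hv, ht⟩
  have key : (1 + (-v * t) + (-v * t) ^ 2 / 2) * ((a : ℂ)⁻¹ + t / 2 + a * t ^ 2 / 12)
        * ((b : ℂ)⁻¹ + t / 2 + b * t ^ 2 / 12)
        - ((a : ℂ)⁻¹ * (b : ℂ)⁻¹ + kernelCoeffOne a b v * t + kernelCoeffZero a b v * t ^ 2)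
      = T (a, b, a⁻¹, b⁻¹, v, t) * (t : ℂ) ^ 3 := by
    simp only [T, kernelCoeffOne, kernelCoeffZero]
    push_cast
    ring
  rw [key, norm_mul, norm_pow, Complex.norm_real, Real.norm_eq_abs, abs_of_nonneg ht.1]
  have := ht.1
  gcongr
  exact h.trans (le_max_left _ _)

/-- The kernel is t⁻² times a product of an exponential and two Bernoulli factors. Each factor is
replaced by its quadratic Taylor polynomial at cost O(t³) and the product is truncated at cost
O(t³); division by t² leaves O(t). Uniformity in a, b, w is what later permits the limit τ ↓ 1. -/
theorem exists_norm_zetaKernelReg_le_of_le_one {δ A : ℝ} (hδ : 0 < δ) (hA : 1 ≤ A) :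
    ∃ K : ℝ, 0 ≤ K ∧ ∀ a ∈ Set.Icc δ A, ∀ b ∈ Set.Icc δ A, ∀ w : ℂ, ‖w - 1‖ ≤ A → ∀ t : ℝ, 0 < t →
      t ≤ 1 → ‖zetaKernelReg a b w t‖ ≤ K * t := by
  obtain ⟨K, hK0, hK⟩ := exists_norm_kernel_expansion_le δ A
  -- B dominates all factors and their Taylor polynomials. In ε, the term A³ e^A is the Taylor
  -- remainder of the exponential and 4A² that of the Bernoulli factors.
  set B : ℝ := (1 + A) * δ⁻¹ + 1 + A + A ^ 2 with hB
  set ε : ℝ := A ^ 3 * Real.exp A + 4 * A ^ 2 with hε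
  have hδi : 0 < δ⁻¹ := inv_pos.2 hδ
  refine ⟨3 * B ^ 2 * ε + K, by positivity, fun a ha b hb w hw t ht ht1 => ?_⟩
  have hA0 : 0 < A := by linarith
  have ha0 : 0 < a := hδ.trans_le ha.1
  have hb0 : 0 < b := hδ.trans_le hb.1
  have ht' : (t : ℂ) ≠ 0 := by exact_mod_cast ht.ne'
  have bnd : ∀ c ∈ Set.Icc δ A, ‖((bernoulliGen (c * t) * c⁻¹ : ℝ) : ℂ)‖ ≤ B := by
    intro c hc
    have hc0 : 0 < c := hδ.trans_le hc.1
    have h1 := bernoulliGen_le (mul_pos hc0 ht)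
    have h2 := bernoulliGen_nonneg (mul_pos hc0 ht)
    rw [Complex.norm_real, Real.norm_eq_abs, abs_of_nonneg (mul_nonneg h2 (inv_pos.2 hc0).le)]
    calc _ ≤ (1 + A) * δ⁻¹ := by
          have h3 : bernoulliGen (c * t) ≤ 1 + A := by
            have : c * t ≤ A := by nlinarith [hc.2]
            linarith
          have h4 := inv_anti₀ hδ hc.1
          gcongr
      _ ≤ _ := by rw [hB]; nlinarith
  have bnde : ‖(1 : ℂ) + (-(w - 1) * t) + (-(w - 1) * t) ^ 2 / 2‖ ≤ B := by
    have hn : ‖-(w - 1) * t‖ ≤ A := by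
      rw [norm_mul, norm_neg, Complex.norm_real, Real.norm_eq_abs, abs_of_pos ht]; nlinarith [norm_nonneg (w - 1)]
    calc _ ≤ ‖(1 : ℂ)‖ + ‖-(w - 1) * t‖ + ‖(-(w - 1) * t) ^ 2 / 2‖ := norm_add₃_le
      _ ≤ 1 + A + A ^ 2 / 2 := by
          rw [norm_one, norm_div, norm_pow, Complex.norm_ofNat]
          gcongr
      _ ≤ _ := by rw [hB]; nlinarith [mul_pos (show 0 < 1 + A by linarith) hδi, sq_nonneg A]
  have bndp : ‖((a : ℂ)⁻¹ + t / 2 + a * t ^ 2 / 12)‖ ≤ B := by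
    have : ((a : ℂ)⁻¹ + t / 2 + a * t ^ 2 / 12) = ((a⁻¹ + t / 2 + a * t ^ 2 / 12 : ℝ) : ℂ) := by
      push_cast; ring
    rw [this, Complex.norm_real, Real.norm_eq_abs, abs_of_pos (by positivity)]
    have h4 := inv_anti₀ hδ ha.1
    have h5 : t ^ 2 ≤ 1 := pow_le_one₀ ht.le ht1
    have : a * t ^ 2 ≤ A := by nlinarith [ha.2]
    rw [hB]; nlinarith [mul_pos hA0 hδi, sq_nonneg A]
  have hE : ‖Complex.exp (-(w - 1) * t) - (1 + (-(w - 1) * t) + (-(w - 1) * t) ^ 2 / 2)‖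
      ≤ ε * t ^ 3 := by
    have h := Complex.norm_exp_sub_sum_le_norm_mul_exp (-(w - 1) * t) 3
    simp only [Finset.sum_range_succ, Finset.sum_range_zero, Nat.factorial] at h
    have hn : ‖-(w - 1) * t‖ ≤ A * t := by
      rw [norm_mul, norm_neg, Complex.norm_real, Real.norm_eq_abs, abs_of_pos ht]; gcongr
    have hn' : ‖-(w - 1) * t‖ ≤ A := hn.trans (by nlinarith)
    calc _ = _ := by congr 1; push_cast; ring
      _ ≤ _ := h
      _ ≤ (A * t) ^ 3 * Real.exp A := by gcongr
      _ ≤ _ := by rw [hε]; nlinarith [show 0 ≤ 4 * A ^ 2 * t ^ 3 by positivity]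
  have hp := fun c (hc : c ∈ Set.Icc δ A) => (norm_scaled_bernoulliGen_sub_le hδ hc ht).trans
    (show 4 * A ^ 2 * t ^ 3 ≤ ε * t ^ 3 by
      rw [hε]; nlinarith [show 0 ≤ A ^ 3 * Real.exp A * t ^ 3 by positivity])
  have main := norm_triple_product_sub_le (bnd a ha) (bnd b hb) bnde bndp hE (hp a ha) (hp b hb)
  have main2 := hK a ha b hb (w - 1) hw t ⟨ht.le, ht1⟩ hδ
  -- The polar part carries e^{-t} in order to decay at infinity; taking this factor out of the
  -- kernel replaces w by w - 1, which is why the coefficients are evaluated at w - 1.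
  have hsplit : Complex.exp (-w * t) = Complex.exp (-(w - 1) * t) * Complex.exp (-t) := by
    rw [← Complex.exp_add]; ring_nf
  have hfin : zetaKernelReg a b w t = ((Complex.exp (-(w - 1) * t) *
      ((bernoulliGen (a * t) * a⁻¹ : ℝ) : ℂ) * ((bernoulliGen (b * t) * b⁻¹ : ℝ) : ℂ)
      - (1 + (-(w - 1) * t) + (-(w - 1) * t) ^ 2 / 2) * ((a : ℂ)⁻¹ + t / 2 + a * t ^ 2 / 12)
        * ((b : ℂ)⁻¹ + t / 2 + b * t ^ 2 / 12)) +
      ((1 + (-(w - 1) * t) + (-(w - 1) * t) ^ 2 / 2) * ((a : ℂ)⁻¹ + t / 2 + a * t ^ 2 / 12)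
        * ((b : ℂ)⁻¹ + t / 2 + b * t ^ 2 / 12)
        - ((a : ℂ)⁻¹ * (b : ℂ)⁻¹ + kernelCoeffOne a b (w - 1) * t
          + kernelCoeffZero a b (w - 1) * t ^ 2))) * (Complex.exp (-t) / (t : ℂ) ^ 2) := by
    rw [zetaKernelReg, zetaKernel_eq ha0 hb0 w ht, kernelPolar, hsplit]
    field_simp
    ring
  rw [hfin, norm_mul]
  have hexp : ‖Complex.exp (-t) / (t : ℂ) ^ 2‖ ≤ 1 / t ^ 2 := by
    rw [norm_div, norm_pow, Complex.norm_real, Real.norm_eq_abs, abs_of_pos ht, Complex.norm_exp]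
    gcongr
    simp [ht.le]
  calc _ ≤ (3 * B ^ 2 * (ε * t ^ 3) + K * t ^ 3) * (1 / t ^ 2) := by
        gcongr
        exact (norm_add_le _ _).trans (add_le_add main main2)
    _ = _ := by field_simp

theorem norm_zetaKernel_le {a b δ : ℝ} (hδ : 0 < δ) (ha : δ ≤ a) (hb : δ ≤ b) {w : ℂ} {t : ℝ}
    (ht : 1 ≤ t) :
    ‖zetaKernel a b w t‖ ≤ Real.exp (-w.re * t) * ((1 - Real.exp (-δ)) ^ 2)⁻¹ := by
  have hd := one_sub_exp_neg_pos hδ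
  have h1 : ∀ c, δ ≤ c → 1 - Real.exp (-δ) ≤ ‖1 - Complex.exp (-(c : ℂ) * t)‖ := by
    intro c hc
    have : (1 - Complex.exp (-(c : ℂ) * t)) = ((1 - Real.exp (-(c * t)) : ℝ) : ℂ) := by
      push_cast; ring_nf
    rw [this, Complex.norm_real]
    refine le_trans ?_ (le_abs_self _)
    have : δ ≤ c * t := by nlinarith
    gcongr
  unfold zetaKernel
  rw [norm_div, norm_mul, Complex.norm_exp, div_eq_mul_inv]
  have := h1 a ha
  have := h1 b hb
  rw [sq]
  gcongr
  simp

/-- For t ≥ 1 the kernel decays like e^{-Re(w) t} and the polar part like e^{-t}, both at least as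
fast as e^{-δt}; for t ≤ 1 the O(t) bound applies. The result, divided by t, is the integrable
majorant used throughout. -/
theorem exists_norm_zetaKernelReg_le {δ A : ℝ} (hδ : 0 < δ) (hδ1 : δ ≤ 1) (hA : 1 ≤ A) :
    ∃ K : ℝ, 0 ≤ K ∧ ∀ a ∈ Set.Icc δ A, ∀ b ∈ Set.Icc δ A, ∀ w : ℂ, ‖w - 1‖ ≤ A → δ ≤ w.re →
      ∀ t : ℝ, 0 < t → ‖zetaKernelReg a b w t‖ ≤ K * (t * Real.exp (-δ * t)) := by
  obtain ⟨K, hK0, hK⟩ := exists_norm_zetaKernelReg_le_of_le_one hδ hA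
  let T : ℝ × ℝ × ℝ × ℝ × ℂ → ℝ := fun x =>
    let a : ℂ := x.1; let b : ℂ := x.2.1; let p : ℂ := x.2.2.1; let q : ℂ := x.2.2.2.1
    let v : ℂ := x.2.2.2.2
    ‖p * q‖ + ‖(p + q) / 2 - v * (p * q)‖ +
      ‖v ^ 2 * (p * q) / 2 - v * (p + q) / 2 + 1 / 4 + (a * q + b * p) / 12‖
  have hT : Continuous T := by fun_prop
  have hC : IsCompact (Set.Icc δ A ×ˢ Set.Icc δ A ×ˢ Set.Icc 0 δ⁻¹ ×ˢ Set.Icc 0 δ⁻¹ ×ˢ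
      Metric.closedBall (0 : ℂ) A) :=
    isCompact_Icc.prod <| isCompact_Icc.prod <| isCompact_Icc.prod <| isCompact_Icc.prod <|
      (isCompact_closedBall _ _)
  obtain ⟨K', hK'⟩ := hC.exists_bound_of_continuousOn hT.continuousOn
  set K'' := ((1 - Real.exp (-δ)) ^ 2)⁻¹ + max K' 0
  have hd := one_sub_exp_neg_pos hδ
  have hK'' : 0 ≤ K'' := by positivity
  refine ⟨max (K * Real.exp δ) K'', le_max_of_le_right hK'', fun a ha b hb w hw hwre t ht => ?_⟩
  rcases le_or_gt t 1 with h1 | h1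
  · calc _ ≤ K * t := hK a ha b hb w hw t ht h1
      _ ≤ K * (t * (Real.exp δ * Real.exp (-δ * t))) := by
          rw [← Real.exp_add]
          have : 1 ≤ Real.exp (δ + -δ * t) := Real.one_le_exp (by nlinarith)
          have := le_mul_of_one_le_right ht.le this
          gcongr
      _ = (K * Real.exp δ) * (t * Real.exp (-δ * t)) := by ring
      _ ≤ _ := by gcongr; exact le_max_left _ _
  · have ha0 : 0 < a := hδ.trans_le ha.1
    have hb0 : 0 < b := hδ.trans_le hb.1
    have h2 := norm_zetaKernel_le hδ ha.1 hb.1 (w := w) h1.le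
    have h3 := hK' (a, b, a⁻¹, b⁻¹, w - 1) ⟨ha, hb, ⟨(inv_pos.2 ha0).le, inv_anti₀ hδ ha.1⟩,
      ⟨(inv_pos.2 hb0).le, inv_anti₀ hδ hb.1⟩, by simpa using hw⟩
    have h4 : ‖kernelPolar a b w t‖ ≤ max K' 0 * Real.exp (-δ * t) := by
      unfold kernelPolar
      rw [norm_mul]
      have h5 : ‖Complex.exp (-t)‖ ≤ Real.exp (-δ * t) := by
        rw [Complex.norm_exp]; simp; nlinarith
      gcongr
      refine le_trans ?_ ((le_abs_self _).trans (h3.trans (le_max_left _ _)))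
      simp only [T]
      push_cast
      refine norm_add₃_le.trans ?_
      rw [norm_div, norm_div, norm_pow, Complex.norm_real, Real.norm_eq_abs, abs_of_pos ht]
      gcongr
      · exact div_le_self (norm_nonneg _) (one_le_pow₀ h1.le)
      · exact div_le_self (norm_nonneg _) h1.le
      · rfl
    calc _ ≤ ‖zetaKernel a b w t‖ + ‖kernelPolar a b w t‖ := norm_sub_le _ _
      _ ≤ Real.exp (-δ * t) * ((1 - Real.exp (-δ)) ^ 2)⁻¹ + max K' 0 * Real.exp (-δ * t) := by
          refine add_le_add (h2.trans ?_) h4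
          gcongr
      _ = K'' * (1 * Real.exp (-δ * t)) := by ring
      _ ≤ _ := by gcongr; exact le_max_right _ _

theorem continuousOn_zetaKernel {a b : ℝ} (ha : 0 < a) (hb : 0 < b) (w : ℂ) :
    ContinuousOn (zetaKernel a b w) (Set.Ioi 0) := by
  have h1 : ∀ c : ℝ, 0 < c → ∀ t ∈ Set.Ioi (0 : ℝ), 1 - Complex.exp (-(c : ℂ) * t) ≠ 0 := by
    intro c hc t ht
    have : (1 - Complex.exp (-(c : ℂ) * t)) = ((1 - Real.exp (-(c * t)) : ℝ) : ℂ) := by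
      push_cast; ring_nf
    rw [this]
    exact_mod_cast (one_sub_exp_neg_pos (mul_pos hc ht)).ne'
  unfold zetaKernel
  refine ContinuousOn.div (by fun_prop) (by fun_prop) fun t ht => ?_
  exact mul_ne_zero (h1 a ha t ht) (h1 b hb t ht)

theorem continuousOn_kernelPolar (a b : ℝ) (w : ℂ) :
    ContinuousOn (kernelPolar a b w) (Set.Ioi 0) := by
  have h : ∀ t ∈ Set.Ioi (0 : ℝ), (t : ℂ) ≠ 0 := fun t ht => by
    exact_mod_cast (ne_of_gt ht)
  unfold kernelPolar
  refine ContinuousOn.mul (ContinuousOn.add (ContinuousOn.add ?_ ?_) (by fun_prop)) (by fun_prop)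
  · exact ContinuousOn.div (by fun_prop) (by fun_prop) fun t ht => pow_ne_zero _ (h t ht)
  · exact ContinuousOn.div (by fun_prop) (by fun_prop) h

theorem continuousOn_zetaKernelReg {a b : ℝ} (ha : 0 < a) (hb : 0 < b) (w : ℂ) :
    ContinuousOn (zetaKernelReg a b w) (Set.Ioi 0) :=
  (continuousOn_zetaKernel ha hb w).sub (continuousOn_kernelPolar a b w)

theorem exists_norm_zetaKernelReg_le_of_pos {a b : ℝ} (ha : 0 < a) (hb : 0 < b) {w : ℂ}
    (hw : 0 < w.re) : ∃ K δ : ℝ, 0 ≤ K ∧ 0 < δ ∧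
      ∀ t : ℝ, 0 < t → ‖zetaKernelReg a b w t‖ ≤ K * (t * Real.exp (-δ * t)) := by
  set δ := min (min a b) (min w.re 1)
  have hδ : 0 < δ := by simp [δ, ha, hb, hw]
  obtain ⟨K, hK0, hK⟩ := exists_norm_zetaKernelReg_le (δ := δ)
    (A := max (max a b) (max ‖w - 1‖ 1)) hδ (by simp [δ]) (by simp)
  exact ⟨K, δ, hK0, hδ, fun t ht => hK a (by simp [δ]) b (by simp [δ]) w (by simp) (by simp [δ]) t ht⟩

theorem integrableOn_mul_exp_neg {δ : ℝ} (hδ : 0 < δ) (K : ℝ) :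
    IntegrableOn (fun t => K * Real.exp (-δ * t)) (Set.Ioi 0) :=
  (exp_neg_integrableOn_Ioi 0 hδ).const_mul K

theorem integrableOn_zetaKernelReg_div {a b : ℝ} (ha : 0 < a) (hb : 0 < b) {w : ℂ}
    (hw : 0 < w.re) : IntegrableOn (fun t : ℝ => zetaKernelReg a b w t / t) (Set.Ioi 0) := by
  obtain ⟨K, δ, hK0, hδ, hK⟩ := exists_norm_zetaKernelReg_le_of_pos ha hb hw
  refine Integrable.mono' (integrableOn_mul_exp_neg hδ K) ?_ ?_
  · refine ContinuousOn.aestronglyMeasurable ?_ measurableSet_Ioi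
    exact (continuousOn_zetaKernelReg ha hb w).div (by fun_prop) fun t ht => by
      exact_mod_cast (ne_of_gt ht)
  · refine (ae_restrict_iff' measurableSet_Ioi).2 (Eventually.of_forall fun t ht => ?_)
    have ht' : (0 : ℝ) < t := ht
    rw [norm_div, Complex.norm_real, Real.norm_eq_abs, abs_of_pos ht', div_le_iff₀ ht']
    exact (hK t ht').trans_eq (by ring)

theorem zetaKernelReg_isBigO_top {a b : ℝ} (ha : 0 < a) (hb : 0 < b) {w : ℂ} (hw : 0 < w.re) :
    ∃ δ : ℝ, 0 < δ ∧ zetaKernelReg a b w =O[atTop] fun t => Real.exp (-δ * t) := by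
  obtain ⟨K, δ, hK0, hδ, hK⟩ := exists_norm_zetaKernelReg_le_of_pos ha hb hw
  -- Half of the exponential rate absorbs the factor t, through t ≤ (2/δ) e^{δt/2}.
  refine ⟨δ / 2, by linarith, Asymptotics.IsBigO.of_bound (K * (2 / δ)) ?_⟩
  filter_upwards [eventually_gt_atTop 0] with t ht
  refine (hK t ht).trans ?_
  rw [Real.norm_eq_abs, abs_of_pos (Real.exp_pos _), mul_assoc]
  have h1 : t ≤ 2 / δ * Real.exp (δ / 2 * t) := by
    have := Real.add_one_le_exp (δ / 2 * t)
    calc t = 2 / δ * (δ / 2 * t) := by field_simp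
      _ ≤ _ := by gcongr; linarith
  have h0 : Real.exp (-δ * t) = Real.exp (-(δ / 2) * t) * Real.exp (-(δ / 2) * t) := by
    rw [← Real.exp_add]; ring_nf
  have h2 : Real.exp (δ / 2 * t) * Real.exp (-(δ / 2) * t) = 1 := by
    rw [← Real.exp_add]; simp
  refine mul_le_mul_of_nonneg_left ?_ hK0
  calc t * Real.exp (-δ * t) ≤ (2 / δ * Real.exp (δ / 2 * t)) * Real.exp (-δ * t) := by gcongr
    _ = 2 / δ * Real.exp (-(δ / 2) * t) *
        (Real.exp (δ / 2 * t) * Real.exp (-(δ / 2) * t)) := by rw [h0]; ring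
    _ = _ := by rw [h2, mul_one]

/-- The exponent has the shape -b with b = -1 expected by the Mellin criteria, which then give
convergence and holomorphy for Re s > -1. -/
theorem zetaKernelReg_isBigO_zero {a b : ℝ} (ha : 0 < a) (hb : 0 < b) {w : ℂ} (hw : 0 < w.re) :
    zetaKernelReg a b w =O[𝓝[>] 0] fun t : ℝ => t ^ (-(-1) : ℝ) := by
  obtain ⟨K, δ, hK0, hδ, hK⟩ := exists_norm_zetaKernelReg_le_of_pos ha hb hw
  refine Asymptotics.IsBigO.of_bound K ?_
  filter_upwards [self_mem_nhdsWithin] with t ht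
  have ht' : (0 : ℝ) < t := ht
  refine (hK t ht').trans ?_
  rw [neg_neg, Real.rpow_one, Real.norm_eq_abs, abs_of_pos ht']
  have : Real.exp (-δ * t) ≤ 1 := Real.exp_le_one_iff.2 (by nlinarith)
  gcongr
  nlinarith

theorem mellinConvergent_zetaKernelReg {a b : ℝ} (ha : 0 < a) (hb : 0 < b) {w : ℂ}
    (hw : 0 < w.re) {s : ℂ} (hs : -1 < s.re) : MellinConvergent (zetaKernelReg a b w) s := by
  obtain ⟨δ, hδ, h⟩ := zetaKernelReg_isBigO_top ha hb hw
  exact mellinConvergent_of_isBigO_rpow_exp hδ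
    ((continuousOn_zetaKernelReg ha hb w).locallyIntegrableOn measurableSet_Ioi) h
    (zetaKernelReg_isBigO_zero ha hb hw) hs

theorem differentiableAt_mellin_zetaKernelReg {a b : ℝ} (ha : 0 < a) (hb : 0 < b) {w : ℂ}
    (hw : 0 < w.re) {s : ℂ} (hs : -1 < s.re) :
    DifferentiableAt ℂ (mellin (zetaKernelReg a b w)) s := by
  obtain ⟨δ, hδ, h⟩ := zetaKernelReg_isBigO_top ha hb hw
  exact mellin_differentiableAt_of_isBigO_rpow_exp hδ
    ((continuousOn_zetaKernelReg ha hb w).locallyIntegrableOn measurableSet_Ioi) h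
    (zetaKernelReg_isBigO_zero ha hb hw) hs

/-! ### Continuation of the double zeta function and the logarithm of Γ₂ -/

/-- An explicit continuation of the double zeta function. -/
noncomputable def zetaCont (a b : ℝ) (w : ℂ) (s : ℂ) : ℂ :=
  (Complex.Gamma s)⁻¹ * mellin (zetaKernelReg a b w) s + ((a : ℂ)⁻¹ * (b : ℂ)⁻¹) / ((s - 1) * (s - 2))
    + kernelCoeffOne a b (w - 1) / (s - 1) + kernelCoeffZero a b (w - 1)

/-- The logarithm `∂ₛ ζ₂(s, w | a, b)` at `s = 0` of the double gamma function. -/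
noncomputable def logDoubleGamma (a b : ℝ) (w : ℂ) : ℂ :=
  (∫ t in Set.Ioi (0 : ℝ), zetaKernelReg a b w t / t) + 3 / 4 * ((a : ℂ)⁻¹ * (b : ℂ)⁻¹)
    - kernelCoeffOne a b (w - 1)

theorem hasDerivAt_inv_Gamma_zero : HasDerivAt (fun s : ℂ => (Complex.Gamma s)⁻¹) 1 0 := by
  have h : (fun s : ℂ => (Complex.Gamma s)⁻¹) = fun s => s * (Complex.Gamma (s + 1))⁻¹ :=
    funext Complex.one_div_Gamma_eq_self_mul_one_div_Gamma_add_one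
  rw [h]
  have h2 : DifferentiableAt ℂ (fun s : ℂ => (Complex.Gamma (s + 1))⁻¹) 0 :=
    (Complex.differentiable_one_div_Gamma.comp (differentiable_id.add_const 1)).differentiableAt
  exact ((hasDerivAt_id (0 : ℂ)).mul h2.hasDerivAt).congr_deriv (by simp)

/-- Since 1/Γ(s) vanishes at 0 with derivative 1, the Mellin term contributes just its value at 0,
the integral of the regularized kernel against dt/t. The numbers 3/4 and -1 are the derivatives at 0
of 1/((s-1)(s-2)) and 1/(s-1). -/
theorem hasDerivAt_zetaCont_zero {a b : ℝ} (ha : 0 < a) (hb : 0 < b) {w : ℂ} (hw : 0 < w.re) :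
    HasDerivAt (zetaCont a b w) (logDoubleGamma a b w) 0 := by
  have h1 := hasDerivAt_inv_Gamma_zero.mul
    (differentiableAt_mellin_zetaKernelReg ha hb hw (s := 0) (by simp)).hasDerivAt
  have hm1 : HasDerivAt (fun s : ℂ => s - 1) 1 0 := (hasDerivAt_id 0).sub_const 1
  have hm2 : HasDerivAt (fun s : ℂ => s - 2) 1 0 := (hasDerivAt_id 0).sub_const 2
  have h2 := (hasDerivAt_const (0 : ℂ) ((a : ℂ)⁻¹ * (b : ℂ)⁻¹)).div (hm1.mul hm2) (by simp)
  have h3 := (hasDerivAt_const (0 : ℂ) (kernelCoeffOne a b (w - 1))).div hm1 (by simp)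
  have h := ((h1.add h2).add h3).add_const (kernelCoeffZero a b (w - 1))
  refine h.congr_deriv ?_
  have : mellin (zetaKernelReg a b w) 0 = ∫ t in Set.Ioi (0 : ℝ), zetaKernelReg a b w t / t := by
    unfold mellin
    refine setIntegral_congr_fun measurableSet_Ioi fun t ht => ?_
    simp only [zero_sub, smul_eq_mul, Complex.cpow_neg_one]
    ring
  rw [this, logDoubleGamma]
  simp
  ring

theorem zetaCont_zero (a b : ℝ) (w : ℂ) : zetaCont a b w 0 = kernelCoeffZero a b w := by
  simp only [zetaCont, Complex.Gamma_zero, kernelCoeffOne, kernelCoeffZero]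
  ring

/-- For Re s > 2 the polar terms can be integrated separately; they give Γ(s-2), Γ(s-1) and Γ(s),
and dividing by Γ(s) leaves the rational functions of `zetaCont`. -/
theorem zetaCont_eq_integral {a b : ℝ} (ha : 0 < a) (hb : 0 < b) {w : ℂ} (hw : 0 < w.re) {s : ℂ}
    (hs : 2 < s.re) :
    IntegrableOn (fun t : ℝ => (t : ℂ) ^ (s - 1) * zetaKernel a b w t) (Set.Ioi 0) ∧
    zetaCont a b w s = (Complex.Gamma s)⁻¹ *
      ∫ t in Set.Ioi (0 : ℝ), (t : ℂ) ^ (s - 1) * zetaKernel a b w t := by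
  have hR := mellinConvergent_zetaKernelReg ha hb hw (s := s) (by linarith)
  have hg : ∀ z : ℂ, 0 < z.re → Integrable (fun t : ℝ => Complex.exp (-t) * (t : ℂ) ^ (z - 1))
      (volume.restrict (Set.Ioi 0)) ∧ ∫ t in Set.Ioi (0 : ℝ), Complex.exp (-t) * (t : ℂ) ^ (z - 1)
        = Complex.Gamma z := by
    intro z hz
    have := Complex.GammaIntegral_convergent hz
    refine ⟨by simpa [IntegrableOn] using this, ?_⟩
    rw [Complex.Gamma_eq_integral hz, Complex.GammaIntegral]
    simp
  obtain ⟨i0, e0⟩ := hg s (by linarith)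
  obtain ⟨i1, e1⟩ := hg (s - 1) (by simp; linarith)
  obtain ⟨i2, e2⟩ := hg (s - 2) (by simp; linarith)
  have hs1 : s - 1 ≠ 0 := fun h => by have := congrArg Complex.re h; simp at this; linarith
  have hs2 : s - 2 ≠ 0 := fun h => by have := congrArg Complex.re h; simp at this; linarith
  have hs0 : Complex.Gamma s ≠ 0 := Complex.Gamma_ne_zero_of_re_pos (by linarith)
  have heq : Set.EqOn (fun t : ℝ => (t : ℂ) ^ (s - 1) * zetaKernel a b w t)
      (fun t : ℝ => (t : ℂ) ^ (s - 1) • zetaKernelReg a b w t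
        + (((a : ℂ)⁻¹ * (b : ℂ)⁻¹) * (Complex.exp (-t) * (t : ℂ) ^ (s - 2 - 1))
          + kernelCoeffOne a b (w - 1) * (Complex.exp (-t) * (t : ℂ) ^ (s - 1 - 1))
          + kernelCoeffZero a b (w - 1) * (Complex.exp (-t) * (t : ℂ) ^ (s - 1)))) (Set.Ioi 0) := by
    intro t ht
    have ht' : (t : ℂ) ≠ 0 := by exact_mod_cast (ne_of_gt ht)
    have p1 : (t : ℂ) ^ (s - 1 - 1) = (t : ℂ) ^ (s - 1) / t := by
      rw [Complex.cpow_sub _ _ ht', Complex.cpow_one]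
    have p2 : (t : ℂ) ^ (s - 2 - 1) = (t : ℂ) ^ (s - 1) / (t : ℂ) ^ 2 := by
      rw [show s - 2 - 1 = s - 1 - (2 : ℕ) by push_cast; ring, Complex.cpow_sub _ _ ht',
        Complex.cpow_natCast]
    simp only [p1, p2, zetaKernelReg, kernelPolar, smul_eq_mul]
    ring
  have i0' : Integrable (fun t : ℝ => kernelCoeffZero a b (w - 1) *
      (Complex.exp (-t) * (t : ℂ) ^ (s - 1))) (volume.restrict (Set.Ioi 0)) := i0.const_mul _
  have hint : Integrable (fun t : ℝ => ((a : ℂ)⁻¹ * (b : ℂ)⁻¹) * (Complex.exp (-t) * (t : ℂ) ^ (s - 2 - 1))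
          + kernelCoeffOne a b (w - 1) * (Complex.exp (-t) * (t : ℂ) ^ (s - 1 - 1)))
          (volume.restrict (Set.Ioi 0)) :=
    (i2.const_mul _).add (i1.const_mul _)
  constructor
  · exact (integrableOn_congr_fun heq measurableSet_Ioi).2 (hR.add (hint.add i0'))
  · have hadd := integral_add hR (hint.add i0')
    simp only [Pi.add_apply] at hadd
    rw [setIntegral_congr_fun measurableSet_Ioi heq, hadd,
      integral_add hint i0', integral_add (i2.const_mul _) (i1.const_mul _),
      integral_const_mul, integral_const_mul, integral_const_mul, e0, e1, e2]
    have g1 : Complex.Gamma s = (s - 1) * Complex.Gamma (s - 1) := by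
      rw [← Complex.Gamma_add_one _ hs1]; ring_nf
    have g2 : Complex.Gamma (s - 1) = (s - 2) * Complex.Gamma (s - 2) := by
      rw [← Complex.Gamma_add_one _ hs2]; ring_nf
    have hg2 : Complex.Gamma (s - 2) ≠ 0 := by
      intro h; rw [g1, g2, h] at hs0; simp at hs0
    rw [zetaCont, mellin, g1, g2]
    field_simp
    ring

theorem isDoubleZeta_zetaCont {a b : ℝ} (ha : 0 < a) (hb : 0 < b) {w : ℂ} (hw : 0 < w.re) :
    IsDoubleZeta a b w (zetaCont a b w) := by
  constructor
  · intro s hs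
    have h1 : s - 1 ≠ 0 := fun h => hs.2 (by simp [sub_eq_zero.1 h])
    have h2 : s - 2 ≠ 0 := fun h => hs.2 (by simp [sub_eq_zero.1 h])
    have hG := Complex.differentiable_one_div_Gamma.differentiableAt (x := s)
    have hm := differentiableAt_mellin_zetaKernelReg ha hb hw (s := s) hs.1
    unfold zetaCont
    refine DifferentiableAt.differentiableWithinAt ?_
    refine DifferentiableAt.add_const _ (((hG.mul hm).add ?_).add ?_)
    · exact (differentiableAt_const _).div (by fun_prop) (mul_ne_zero h1 h2)
    · exact (differentiableAt_const _).div (by fun_prop) h1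
  · intro s hs
    rw [(zetaCont_eq_integral ha hb hw hs).2]
    simp only [zetaKernel, mul_div_assoc]

/-- The part of the punctured half plane on which the continuation is compared. -/
def contDomain : Set ℂ := {s : ℂ | -1 < s.re ∧ (0 < s.im ∨ 2 < s.re ∨ s.re < 1)}

theorem isOpen_contDomain : IsOpen contDomain := by
  have h1 : IsOpen {s : ℂ | -1 < s.re} := isOpen_lt continuous_const Complex.continuous_re
  have h2 : IsOpen {s : ℂ | 0 < s.im} := isOpen_lt continuous_const Complex.continuous_im
  have h3 : IsOpen {s : ℂ | 2 < s.re} := isOpen_lt continuous_const Complex.continuous_re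
  have h4 : IsOpen {s : ℂ | s.re < 1} := isOpen_lt Complex.continuous_re continuous_const
  exact h1.inter (h2.union (h3.union h4))

/-- Three convex pieces: the upper part meets the strip to the left of 1 and the half plane to the
right of 2, so 0 and the region of convergence are joined by passing above the poles. -/
theorem isPreconnected_contDomain : IsPreconnected contDomain := by
  have e : contDomain = ({s : ℂ | -1 < s.re} ∩ {s | 0 < s.im}) ∪ {s : ℂ | 2 < s.re} ∪
      ({s : ℂ | -1 < s.re} ∩ {s | s.re < 1}) := by
    ext s
    simp only [contDomain, Set.mem_ofPred_eq, Set.mem_union, Set.mem_inter_iff]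
    constructor
    · rintro ⟨h1, h2 | h2 | h2⟩ <;> tauto
    · rintro ((⟨h1, h2⟩ | h2) | ⟨h1, h2⟩)
      · tauto
      · exact ⟨by linarith, by tauto⟩
      · tauto
  rw [e]
  have c1 : Convex ℝ ({s : ℂ | -1 < s.re} ∩ {s | 0 < s.im}) :=
    (convex_halfSpace_re_gt _).inter (convex_halfSpace_im_gt _)
  have c2 : Convex ℝ {s : ℂ | 2 < s.re} := convex_halfSpace_re_gt _
  have c3 : Convex ℝ ({s : ℂ | -1 < s.re} ∩ {s | s.re < 1}) :=
    (convex_halfSpace_re_gt _).inter (convex_halfSpace_re_lt _)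
  refine IsPreconnected.union Complex.I ?_ ?_ ?_ c3.isPreconnected
  · left; constructor <;> simp
  · constructor <;> simp
  · refine IsPreconnected.union (3 + Complex.I) ?_ ?_ c1.isPreconnected c2.isPreconnected
    · constructor <;> simp; norm_num
    · simp; norm_num

theorem contDomain_subset : contDomain ⊆ {s : ℂ | -1 < s.re} \ {1, 2} := by
  rintro s ⟨h1, h2⟩
  refine ⟨h1, ?_⟩
  rintro (rfl | rfl) <;> norm_num at h2

/-- Identity theorem. Besides uniqueness of the continuation, it transports to s = 0 the scaling and
halving identities, which are evident for the integrals at Re s > 2. -/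
theorem eventuallyEq_zero_of_eq_of_re_gt {f g : ℂ → ℂ}
    (hf : DifferentiableOn ℂ f ({s : ℂ | -1 < s.re} \ {1, 2}))
    (hg : DifferentiableOn ℂ g ({s : ℂ | -1 < s.re} \ {1, 2}))
    (h : ∀ s : ℂ, 2 < s.re → f s = g s) : f =ᶠ[𝓝 0] g := by
  have hfa := (hf.mono contDomain_subset).analyticOnNhd isOpen_contDomain
  have hga := (hg.mono contDomain_subset).analyticOnNhd isOpen_contDomain
  have h3 : f =ᶠ[𝓝 3] g := by
    have : {s : ℂ | 2 < s.re} ∈ 𝓝 (3 : ℂ) :=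
      (isOpen_lt continuous_const Complex.continuous_re).mem_nhds (by simp; norm_num)
    filter_upwards [this] with s hs using h s hs
  have := hfa.eqOn_of_preconnected_of_eventuallyEq hga isPreconnected_contDomain
    (show (3 : ℂ) ∈ contDomain by constructor <;> norm_num) h3
  filter_upwards [isOpen_contDomain.mem_nhds (show (0 : ℂ) ∈ contDomain by constructor <;> norm_num)]
    with s hs using this hs

theorem IsDoubleZeta.eventuallyEq {a b : ℝ} {w : ℂ} {Z Z' : ℂ → ℂ} (h : IsDoubleZeta a b w Z)
    (h' : IsDoubleZeta a b w Z') : Z =ᶠ[𝓝 0] Z' :=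
  eventuallyEq_zero_of_eq_of_re_gt h.1 h'.1 fun s hs => by rw [h.2 s hs, h'.2 s hs]

theorem doubleGamma_eq {a b : ℝ} (ha : 0 < a) (hb : 0 < b) {w : ℂ} (hw : 0 < w.re) :
    doubleGamma a b w = Complex.exp (logDoubleGamma a b w) := by
  have hex : ∃ Z : ℂ → ℂ, IsDoubleZeta a b w Z := ⟨_, isDoubleZeta_zetaCont ha hb hw⟩
  have h : doubleZeta a b w = hex.choose := by unfold doubleZeta; rw [dif_pos hex]
  unfold doubleGamma
  rw [h, (hex.choose_spec.eventuallyEq (isDoubleZeta_zetaCont ha hb hw)).deriv_eq,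
    (hasDerivAt_zetaCont_zero ha hb hw).deriv]

/-- The t⁻² coefficient is constant in w, the t⁻¹ coefficient affine and the constant coefficient
quadratic. The two moment conditions therefore cancel all but the w² part of the last one. -/
theorem sum_mul_logDoubleGamma {ι : Type*} [Fintype ι] {a b : ℝ} (ha : 0 < a) (hb : 0 < b)
    (α w : ι → ℂ) (hw : ∀ i, 0 < (w i).re) (h0 : ∑ i, α i = 0) (h1 : ∑ i, α i * w i = 0) :
    IntegrableOn (fun t : ℝ => (∑ i, α i * zetaKernel a b (w i) t
      - (∑ i, α i * w i ^ 2) * ((a : ℂ)⁻¹ * (b : ℂ)⁻¹) / 2 * Complex.exp (-t)) / t) (Set.Ioi 0) ∧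
    ∑ i, α i * logDoubleGamma a b (w i) = ∫ t in Set.Ioi (0 : ℝ),
      (∑ i, α i * zetaKernel a b (w i) t
      - (∑ i, α i * w i ^ 2) * ((a : ℂ)⁻¹ * (b : ℂ)⁻¹) / 2 * Complex.exp (-t)) / t := by
  have hi : ∀ i, Integrable (fun t : ℝ => α i * (zetaKernelReg a b (w i) t / t))
      (volume.restrict (Set.Ioi 0)) := fun i =>
    (integrableOn_zetaKernelReg_div ha hb (hw i)).const_mul _
  have h1' : ∑ i, α i * kernelCoeffOne a b (w i - 1) = 0 := by
    have : ∀ i, α i * kernelCoeffOne a b (w i - 1)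
        = (((a : ℂ)⁻¹ + (b : ℂ)⁻¹) / 2 + ((a : ℂ)⁻¹ * (b : ℂ)⁻¹)) * α i
          - ((a : ℂ)⁻¹ * (b : ℂ)⁻¹) * (α i * w i) := fun i => by
      simp only [kernelCoeffOne]; ring
    simp only [this, Finset.sum_sub_distrib, ← Finset.mul_sum, h0, h1]
    ring
  have h2' : ∑ i, α i * kernelCoeffZero a b (w i - 1)
      = (∑ i, α i * w i ^ 2) * ((a : ℂ)⁻¹ * (b : ℂ)⁻¹) / 2 := by
    have : ∀ i, α i * kernelCoeffZero a b (w i - 1)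
        = ((a : ℂ)⁻¹ * (b : ℂ)⁻¹) / 2 * (α i * w i ^ 2)
          - (((a : ℂ)⁻¹ * (b : ℂ)⁻¹) + ((a : ℂ)⁻¹ + (b : ℂ)⁻¹) / 2) * (α i * w i)
          + kernelCoeffZero a b (-1) * α i := fun i => by
      simp only [kernelCoeffZero]; ring
    simp only [this, Finset.sum_sub_distrib, Finset.sum_add_distrib, ← Finset.mul_sum, h0, h1]
    ring
  have key : ∀ t : ℝ, (∑ i, α i * zetaKernel a b (w i) t
      - (∑ i, α i * w i ^ 2) * ((a : ℂ)⁻¹ * (b : ℂ)⁻¹) / 2 * Complex.exp (-t)) / t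
      = ∑ i, α i * (zetaKernelReg a b (w i) t / t) := by
    intro t
    have e : ∀ i, α i * (zetaKernelReg a b (w i) t / t) = (α i * zetaKernel a b (w i) t) / t
        - (((a : ℂ)⁻¹ * (b : ℂ)⁻¹) / (t : ℂ) ^ 2 * Complex.exp (-t) / t * α i
        + Complex.exp (-t) / t / t * (α i * kernelCoeffOne a b (w i - 1))
        + Complex.exp (-t) / t * (α i * kernelCoeffZero a b (w i - 1))) := fun i => by
      simp only [zetaKernelReg, kernelPolar]; ring
    simp only [e, Finset.sum_sub_distrib, Finset.sum_add_distrib, ← Finset.mul_sum, h0, h1', h2',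
      ← Finset.sum_div]
    ring
  simp only [key]
  refine ⟨integrable_finsetSum _ fun i _ => hi i, ?_⟩
  rw [integral_finsetSum _ fun i _ => hi i]
  simp only [integral_const_mul]
  have e : ∀ i, α i * logDoubleGamma a b (w i)
      = α i * (∫ t in Set.Ioi (0 : ℝ), zetaKernelReg a b (w i) t / t)
        + 3 / 4 * ((a : ℂ)⁻¹ * (b : ℂ)⁻¹) * α i - α i * kernelCoeffOne a b (w i - 1) := fun i => by
    simp only [logDoubleGamma]; ring
  simp only [e, Finset.sum_sub_distrib, Finset.sum_add_distrib, ← Finset.mul_sum, h0, h1']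
  ring

/-- Combinations of `log Γ₂` killing polynomials of degree two have no regularization terms. -/
theorem sum_mul_logDoubleGamma_of_sq {ι : Type*} [Fintype ι] {a b : ℝ} (ha : 0 < a) (hb : 0 < b)
    (α w : ι → ℂ) (hw : ∀ i, 0 < (w i).re) (h0 : ∑ i, α i = 0) (h1 : ∑ i, α i * w i = 0)
    (h2 : ∑ i, α i * w i ^ 2 = 0) :
    IntegrableOn (fun t : ℝ => (∑ i, α i * zetaKernel a b (w i) t) / t) (Set.Ioi 0) ∧
    ∑ i, α i * logDoubleGamma a b (w i) = ∫ t in Set.Ioi (0 : ℝ),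
      (∑ i, α i * zetaKernel a b (w i) t) / t := by
  simpa [h2] using sum_mul_logDoubleGamma ha hb α w hw h0 h1

theorem one_sub_cexp_neg_ne_zero {c t : ℝ} (hc : 0 < c) (ht : 0 < t) :
    1 - Complex.exp (-(c : ℂ) * t) ≠ 0 := by
  have : (1 - Complex.exp (-(c : ℂ) * t)) = ((1 - Real.exp (-(c * t)) : ℝ) : ℂ) := by
    push_cast; ring_nf
  rw [this]
  exact_mod_cast (one_sub_exp_neg_pos (mul_pos hc ht)).ne'

/-! ### Difference equation, scaling and duplication for log Γ₂ -/

theorem zetaKernel_one_one (w : ℂ) (t : ℝ) :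
    zetaKernel 1 1 w t = Complex.exp (-w * t) / (1 - Complex.exp (-t)) ^ 2 := by
  simp only [zetaKernel]; push_cast; ring_nf

theorem zetaKernel_add (a b : ℝ) (w v : ℂ) (t : ℝ) :
    zetaKernel a b (w + v) t = Complex.exp (-v * t) * zetaKernel a b w t := by
  have : Complex.exp (-(w + v) * t) = Complex.exp (-v * t) * Complex.exp (-w * t) := by
    rw [← Complex.exp_add]; ring_nf
  simp only [zetaKernel, this]; ring

/-- The weights 1, -2, 1 multiply the kernel by (1 - e^{-t})², which is exactly its denominator; the
second difference of w² is 2, so the surviving regularization is e^{-t}. -/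
theorem logDoubleGamma_second_difference_eq_integral {w : ℂ} (hw : 0 < w.re) :
    IntegrableOn (fun t : ℝ => (Complex.exp (-w * t) - Complex.exp (-t)) / t) (Set.Ioi 0) ∧
    logDoubleGamma 1 1 w - 2 * logDoubleGamma 1 1 (w + 1) + logDoubleGamma 1 1 (w + 2)
      = ∫ t in Set.Ioi (0 : ℝ), (Complex.exp (-w * t) - Complex.exp (-t)) / t := by
  have h := sum_mul_logDoubleGamma one_pos one_pos ![1, -2, 1] ![w, w + 1, w + 2]
    (by intro i; fin_cases i <;> simp <;> linarith)
    (by simp [Fin.sum_univ_three]; ring) (by simp [Fin.sum_univ_three]; ring)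
  simp only [Fin.sum_univ_three, Matrix.cons_val_zero, Matrix.cons_val_one, Matrix.cons_val] at h
  have key : Set.EqOn (fun t : ℝ => (1 * zetaKernel 1 1 w t + -2 * zetaKernel 1 1 (w + 1) t
      + 1 * zetaKernel 1 1 (w + 2) t - (1 * w ^ 2 + -2 * (w + 1) ^ 2 + 1 * (w + 2) ^ 2) *
      (((1 : ℝ) : ℂ)⁻¹ * ((1 : ℝ) : ℂ)⁻¹) / 2 * Complex.exp (-t)) / t)
      (fun t : ℝ => (Complex.exp (-w * t) - Complex.exp (-t)) / t) (Set.Ioi 0) := by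
    intro t ht
    have h1 : (1 - Complex.exp (-t)) ≠ 0 := by
      simpa using one_sub_cexp_neg_ne_zero one_pos ht
    have e2 : Complex.exp (-2 * t) = Complex.exp (-t) ^ 2 := by
      rw [← Complex.exp_nat_mul]; push_cast; ring_nf
    simp only [zetaKernel_add, zetaKernel_one_one, neg_one_mul, e2]
    congr 1
    field_simp
    push_cast
    ring
  rw [integrableOn_congr_fun key measurableSet_Ioi, setIntegral_congr_fun measurableSet_Ioi key] at h
  exact ⟨h.1, by rw [← h.2]; ring⟩

/-- Differentiating under the integral gives -1/w. The right half plane is connected and both sides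
vanish at w = 1. -/
theorem integral_frullani {w : ℂ} (hw : 0 < w.re) :
    ∫ t in Set.Ioi (0 : ℝ), (Complex.exp (-w * t) - Complex.exp (-t)) / t = -Complex.log w := by
  set F : ℂ → ℂ := fun w =>
    ∫ t in Set.Ioi (0 : ℝ), (Complex.exp (-w * t) - Complex.exp (-t)) / t with hF
  have hopen : IsOpen {w : ℂ | 0 < w.re} := isOpen_lt continuous_const Complex.continuous_re
  have hderiv : ∀ w : ℂ, 0 < w.re → HasDerivAt F (-w⁻¹) w := by
    intro w hw
    set S : Set ℂ := {z : ℂ | w.re / 2 < z.re}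
    have hS : S ∈ 𝓝 w := (isOpen_lt continuous_const Complex.continuous_re).mem_nhds
      (by simp; linarith)
    have hcont : ∀ z : ℂ, 0 < z.re → AEStronglyMeasurable
        (fun t : ℝ => (Complex.exp (-z * t) - Complex.exp (-t)) / t)
        (volume.restrict (Set.Ioi 0)) := fun z hz =>
      (logDoubleGamma_second_difference_eq_integral hz).1.aestronglyMeasurable
    have := hasDerivAt_integral_of_dominated_loc_of_deriv_le
      (μ := volume.restrict (Set.Ioi (0 : ℝ)))
      (F := fun (z : ℂ) (t : ℝ) => (Complex.exp (-z * t) - Complex.exp (-t)) / t)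
      (F' := fun (z : ℂ) (t : ℝ) => -Complex.exp (-z * t)) (x₀ := w)
      (bound := fun t => 1 * Real.exp (-(w.re / 2) * t)) hS
      (by filter_upwards [hopen.mem_nhds hw] with z hz using hcont z hz)
      (logDoubleGamma_second_difference_eq_integral hw).1
      (by fun_prop) ?_ (integrableOn_mul_exp_neg (by linarith) 1) ?_
    · refine this.2.congr_deriv ?_
      rw [integral_neg, integral_exp_mul_complex_Ioi (by simpa using hw)]
      simp
    · refine (ae_restrict_iff' measurableSet_Ioi).2 (Eventually.of_forall fun t ht z hz => ?_)
      have ht' : (0 : ℝ) < t := ht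
      have hz' : w.re / 2 < z.re := hz
      rw [norm_neg, Complex.norm_exp, one_mul]
      simp only [Complex.mul_re, Complex.neg_re, Complex.ofReal_re, Complex.ofReal_im, mul_zero,
        sub_zero]
      gcongr
    · refine (ae_restrict_iff' measurableSet_Ioi).2 (Eventually.of_forall fun t ht z hz => ?_)
      have ht' : (t : ℂ) ≠ 0 := by exact_mod_cast (ne_of_gt ht)
      have h1 : HasDerivAt (fun z : ℂ => -z * t) (-1 * t) z :=
        ((hasDerivAt_id z).neg).mul_const _
      have h2 := ((h1.cexp).sub_const (Complex.exp (-t))).div_const (t : ℂ)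
      refine h2.congr_deriv ?_
      field_simp
  have hconv : Convex ℝ {w : ℂ | 0 < w.re} := convex_halfSpace_re_gt 0
  have hlog : ∀ w : ℂ, 0 < w.re → HasDerivAt (fun w => F w + Complex.log w) 0 w := by
    intro w hw
    have := (hderiv w hw).add (Complex.hasDerivAt_log (Or.inl hw))
    exact this.congr_deriv (by simp)
  have hconst := hopen.is_const_of_deriv_eq_zero hconv.isPreconnected
    (f := fun w => F w + Complex.log w)
    (fun z hz => (hlog z hz).differentiableAt.differentiableWithinAt)
    (fun z hz => (hlog z hz).deriv) (show w ∈ {w : ℂ | 0 < w.re} from hw)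
    (show (1 : ℂ) ∈ {w : ℂ | 0 < w.re} by simp)
  have h1 : F 1 = 0 := by simp [hF]
  rw [h1, Complex.log_one] at hconst
  simp only [add_zero] at hconst
  exact eq_neg_of_add_eq_zero_left hconst

theorem logDoubleGamma_second_difference {w : ℂ} (hw : 0 < w.re) :
    logDoubleGamma 1 1 w - 2 * logDoubleGamma 1 1 (w + 1) + logDoubleGamma 1 1 (w + 2)
      = -Complex.log w := by
  rw [(logDoubleGamma_second_difference_eq_integral hw).2, integral_frullani hw]

/-- Substituting t ↦ ct in the integral gives ζ₂(s, cw | ca, cb) = c^{-s} ζ₂(s, w | a, b); the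
derivative at 0 of c^{-s} brings in ζ₂(0, w), which is `kernelCoeffZero`. -/
theorem logDoubleGamma_scale {a b c : ℝ} (ha : 0 < a) (hb : 0 < b) (hc : 0 < c) {w : ℂ}
    (hw : 0 < w.re) : logDoubleGamma (c * a) (c * b) (c * w)
      = logDoubleGamma a b w - Real.log c * kernelCoeffZero a b w := by
  have hcw : 0 < ((c : ℂ) * w).re := by simp [hc, hw]
  have hc' : (c : ℂ) ≠ 0 := by exact_mod_cast hc.ne'
  have hpow : ∀ s : ℂ, HasDerivAt (fun s : ℂ => (c : ℂ) ^ (-s)) (-((c : ℂ) ^ (-s) * Complex.log c)) s := by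
    intro s
    have := (hasDerivAt_neg s).const_cpow (c := (c : ℂ)) (Or.inl hc')
    exact this.congr_deriv (by ring)
  have h1 := isDoubleZeta_zetaCont (mul_pos hc ha) (mul_pos hc hb) hcw
  have h2 := isDoubleZeta_zetaCont ha hb hw
  have hev := eventuallyEq_zero_of_eq_of_re_gt (g := fun s => (c : ℂ) ^ (-s) * zetaCont a b w s) h1.1
    (DifferentiableOn.mul (fun s _ => (hpow s).differentiableAt.differentiableWithinAt) h2.1) ?_
  · have hd := (hpow 0).mul (hasDerivAt_zetaCont_zero ha hb hw)
    have := (hasDerivAt_zetaCont_zero (mul_pos hc ha) (mul_pos hc hb) hcw).unique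
      (hd.congr_of_eventuallyEq hev)
    rw [this, zetaCont_zero, Complex.ofReal_log hc.le]
    simp
    ring
  · intro s hs
    rw [(zetaCont_eq_integral (mul_pos hc ha) (mul_pos hc hb) hcw hs).2,
      (zetaCont_eq_integral ha hb hw hs).2]
    have := mellin_comp_mul_left (zetaKernel a b w) s hc
    simp only [mellin, smul_eq_mul] at this
    rw [mul_left_comm, ← this]
    congr 2
    ext t
    simp only [zetaKernel]
    push_cast
    ring_nf

/-- With A = e^{-at/2}, 1/(1 - A) = (1 + A)/(1 - A²), likewise for b; multiplying out the two
numerators gives the four terms. -/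
theorem zetaKernel_half {a b : ℝ} (ha : 0 < a) (hb : 0 < b) (w : ℂ) {t : ℝ} (ht : 0 < t) :
    zetaKernel (a / 2) (b / 2) w t = zetaKernel a b w t + zetaKernel a b (w + a / 2) t
      + zetaKernel a b (w + b / 2) t + zetaKernel a b (w + (a + b) / 2) t := by
  have h1 : ∀ c : ℝ, 0 < c → Complex.exp (-(c : ℂ) * t) = Complex.exp (-(c / 2 : ℂ) * t) ^ 2
      ∧ 1 - Complex.exp (-(c / 2 : ℂ) * t) ≠ 0 ∧ 1 + Complex.exp (-(c / 2 : ℂ) * t) ≠ 0 := by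
    intro c hc
    have h2 : Complex.exp (-(c : ℂ) * t) = Complex.exp (-(c / 2 : ℂ) * t) ^ 2 := by
      rw [← Complex.exp_nat_mul]; push_cast; ring_nf
    have h3 := one_sub_cexp_neg_ne_zero hc ht
    rw [h2, show ∀ x : ℂ, 1 - x ^ 2 = (1 - x) * (1 + x) by intro x; ring] at h3
    exact ⟨h2, left_ne_zero_of_mul h3, right_ne_zero_of_mul h3⟩
  obtain ⟨ea, na, ma⟩ := h1 a ha
  obtain ⟨eb, nb, mb⟩ := h1 b hb
  have e3 : Complex.exp (-((a + b) / 2 : ℂ) * t)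
      = Complex.exp (-(a / 2 : ℂ) * t) * Complex.exp (-(b / 2 : ℂ) * t) := by
    rw [← Complex.exp_add]; ring_nf
  simp only [zetaKernel_add, e3]
  simp only [zetaKernel, ea, eb, Complex.ofReal_div, Complex.ofReal_ofNat]
  generalize Complex.exp (-(a / 2 : ℂ) * t) = A at *
  generalize Complex.exp (-(b / 2 : ℂ) * t) = B at *
  rw [show 1 - A ^ 2 = (1 - A) * (1 + A) by ring, show 1 - B ^ 2 = (1 - B) * (1 + B) by ring]
  field_simp
  ring

theorem logDoubleGamma_half {a b : ℝ} (ha : 0 < a) (hb : 0 < b) {w : ℂ} (hw : 0 < w.re) :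
    logDoubleGamma (a / 2) (b / 2) w = logDoubleGamma a b w + logDoubleGamma a b (w + a / 2)
      + logDoubleGamma a b (w + b / 2) + logDoubleGamma a b (w + (a + b) / 2) := by
  have hw1 : 0 < (w + a / 2).re := by simp; positivity
  have hw2 : 0 < (w + b / 2).re := by simp; positivity
  have hw3 : 0 < (w + (a + b) / 2).re := by simp; positivity
  have ha2 : 0 < a / 2 := by positivity
  have hb2 : 0 < b / 2 := by positivity
  have hev := eventuallyEq_zero_of_eq_of_re_gt (f := zetaCont (a / 2) (b / 2) w)
    (g := fun s => zetaCont a b w s + zetaCont a b (w + a / 2) s + zetaCont a b (w + b / 2) s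
      + zetaCont a b (w + (a + b) / 2) s) (isDoubleZeta_zetaCont ha2 hb2 hw).1
    ((((isDoubleZeta_zetaCont ha hb hw).1.add (isDoubleZeta_zetaCont ha hb hw1).1).add
      (isDoubleZeta_zetaCont ha hb hw2).1).add (isDoubleZeta_zetaCont ha hb hw3).1) ?_
  · exact (hasDerivAt_zetaCont_zero ha2 hb2 hw).unique
      (((((hasDerivAt_zetaCont_zero ha hb hw).add (hasDerivAt_zetaCont_zero ha hb hw1)).add
        (hasDerivAt_zetaCont_zero ha hb hw2)).add
        (hasDerivAt_zetaCont_zero ha hb hw3)).congr_of_eventuallyEq hev)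
  · intro s hs
    obtain ⟨i0, e0⟩ := zetaCont_eq_integral ha hb hw hs
    obtain ⟨i1, e1⟩ := zetaCont_eq_integral ha hb hw1 hs
    obtain ⟨i2, e2⟩ := zetaCont_eq_integral ha hb hw2 hs
    obtain ⟨i3, e3⟩ := zetaCont_eq_integral ha hb hw3 hs
    have i01 : IntegrableOn (fun t : ℝ => (t : ℂ) ^ (s - 1) * zetaKernel a b w t
      + (t : ℂ) ^ (s - 1) * zetaKernel a b (w + a / 2) t) (Set.Ioi 0) := i0.add i1
    have i012 : IntegrableOn (fun t : ℝ => (t : ℂ) ^ (s - 1) * zetaKernel a b w t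
      + (t : ℂ) ^ (s - 1) * zetaKernel a b (w + a / 2) t
      + (t : ℂ) ^ (s - 1) * zetaKernel a b (w + b / 2) t) (Set.Ioi 0) := i01.add i2
    rw [(zetaCont_eq_integral ha2 hb2 hw hs).2, e0, e1, e2, e3, ← mul_add, ← mul_add, ← mul_add,
      ← integral_add i0 i1, ← integral_add i01 i2, ← integral_add i012 i3]
    congr 1
    refine setIntegral_congr_fun measurableSet_Ioi fun t ht => ?_
    simp only [zetaKernel_half ha hb w ht]
    ring

/-- Halving the periods and then scaling by 2. The quadratic polynomial multiplying log 2 is the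
source of the Gaussian factor in the Selberg laws and of the lognormal factor of the limit. -/
theorem logDoubleGamma_two_mul {a b : ℝ} (ha : 0 < a) (hb : 0 < b) {w : ℂ} (hw : 0 < w.re) :
    logDoubleGamma a b (2 * w) = logDoubleGamma a b w + logDoubleGamma a b (w + a / 2)
      + logDoubleGamma a b (w + b / 2) + logDoubleGamma a b (w + (a + b) / 2)
      - Real.log 2 * kernelCoeffZero (a / 2) (b / 2) w := by
  have := logDoubleGamma_scale (half_pos ha) (half_pos hb) two_pos hw
  rw [mul_div_cancel₀ _ two_ne_zero, mul_div_cancel₀ _ two_ne_zero, logDoubleGamma_half ha hb hw] at this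
  simpa using this

/-! ### Newton interpolation and asymptotics of log Γ₂ -/

/-- The remainder of second order Newton interpolation of `u ↦ e^(-ut)` at `0, 1, 2`. -/
noncomputable def newtonRem (u : ℂ) (t : ℝ) : ℂ :=
  Complex.exp (-u * t) - 1 - u * (Complex.exp (-t) - 1)
    - u * (u - 1) / 2 * (Complex.exp (-t) - 1) ^ 2

/-- Interpolation at 0, 1, 2 is exact on quadratics in the exponent, so the second order Taylor
polynomials in t cancel. Each of e^{-ut}, e^{-t}, e^{-2t} may then be replaced by its Taylor
remainder O(t³). -/
theorem exists_norm_newtonRem_le (u : ℂ) : ∃ C : ℝ, 0 ≤ C ∧ ∀ t : ℝ, 0 < t →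
    ‖newtonRem u t‖ ≤ C * t ^ 3 * Real.exp ((‖u‖ + 2) * t) := by
  have hr : ∀ v : ℂ, ‖v‖ ≤ ‖u‖ + 2 → ∀ t : ℝ, 0 < t →
      ‖Complex.exp (-v * t) - (1 - v * t + v ^ 2 * t ^ 2 / 2)‖
        ≤ ‖v‖ ^ 3 * (t ^ 3 * Real.exp ((‖u‖ + 2) * t)) := by
    intro v hv t ht
    have h := Complex.norm_exp_sub_sum_le_norm_mul_exp (-v * t) 3
    simp only [Finset.sum_range_succ, Finset.sum_range_zero, Nat.factorial] at h
    have hn : ‖-v * t‖ = ‖v‖ * t := by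
      rw [norm_mul, norm_neg, Complex.norm_real, Real.norm_eq_abs, abs_of_pos ht]
    rw [hn] at h
    calc _ = _ := by congr 1; push_cast; ring
      _ ≤ _ := h
      _ ≤ (‖v‖ * t) ^ 3 * Real.exp ((‖u‖ + 2) * t) := by gcongr
      _ = _ := by ring
  set c := u * (u - 1) / 2 with hc
  refine ⟨‖u‖ ^ 3 + ‖2 * c - u‖ + 8 * ‖c‖, by positivity, fun t ht => ?_⟩
  have h2 : Complex.exp (-2 * t) = Complex.exp (-t) ^ 2 := by
    rw [← Complex.exp_nat_mul]; push_cast; ring_nf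
  have key : newtonRem u t = (Complex.exp (-u * t) - (1 - u * t + u ^ 2 * t ^ 2 / 2))
      + (2 * c - u) * (Complex.exp (-1 * t) - (1 - 1 * t + 1 ^ 2 * t ^ 2 / 2))
      - c * (Complex.exp (-2 * t) - (1 - 2 * t + 2 ^ 2 * t ^ 2 / 2)) := by
    simp only [newtonRem, h2, neg_one_mul, hc]; ring
  have r0 := hr u (by linarith) t ht
  have r1 := hr 1 (by rw [norm_one]; linarith [norm_nonneg u]) t ht
  have r2 := hr 2 (by rw [Complex.norm_ofNat]; linarith [norm_nonneg u]) t ht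
  rw [norm_one] at r1
  rw [Complex.norm_ofNat] at r2
  rw [key]
  set X := t ^ 3 * Real.exp ((‖u‖ + 2) * t)
  calc _ ≤ ‖u‖ ^ 3 * X + ‖2 * c - u‖ * (1 ^ 3 * X) + ‖c‖ * (2 ^ 3 * X) := by
        refine (norm_sub_le _ _).trans (add_le_add ((norm_add_le _ _).trans (add_le_add r0 ?_)) ?_)
        · rw [norm_mul]; gcongr
        · rw [norm_mul]; gcongr
    _ = _ := by ring

theorem newton_logDoubleGamma_eq_integral {u w : ℂ} (hw : 0 < w.re) (hwu : 0 < (w + u).re) :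
    IntegrableOn (fun t : ℝ => Complex.exp (-w * t) * newtonRem u t
      / (1 - Complex.exp (-t)) ^ 2 / t) (Set.Ioi 0) ∧
    logDoubleGamma 1 1 (w + u) - logDoubleGamma 1 1 w
      - u * (logDoubleGamma 1 1 (w + 1) - logDoubleGamma 1 1 w)
      - u * (u - 1) / 2 * (logDoubleGamma 1 1 w - 2 * logDoubleGamma 1 1 (w + 1)
        + logDoubleGamma 1 1 (w + 2))
    = ∫ t in Set.Ioi (0 : ℝ), Complex.exp (-w * t) * newtonRem u t
      / (1 - Complex.exp (-t)) ^ 2 / t := by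
  have h := sum_mul_logDoubleGamma_of_sq one_pos one_pos
    ![1, -1 + u - u * (u - 1) / 2, -u + u * (u - 1), -(u * (u - 1) / 2)] ![w + u, w, w + 1, w + 2]
    (by intro i; fin_cases i <;> simp at hwu ⊢ <;> linarith)
    (by simp [Fin.sum_univ_four]; ring) (by simp [Fin.sum_univ_four]; ring)
    (by simp [Fin.sum_univ_four]; ring)
  simp only [Fin.sum_univ_four, Matrix.cons_val_zero, Matrix.cons_val_one, Matrix.cons_val] at h
  have key : ∀ t : ℝ, 1 * zetaKernel 1 1 (w + u) t
      + (-1 + u - u * (u - 1) / 2) * zetaKernel 1 1 w t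
      + (-u + u * (u - 1)) * zetaKernel 1 1 (w + 1) t + -(u * (u - 1) / 2) * zetaKernel 1 1 (w + 2) t
      = Complex.exp (-w * t) * newtonRem u t / (1 - Complex.exp (-t)) ^ 2 := by
    intro t
    have e2 : Complex.exp (-2 * t) = Complex.exp (-t) ^ 2 := by
      rw [← Complex.exp_nat_mul]; push_cast; ring_nf
    simp only [zetaKernel_add, zetaKernel_one_one, neg_one_mul, e2, newtonRem]
    ring
  simp only [key] at h
  exact ⟨h.1, by rw [← h.2]; ring⟩

theorem integral_exp_neg_mul_Ioi_zero {k : ℝ} (hk : 0 < k) (C : ℝ) :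
    ∫ t in Set.Ioi (0 : ℝ), C * Real.exp (-k * t) = C / k := by
  rw [integral_const_mul, integral_exp_mul_Ioi (by linarith)]
  simp [div_eq_mul_inv]

theorem norm_one_sub_cexp_neg_ge (t : ℝ) :
    t * Real.exp (-t) ≤ ‖1 - Complex.exp (-t)‖ := by
  have : (1 - Complex.exp (-t)) = ((1 - Real.exp (-t) : ℝ) : ℂ) := by push_cast; ring_nf
  rw [this, Complex.norm_real]
  refine le_trans ?_ (le_abs_self _)
  have h1 := Real.add_one_le_exp t
  have h2 : (1 + t) * Real.exp (-t) ≤ 1 := by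
    rw [Real.exp_neg, mul_inv_le_iff₀ (Real.exp_pos t)]; linarith
  linarith

/-- For n > 2|k| one has n - k ≥ n/2, which costs the factor 2^p. -/
theorem eventually_le_div_of_le_div_sub {g : ℕ → ℝ} {C k : ℝ} (hC : 0 ≤ C) (p : ℕ)
    (h : ∀ n : ℕ, k < n → g n ≤ C / (n - k) ^ p) :
    ∃ C' : ℝ, ∀ᶠ n : ℕ in atTop, g n ≤ C' / (n : ℝ) ^ p := by
  refine ⟨C * 2 ^ p, ?_⟩
  filter_upwards [(tendsto_natCast_atTop_atTop (R := ℝ)).eventually_gt_atTop (2 * |k|),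
    eventually_gt_atTop 0] with n hn hn0
  have hk := le_abs_self k
  have hk0 := abs_nonneg k
  have hn0' : (0 : ℝ) < n := by exact_mod_cast hn0
  refine (h n (by linarith)).trans ?_
  rw [mul_div_assoc, ← div_pow, div_eq_mul_inv, ← inv_pow]
  have : ((n : ℝ) - k)⁻¹ ≤ 2 / n := by
    rw [inv_le_comm₀ (by linarith) (by positivity), inv_div]; linarith
  have h3 : 0 < (n : ℝ) - k := by linarith
  gcongr

/-- The logarithm of `Γ(w) / √(2π)`, written through the double gamma function. -/
noncomputable def logGammaDiff (w : ℂ) : ℂ := logDoubleGamma 1 1 w - logDoubleGamma 1 1 (w + 1)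

theorem logGammaDiff_add_one {w : ℂ} (hw : 0 < w.re) :
    logGammaDiff (w + 1) = logGammaDiff w + Complex.log w := by
  have := logDoubleGamma_second_difference hw
  simp only [logGammaDiff]
  rw [show w + 1 + 1 = w + 2 by ring]
  linear_combination -this

theorem logDoubleGamma_add_one (w : ℂ) :
    logDoubleGamma 1 1 (w + 1) = logDoubleGamma 1 1 w - logGammaDiff w := by
  simp only [logGammaDiff]; ring

/-- The t³ of the remainder cancels (1 - e^{-t})² t in the denominator, leaving an exponential of
rate n - ‖u‖ - 4: the growth ‖u‖ + 2 comes from the remainder, and 2 from the bound 1 - e^{-t} ≥ t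
e^{-t} used twice. -/
theorem newton_logDoubleGamma (u : ℂ) : ∃ C : ℝ, ∀ᶠ n : ℕ in atTop,
    ‖logDoubleGamma 1 1 (n + u) - logDoubleGamma 1 1 n + u * logGammaDiff n
      + u * (u - 1) / 2 * Complex.log n‖ ≤ C / (n : ℝ) ^ 1 := by
  obtain ⟨C, hC0, hC⟩ := exists_norm_newtonRem_le u
  refine eventually_le_div_of_le_div_sub (C := C) (k := ‖u‖ + 4) hC0 1 fun n hn => ?_
  have hn0 : (0 : ℝ) < n := by linarith [norm_nonneg u]
  have hre : 0 < ((n : ℂ) + u).re := by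
    have := (abs_le.1 (Complex.abs_re_le_norm u)).1
    simp; linarith
  have hw : 0 < ((n : ℂ)).re := by simpa using hn0
  obtain ⟨-, h2⟩ := newton_logDoubleGamma_eq_integral hw hre
  rw [logDoubleGamma_second_difference hw] at h2
  have e : logDoubleGamma 1 1 (n + u) - logDoubleGamma 1 1 n + u * logGammaDiff n
      + u * (u - 1) / 2 * Complex.log n
      = ∫ t in Set.Ioi (0 : ℝ), Complex.exp (-n * t) * newtonRem u t
      / (1 - Complex.exp (-t)) ^ 2 / t := by
    rw [← h2, logDoubleGamma_add_one]; ring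
  rw [e, pow_one, ← integral_exp_neg_mul_Ioi_zero (by linarith)]
  refine norm_integral_le_of_norm_le (integrableOn_mul_exp_neg (by linarith) C) ?_
  refine (ae_restrict_iff' measurableSet_Ioi).2 (Eventually.of_forall fun t ht => ?_)
  have ht' : (0 : ℝ) < t := ht
  have hb := norm_one_sub_cexp_neg_ge t
  rw [norm_div, norm_div, norm_mul, norm_pow, Complex.norm_real, Real.norm_eq_abs, abs_of_pos ht',
    Complex.norm_exp]
  simp only [Complex.mul_re, Complex.neg_re, Complex.natCast_re, Complex.ofReal_re,
    Complex.neg_im, Complex.ofReal_im, mul_zero, sub_zero]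
  calc _ ≤ Real.exp (-n * t) * (C * t ^ 3 * Real.exp ((‖u‖ + 2) * t)) / (t * Real.exp (-t)) ^ 2 / t := by
        have := hC t ht'
        gcongr
    _ = C * (Real.exp (-n * t) * Real.exp ((‖u‖ + 2) * t) / (Real.exp (-t)) ^ 2) := by field_simp
    _ = _ := by
        rw [← Real.exp_nat_mul, ← Real.exp_add, ← Real.exp_sub]
        congr 2; push_cast; ring

/-- Subtracting the formula at n + 1 from that at n removes one factor 1 - e^{-t} from the
denominator. The integrand gains a factor t, hence the integral a factor 1/n; this second order is
needed because the estimate is later multiplied by n. -/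
theorem newton_logGammaDiff (u : ℂ) : ∃ C : ℝ, ∀ᶠ n : ℕ in atTop,
    ‖logGammaDiff (n + u) - logGammaDiff n - u * Complex.log n
      - u * (u - 1) / 2 * (Complex.log (n + 1) - Complex.log n)‖ ≤ C / (n : ℝ) ^ 2 := by
  obtain ⟨C, hC0, hC⟩ := exists_norm_newtonRem_le u
  refine eventually_le_div_of_le_div_sub (C := 4 * C) (k := ‖u‖ + 3) (by positivity) 2
    fun n hn => ?_
  have hn0 : (0 : ℝ) < n := by linarith [norm_nonneg u]
  have hre : 0 < ((n : ℂ) + u).re := by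
    have := (abs_le.1 (Complex.abs_re_le_norm u)).1
    simp; linarith
  have hw : 0 < ((n : ℂ)).re := by simpa using hn0
  have hw1 : 0 < ((n : ℂ) + 1).re := by simp; linarith
  have hre1 : 0 < ((n : ℂ) + 1 + u).re := by simp at hre ⊢; linarith
  obtain ⟨i1, h1⟩ := newton_logDoubleGamma_eq_integral hw hre
  obtain ⟨i2, h2⟩ := newton_logDoubleGamma_eq_integral hw1 hre1
  have e : logGammaDiff (n + u) - logGammaDiff n - u * Complex.log n
      - u * (u - 1) / 2 * (Complex.log (n + 1) - Complex.log n)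
      = ∫ t in Set.Ioi (0 : ℝ), (Complex.exp (-n * t) * newtonRem u t
      / (1 - Complex.exp (-t)) ^ 2 / t - Complex.exp (-(n + 1) * t) * newtonRem u t
      / (1 - Complex.exp (-t)) ^ 2 / t) := by
    rw [integral_sub i1 i2, ← h1, ← h2, logDoubleGamma_second_difference hw,
      logDoubleGamma_second_difference hw1, logDoubleGamma_add_one ((n : ℂ) + 1),
      logGammaDiff_add_one hw, logDoubleGamma_add_one, logGammaDiff,
      show (n : ℂ) + 1 + u = n + u + 1 by ring]
    ring
  have hk : 0 < (n : ℝ) - (‖u‖ + 3) := by linarith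
  have e3 : 4 * C / ((n : ℝ) - (‖u‖ + 3)) ^ 2
      = (C * (2 / ((n : ℝ) - (‖u‖ + 3)))) / (((n : ℝ) - (‖u‖ + 3)) / 2) := by
    field_simp; ring
  rw [e, e3, ← integral_exp_neg_mul_Ioi_zero (by positivity)]
  refine norm_integral_le_of_norm_le (integrableOn_mul_exp_neg (by positivity) _) ?_
  refine (ae_restrict_iff' measurableSet_Ioi).2 (Eventually.of_forall fun t ht => ?_)
  have ht' : (0 : ℝ) < t := ht
  have hb := norm_one_sub_cexp_neg_ge t
  have h0 : 1 - Complex.exp (-t) ≠ 0 := by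
    simpa using one_sub_cexp_neg_ne_zero one_pos ht'
  have e4 : Complex.exp (-n * t) * newtonRem u t
      / (1 - Complex.exp (-t)) ^ 2 / t - Complex.exp (-(n + 1) * t) * newtonRem u t
      / (1 - Complex.exp (-t)) ^ 2 / t
      = Complex.exp (-n * t) * newtonRem u t / (1 - Complex.exp (-t)) / t := by
    have : Complex.exp (-(n + 1) * t) = Complex.exp (-n * t) * Complex.exp (-t) := by
      rw [← Complex.exp_add]; ring_nf
    rw [this]; field_simp
  set k := (n : ℝ) - (‖u‖ + 3) with hkdef
  rw [e4, norm_div, norm_div, norm_mul, Complex.norm_real, Real.norm_eq_abs, abs_of_pos ht',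
    Complex.norm_exp]
  simp only [Complex.mul_re, Complex.neg_re, Complex.natCast_re, Complex.ofReal_re,
    Complex.neg_im, Complex.ofReal_im, mul_zero, sub_zero]
  calc _ ≤ Real.exp (-n * t) * (C * t ^ 3 * Real.exp ((‖u‖ + 2) * t)) / (t * Real.exp (-t)) / t := by
        have := hC t ht'
        gcongr
    _ = C * t * (Real.exp (-n * t) * Real.exp ((‖u‖ + 2) * t) / (Real.exp (-t))) := by field_simp
    _ = C * t * Real.exp (-k * t) := by
        rw [← Real.exp_add, ← Real.exp_sub]
        congr 2; rw [hkdef]; ring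
    _ ≤ C * (2 / k * Real.exp (k / 2 * t)) * Real.exp (-k * t) := by
        have h1 : t ≤ 2 / k * Real.exp (k / 2 * t) := by
          have := Real.add_one_le_exp (k / 2 * t)
          calc t = 2 / k * (k / 2 * t) := by field_simp
            _ ≤ _ := by gcongr; linarith
        gcongr
    _ = C * (2 / k) * (Real.exp (k / 2 * t) * Real.exp (-k * t)) := by ring
    _ = _ := by rw [← Real.exp_add]; congr 2; ring

/-! ### Identification with Γ, and Stirling's formula -/

/-- Duplication at w = 1/2 and at w = 1: in the difference all values of log Γ₂ cancel except those
at 1/2 and 3/2. This fixes the constant between Γ₂(w)/Γ₂(w+1) and Γ(w). -/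
theorem logGammaDiff_one_half : logGammaDiff (1 / 2) = -(Real.log 2 / 2 : ℝ) := by
  have h1 := logDoubleGamma_two_mul one_pos one_pos (w := 1 / 2) (by norm_num)
  have h2 := logDoubleGamma_two_mul one_pos one_pos (w := 1) (by norm_num)
  norm_num [kernelCoeffZero] at h1 h2
  simp only [logGammaDiff]
  norm_num
  linear_combination h2 - h1

theorem logGammaDiff_add_nat {w : ℂ} (hw : 0 < w.re) (n : ℕ) :
    Complex.exp (logGammaDiff (w + n)) =
      Complex.exp (logGammaDiff w) * ∏ j ∈ Finset.range n, (w + j) := by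
  induction n with
  | zero => simp
  | succ n ih =>
    have hre : 0 < (w + n).re := by simp; positivity
    have h0 : w + n ≠ 0 := fun h => by rw [h] at hre; simp at hre
    rw [Finset.prod_range_succ, ← mul_assoc, ← ih]
    push_cast
    rw [← add_assoc, logGammaDiff_add_one hre, Complex.exp_add, Complex.exp_log h0]

theorem tendsto_of_norm_le_div_pow {g : ℕ → ℂ} {C : ℝ} {p : ℕ} (hp : p ≠ 0)
    (h : ∀ᶠ n : ℕ in atTop, ‖g n‖ ≤ C / (n : ℝ) ^ p) : Tendsto g atTop (𝓝 0) := by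
  refine squeeze_zero_norm' h ?_
  exact Tendsto.const_div_atTop ((tendsto_pow_atTop hp).comp tendsto_natCast_atTop_atTop) C

theorem tendsto_log_succ_sub_log :
    Tendsto (fun n : ℕ => Complex.log ((n : ℂ) + 1) - Complex.log n) atTop (𝓝 0) := by
  have h := Real.tendsto_log_nat_add_one_sub_log
  have h2 := (Complex.continuous_ofReal.tendsto 0).comp h
  rw [Complex.ofReal_zero] at h2
  refine h2.congr fun n => ?_
  simp only [Function.comp]
  rw [Complex.ofReal_sub, Complex.ofReal_log (by positivity), Complex.ofReal_log (by positivity)]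
  push_cast; rfl

/-- The recursion w ↦ w + 1 together with `logGammaDiff` (n + w) - `logGammaDiff` n - w log n → 0
reproduces Gauss's limit for Γ(w), up to the value at 1. -/
theorem exp_logGammaDiff_div {w : ℂ} (hw : 0 < w.re) :
    Complex.exp (logGammaDiff w) = Complex.exp (logGammaDiff 1) * Complex.Gamma w := by
  obtain ⟨C, hC⟩ := newton_logGammaDiff w
  have t1 := tendsto_of_norm_le_div_pow two_ne_zero hC
  have t2 : Tendsto (fun n : ℕ => logGammaDiff (n + w) - logGammaDiff n - w * Complex.log n)
      atTop (𝓝 0) := by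
    have := t1.add (tendsto_log_succ_sub_log.const_mul (w * (w - 1) / 2))
    simpa using this
  have t3 := (Complex.continuous_exp.tendsto 0).comp t2
  rw [Complex.exp_zero] at t3
  -- Gauss's sequence has n + 1 factors in its denominator, so the asymptotics is taken at n + 1;
  -- replacing log(n+1) by log n costs a factor tending to 1.
  have t4 := (t3.comp (tendsto_add_atTop_nat 1))
  have hpow : Tendsto (fun n : ℕ => Complex.exp (w * (Complex.log ((n : ℂ) + 1) - Complex.log n)))
      atTop (𝓝 1) := by
    have := (Complex.continuous_exp.tendsto _).comp (tendsto_log_succ_sub_log.const_mul w)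
    simpa [Function.comp_def] using this
  have t5 := (Complex.GammaSeq_tendsto_Gamma w).mul ((t4.mul hpow).const_mul
    (Complex.exp (logGammaDiff 1)))
  rw [mul_one, mul_one, mul_comm] at t5
  refine tendsto_nhds_unique (tendsto_const_nhds.congr' ?_) t5
  filter_upwards [eventually_gt_atTop 0] with n hn
  have hn' : (n : ℂ) ≠ 0 := by exact_mod_cast hn.ne'
  have hn1 : (n : ℂ) + 1 ≠ 0 := by exact_mod_cast n.succ_ne_zero
  have e1 := logGammaDiff_add_nat hw (n + 1)
  have e2 := logGammaDiff_add_nat (w := 1) (by simp) n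
  have e3 : ∏ j ∈ Finset.range n, ((1 : ℂ) + j) = (n.factorial : ℂ) := by
    rw [← Finset.prod_range_add_one_eq_factorial]; push_cast
    exact Finset.prod_congr rfl fun j _ => add_comm _ _
  rw [e3] at e2
  simp only [Function.comp, Complex.GammaSeq]
  push_cast at e1 ⊢
  rw [show (n : ℂ) + 1 + w = w + (n + 1) by ring, Complex.exp_sub, Complex.exp_sub, mul_sub,
    Complex.exp_sub, e1, add_comm (n : ℂ) 1, e2, Complex.cpow_def_of_ne_zero hn',
    mul_comm (Complex.log (n : ℂ)) w]
  have hp : ∏ j ∈ Finset.range (n + 1), (w + j) ≠ 0 := by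
    refine Finset.prod_ne_zero_iff.2 fun j _ h => ?_
    have := congrArg Complex.re h
    simp at this
    linarith [(Nat.cast_nonneg j : (0 : ℝ) ≤ j)]
  have hf : (n.factorial : ℂ) ≠ 0 := by exact_mod_cast n.factorial_ne_zero
  have x1 := Complex.exp_ne_zero (logGammaDiff 1)
  have x2 := Complex.exp_ne_zero (w * Complex.log n)
  have x3 := Complex.exp_ne_zero (w * Complex.log (1 + (n : ℂ)))
  field_simp

theorem exp_logGammaDiff_one :
    Complex.exp (logGammaDiff 1) = ((Real.sqrt (2 * Real.pi))⁻¹ : ℝ) := by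
  have h := exp_logGammaDiff_div (w := 1 / 2) (by norm_num)
  rw [logGammaDiff_one_half, Complex.Gamma_one_half_eq, ← Complex.ofReal_neg, ← Complex.ofReal_exp] at h
  have e : Real.exp (-(Real.log 2 / 2)) = (Real.sqrt 2)⁻¹ := by
    rw [Real.exp_neg, Real.sqrt_eq_rpow, Real.rpow_def_of_pos two_pos]; ring_nf
  have e2 : (Real.pi : ℂ) ^ (1 / 2 : ℂ) = ((Real.sqrt Real.pi : ℝ) : ℂ) := by
    rw [Real.sqrt_eq_rpow, Complex.ofReal_cpow Real.pi_pos.le]; norm_num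
  rw [e, e2] at h
  have hpi : ((Real.sqrt Real.pi : ℝ) : ℂ) ≠ 0 := by
    exact_mod_cast (Real.sqrt_pos.2 Real.pi_pos).ne'
  rw [Real.sqrt_mul two_pos.le, mul_inv]
  rw [Complex.ofReal_mul, h, Complex.ofReal_inv]
  field_simp

theorem exp_logGammaDiff {w : ℂ} (hw : 0 < w.re) :
    Complex.exp (logGammaDiff w) = ((Real.sqrt (2 * Real.pi))⁻¹ : ℝ) * Complex.Gamma w := by
  rw [exp_logGammaDiff_div hw, exp_logGammaDiff_one]

theorem conj_zetaKernelReg (a b x t : ℝ) :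
    (starRingEnd ℂ) (zetaKernelReg a b x t) = zetaKernelReg a b x t := by
  simp [zetaKernelReg, zetaKernel, kernelPolar, kernelCoeffOne, kernelCoeffZero,
    ← Complex.exp_conj, Complex.conj_ofReal, map_ofNat]

theorem conj_logDoubleGamma (a b x : ℝ) :
    (starRingEnd ℂ) (logDoubleGamma a b x) = logDoubleGamma a b x := by
  unfold logDoubleGamma
  simp only [map_sub, map_add, map_mul, ← integral_conj, map_div₀, conj_zetaKernelReg,
    Complex.conj_ofReal, kernelCoeffOne, map_inv₀, map_ofNat, map_one]

theorem logDoubleGamma_ofReal (a b x : ℝ) :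
    logDoubleGamma a b x = ((logDoubleGamma a b x).re : ℂ) :=
  (Complex.conj_eq_iff_re.1 (conj_logDoubleGamma a b x)).symm

/-- The exponential determines the value only modulo 2πi. Invariance of log Γ₂ under conjugation at
real arguments makes the value real and removes the ambiguity. -/
theorem logGammaDiff_one : logGammaDiff 1 = ((-(Real.log (2 * Real.pi) / 2) : ℝ) : ℂ) := by
  have h1 : logGammaDiff 1 = ((logGammaDiff 1).re : ℂ) := by
    have e1 := logDoubleGamma_ofReal 1 1 1
    have e2 := logDoubleGamma_ofReal 1 1 2
    simp only [Complex.ofReal_one, Complex.ofReal_ofNat] at e1 e2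
    simp only [logGammaDiff]
    norm_num
    rw [e1, e2]; simp
  have h2 := exp_logGammaDiff_one
  rw [h1, ← Complex.ofReal_exp] at h2
  have h3 := Complex.ofReal_injective h2
  have h4 := congrArg Real.log h3
  rw [Real.log_exp, Real.log_inv, Real.log_sqrt (by positivity)] at h4
  rw [h1, h4]

theorem logGammaDiff_nat_add_one (n : ℕ) :
    logGammaDiff (n + 1) = ((Real.log n.factorial - Real.log (2 * Real.pi) / 2 : ℝ) : ℂ) := by
  induction n with
  | zero => simp [logGammaDiff_one]
  | succ n ih =>
    have hre : 0 < ((n : ℂ) + 1).re := by simp; positivity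
    have e : Real.log (n + 1).factorial = Real.log (n + 1) + Real.log n.factorial := by
      rw [Nat.factorial_succ, Nat.cast_mul, Real.log_mul (by positivity) (by positivity)]
      push_cast; ring
    have hl : Complex.log ((n : ℂ) + 1) = ((Real.log (n + 1) : ℝ) : ℂ) := by
      rw [Complex.ofReal_log (by positivity)]; push_cast; rfl
    rw [Nat.cast_add_one, logGammaDiff_add_one hre, ih, e, hl]
    simp only [Complex.ofReal_sub, Complex.ofReal_add]
    ring

theorem log_nat_add_one (n : ℕ) : Complex.log ((n : ℂ) + 1) = ((Real.log (n + 1) : ℝ) : ℂ) := by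
  rw [Complex.ofReal_log (by positivity)]; push_cast; rfl

theorem tendsto_nat_mul_log_succ_sub_log :
    Tendsto (fun n : ℕ => (n : ℝ) * (Real.log (n + 1) - Real.log n)) atTop (𝓝 1) := by
  have h : Tendsto (fun x : ℝ => x * (1 / x)) atTop (𝓝 1) :=
    tendsto_const_nhds.congr' (by
      filter_upwards [eventually_gt_atTop 0] with x hx
      field_simp)
  have := (Real.tendsto_mul_log_one_add_of_tendsto h).comp (tendsto_natCast_atTop_atTop (R := ℝ))
  refine this.congr' ?_
  filter_upwards [eventually_gt_atTop 0] with n hn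
  have hn' : (0 : ℝ) < n := by exact_mod_cast hn
  simp only [Function.comp]
  rw [← Real.log_div (by positivity) (by positivity)]
  congr 2
  field_simp

theorem tendsto_nat_mul_log_add_two_sub_log :
    Tendsto (fun n : ℕ => (n : ℝ) * (Real.log (n + 2) - Real.log (n + 1))) atTop (𝓝 1) := by
  have h := (tendsto_nat_mul_log_succ_sub_log.comp (tendsto_add_atTop_nat 1))
  have h2 := Real.tendsto_log_nat_add_one_sub_log.comp (tendsto_add_atTop_nat 1)
  have := h.sub h2
  rw [sub_zero] at this
  refine this.congr fun n => ?_
  simp only [Function.comp]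
  push_cast
  rw [show (n : ℝ) + 1 + 1 = n + 2 by ring]
  ring

/-- Stirling's formula with log n replaced by log(n+1); the replacement contributes -n(log(n+1) -
log n) → -1. -/
theorem tendsto_log_factorial_stirling :
    Tendsto (fun n : ℕ => Real.log n.factorial - n * Real.log (n + 1) + n - Real.log (n + 1) / 2)
      atTop (𝓝 (Real.log (2 * Real.pi) / 2 - 1)) := by
  have hpi : 0 < Real.sqrt Real.pi := Real.sqrt_pos.2 Real.pi_pos
  have h1 := (Real.continuousAt_log hpi.ne').tendsto.comp Stirling.tendsto_stirlingSeq_sqrt_pi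
  have h2 := (h1.sub tendsto_nat_mul_log_succ_sub_log).sub
    (Real.tendsto_log_nat_add_one_sub_log.div_const 2)
  have h3 := h2.add_const (Real.log 2 / 2)
  have e : Real.log (Real.sqrt Real.pi) - 1 - 0 / 2 + Real.log 2 / 2
      = Real.log (2 * Real.pi) / 2 - 1 := by
    rw [Real.log_sqrt Real.pi_pos.le, Real.log_mul two_ne_zero Real.pi_ne_zero]; ring
  rw [e] at h3
  refine h3.congr' ?_
  filter_upwards [eventually_gt_atTop 0] with n hn
  have hn' : (n : ℝ) ≠ 0 := by exact_mod_cast hn.ne'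
  simp only [Function.comp]
  rw [Stirling.log_stirlingSeq_formula, Real.log_div hn' (Real.exp_ne_zero _), Real.log_exp,
    Real.log_mul two_ne_zero hn']
  ring

/-! ### The Barnes G-function -/

/-- The factors of the Weierstrass product of `u ↦ G(1 + u)`. -/
noncomputable def barnesFactor (k : ℕ) (u : ℂ) : ℂ :=
  (1 + u / ((k : ℂ) + 1)) ^ (k + 1) * Complex.exp (u ^ 2 / (2 * ((k : ℂ) + 1)) - u)

/-- With x = u/(k+1), the factor is the exponential of (k+1)(log(1+x) - x + x²/2), which is
O(|u|³/(k+1)²). The bound is uniform on balls, so the product converges locally uniformly and is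
entire. -/
theorem eventually_norm_barnesFactor_sub_one_le {R : ℝ} (hR : 0 ≤ R) : ∀ᶠ k : ℕ in atTop,
    ∀ u ∈ Metric.ball (0 : ℂ) R, ‖barnesFactor k u - 1‖ ≤ R ^ 3 * Real.exp (R ^ 3) * (1 / ((k : ℝ) + 1) ^ 2) := by
  filter_upwards [(tendsto_natCast_atTop_atTop (R := ℝ)).eventually_gt_atTop (2 * R)] with k hk u hu
  have hu' : ‖u‖ ≤ R := by simpa using (Metric.mem_ball.1 hu).le
  have hk1 : (0 : ℝ) < (k : ℝ) + 1 := by positivity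
  have hk1' : (k : ℂ) + 1 ≠ 0 := by exact_mod_cast hk1.ne'
  set x := u / ((k : ℂ) + 1) with hx
  have hnk : ‖(k : ℂ) + 1‖ = (k : ℝ) + 1 := by
    have : (k : ℂ) + 1 = (((k : ℝ) + 1 : ℝ) : ℂ) := by push_cast; ring
    rw [this, Complex.norm_real, Real.norm_eq_abs, abs_of_pos hk1]
  have hxn : ‖x‖ ≤ R / (k + 1) := by rw [hx, norm_div, hnk]; gcongr
  have hx2 : ‖x‖ ≤ 1 / 2 := hxn.trans (by rw [div_le_iff₀ hk1]; linarith)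
  have hlog := Complex.norm_log_sub_logTaylor_le 2 (show ‖x‖ < 1 by linarith)
  have hne : 1 + x ≠ 0 := by
    intro h
    have : x = -1 := by linear_combination h
    rw [this] at hx2; norm_num at hx2
  have hT : Complex.logTaylor 3 x = x - x ^ 2 / 2 := by
    simp [Complex.logTaylor, Finset.sum_range_succ]; ring
  norm_num at hlog
  rw [hT] at hlog
  have hlog' : ‖Complex.log (1 + x) - (x - x ^ 2 / 2)‖ ≤ ‖x‖ ^ 3 := by
    refine hlog.trans ?_
    have : (1 - ‖x‖)⁻¹ ≤ 2 := by rw [inv_le_comm₀ (by linarith) (by norm_num)]; linarith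
    have h3 : 0 ≤ ‖x‖ ^ 3 := by positivity
    nlinarith
  set E := ((k : ℂ) + 1) * (Complex.log (1 + x) - (x - x ^ 2 / 2)) with hE
  have hEn : ‖E‖ ≤ R ^ 3 * (1 / ((k : ℝ) + 1) ^ 2) := by
    rw [hE, norm_mul, hnk]
    calc _ ≤ ((k : ℝ) + 1) * (R / (k + 1)) ^ 3 := by
          have := hlog'.trans (pow_le_pow_left₀ (norm_nonneg _) hxn 3)
          gcongr
      _ = _ := by field_simp
  have hf : barnesFactor k u = Complex.exp E := by
    have e1 : ((k : ℂ) + 1) * Complex.log (1 + x) = ((k + 1 : ℕ) : ℂ) * Complex.log (1 + x) := by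
      push_cast; ring
    have e2 : E = ((k + 1 : ℕ) : ℂ) * Complex.log (1 + x) + (u ^ 2 / (2 * ((k : ℂ) + 1)) - u) := by
      rw [← e1, hE, hx]; field_simp; ring
    rw [e2, Complex.exp_add, Complex.exp_nat_mul, Complex.exp_log hne]
    rfl
  have h1 := Complex.norm_exp_sub_sum_le_norm_mul_exp E 1
  simp only [Finset.range_one, Finset.sum_singleton, pow_zero, Nat.factorial, Nat.cast_one, div_one,
    pow_one] at h1
  rw [hf]
  refine h1.trans ?_
  have hE3 : ‖E‖ ≤ R ^ 3 := by
    refine hEn.trans (mul_le_of_le_one_right (by positivity) ?_)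
    rw [div_le_one (by positivity)]
    have : (1 : ℝ) ≤ (k : ℝ) + 1 := by linarith [(Nat.cast_nonneg k : (0 : ℝ) ≤ k)]
    exact one_le_pow₀ this
  calc _ ≤ (R ^ 3 * (1 / ((k : ℝ) + 1) ^ 2)) * Real.exp (R ^ 3) := by gcongr
    _ = _ := by ring

theorem summable_one_div_nat_add_one_sq : Summable fun k : ℕ => 1 / ((k : ℝ) + 1) ^ 2 := by
  have := (summable_nat_add_iff 1).2 (Real.summable_one_div_nat_pow.2 (one_lt_two))
  simpa using this

theorem differentiable_barnesFactor (k : ℕ) : Differentiable ℂ (barnesFactor k) := by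
  unfold barnesFactor; fun_prop

theorem hasProdLocallyUniformlyOn_barnesFactor (R : ℝ) (hR : 0 ≤ R) :
    HasProdLocallyUniformlyOn barnesFactor (fun u => ∏' k, barnesFactor k u)
      (Metric.ball (0 : ℂ) R) := by
  have := (summable_one_div_nat_add_one_sq.mul_left
    (R ^ 3 * Real.exp (R ^ 3))).hasProdLocallyUniformlyOn_nat_one_add
      (f := fun k u => barnesFactor k u - 1) (Metric.isOpen_ball (x := (0 : ℂ)) (ε := R))
      (eventually_norm_barnesFactor_sub_one_le hR)
      (fun k => ((differentiable_barnesFactor k).continuous.sub continuous_const).continuousOn)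
  simpa using this

theorem tendsto_prod_barnesFactor (u : ℂ) :
    Tendsto (fun n : ℕ => ∏ k ∈ Finset.range n, barnesFactor k u) atTop
      (𝓝 (∏' k, barnesFactor k u)) :=
  ((hasProdLocallyUniformlyOn_barnesFactor (‖u‖ + 1) (by positivity)).hasProd
    (x := u) (by simp)).tendsto_prod_nat

theorem differentiable_tprod_barnesFactor : Differentiable ℂ fun u => ∏' k, barnesFactor k u := by
  intro u
  have h := (hasProdLocallyUniformlyOn_barnesFactor (‖u‖ + 1) (by positivity))
  have := h.tendstoLocallyUniformlyOn_finsetRange.differentiableOn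
    (Eventually.of_forall fun n => by
      refine DifferentiableOn.fun_finsetProd fun k _ => (differentiable_barnesFactor k).differentiableOn)
    Metric.isOpen_ball
  exact this.differentiableAt (Metric.isOpen_ball.mem_nhds (by simp))

theorem barnesG_eq (z : ℂ) : barnesG z = (2 * Real.pi : ℂ) ^ ((z - 1) / 2) *
    Complex.exp (-((z - 1) + (1 + (Real.eulerMascheroniConstant : ℂ)) * (z - 1) ^ 2) / 2) *
    ∏' k, barnesFactor k (z - 1) := rfl

theorem differentiable_barnesG : Differentiable ℂ barnesG := by
  have h : barnesG = fun z => (2 * Real.pi : ℂ) ^ ((z - 1) / 2) *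
    Complex.exp (-((z - 1) + (1 + (Real.eulerMascheroniConstant : ℂ)) * (z - 1) ^ 2) / 2) *
    (fun u => ∏' k, barnesFactor k u) (z - 1) := rfl
  rw [h]
  have hpi : (2 * Real.pi : ℂ) ≠ 0 := by
    exact_mod_cast (mul_pos two_pos Real.pi_pos).ne'
  refine Differentiable.mul (Differentiable.mul ?_ (by fun_prop)) ?_
  · intro z
    exact DifferentiableAt.const_cpow (by fun_prop) (Or.inl hpi)
  · exact differentiable_tprod_barnesFactor.comp (differentiable_id.sub_const 1)

theorem barnesG_neg_nat (n : ℕ) : barnesG (-n) = 0 := by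
  rw [barnesG_eq, tprod_of_exists_eq_zero, mul_zero]
  refine ⟨n, ?_⟩
  have : (n : ℂ) + 1 ≠ 0 := by exact_mod_cast n.succ_ne_zero
  have e : 1 + (-(n : ℂ) - 1) / (n + 1) = 0 := by field_simp; ring
  simp [barnesFactor, e]

theorem barnesG_one : barnesG 1 = 1 := by
  simp [barnesG_eq, barnesFactor]

/-- The Gauss-type approximations of `G(1 + u)`. -/
noncomputable def barnesSeq (u : ℂ) (n : ℕ) : ℂ :=
  (∏ m ∈ Finset.range n, (Complex.Gamma (1 + m) / Complex.Gamma (1 + u + m))) *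
    Complex.exp (u * Real.log n.factorial + u * (u - 1) / 2 * Real.log (n + 1))

theorem Gamma_ne_zero_of_shift {u : ℂ} (hu : ∀ m : ℕ, 1 + u + m ≠ 0) (n : ℕ) :
    Complex.Gamma (1 + u + n) ≠ 0 := by
  refine Complex.Gamma_ne_zero fun m h => hu (n + m) ?_
  push_cast
  linear_combination h

/-- Multiplicative summation by parts: passing from m to m + 1 divides Γ(1+m)/Γ(1+u+m) by 1 +
u/(m+1), so collecting these quotients produces the powers in the Weierstrass product. -/
theorem prod_Gamma_ratio {u : ℂ} (hu : ∀ m : ℕ, 1 + u + m ≠ 0) (n : ℕ) :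
    ∏ m ∈ Finset.range n, (Complex.Gamma (1 + m) / Complex.Gamma (1 + u + m))
      = (Complex.Gamma (1 + n) / Complex.Gamma (1 + u + n)) ^ n *
        ∏ k ∈ Finset.range n, (1 + u / ((k : ℂ) + 1)) ^ (k + 1) := by
  induction n with
  | zero => simp
  | succ n ih =>
    have h1 : (1 : ℂ) + n ≠ 0 := by rw [add_comm]; exact_mod_cast n.succ_ne_zero
    have e1 : Complex.Gamma (1 + ((n + 1 : ℕ) : ℂ)) = (1 + n) * Complex.Gamma (1 + n) := by
      rw [← Complex.Gamma_add_one _ h1]; push_cast; ring_nf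
    have e2 : Complex.Gamma (1 + u + ((n + 1 : ℕ) : ℂ)) = (1 + u + n) * Complex.Gamma (1 + u + n) := by
      rw [← Complex.Gamma_add_one _ (hu n)]; push_cast; ring_nf
    have g := Gamma_ne_zero_of_shift hu n
    have hu' := hu n
    have e3 : 1 + u / ((n : ℂ) + 1) = (1 + u + n) / (1 + n) := by
      rw [add_comm (n : ℂ) 1]; field_simp; ring
    rw [Finset.prod_range_succ, Finset.prod_range_succ, ih, e1, e2, e3, mul_div_mul_comm, mul_pow,
      pow_succ (Complex.Gamma (1 + n) / Complex.Gamma (1 + u + n)) n]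
    have : ((1 + (n : ℂ)) / (1 + u + n)) ^ (n + 1) * ((1 + u + n) / (1 + n)) ^ (n + 1) = 1 := by
      rw [← mul_pow]; field_simp; simp
    linear_combination (-(Complex.Gamma (1 + n) / Complex.Gamma (1 + u + n)) ^ n *
      (Complex.Gamma (1 + n) / Complex.Gamma (1 + u + n)) *
      ∏ k ∈ Finset.range n, (1 + u / ((k : ℂ) + 1)) ^ (k + 1)) * this

theorem eventually_Gamma_ratio_eq (u : ℂ) : ∀ᶠ n : ℕ in atTop,
    Complex.Gamma (1 + n) / Complex.Gamma (1 + u + n)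
      = Complex.exp (-(logGammaDiff (((n + 1 : ℕ) : ℂ) + u) - logGammaDiff ((n + 1 : ℕ) : ℂ))) := by
  filter_upwards [(tendsto_natCast_atTop_atTop (R := ℝ)).eventually_gt_atTop ‖u‖] with n hn
  have hre : 0 < (((n + 1 : ℕ) : ℂ) + u).re := by
    have := (abs_le.1 (Complex.abs_re_le_norm u)).1
    simp; linarith
  have hre1 : 0 < ((n + 1 : ℕ) : ℂ).re := by simp; positivity
  have hc : ((((Real.sqrt (2 * Real.pi))⁻¹ : ℝ)) : ℂ) ≠ 0 := by
    have : 0 < Real.sqrt (2 * Real.pi) := Real.sqrt_pos.2 (by positivity)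
    exact_mod_cast (inv_pos.2 this).ne'
  rw [neg_sub, Complex.exp_sub, exp_logGammaDiff hre, exp_logGammaDiff hre1,
    mul_div_mul_left _ _ hc]
  push_cast
  ring_nf

/-- After summation by parts, the n-th power of a Γ-ratio is expanded with an error n ρ(n+1) → 0.
Stirling's formula for n!, the limit of n(log(n+2) - log(n+1)) and that of the harmonic sum minus
log(n+1) supply log 2π, the rational constants and Euler's constant of the exponential prefactor of
G. -/
theorem tendsto_barnesSeq {u : ℂ} (hu : ∀ m : ℕ, 1 + u + m ≠ 0) :
    Tendsto (barnesSeq u) atTop (𝓝 (barnesG (1 + u))) := by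
  obtain ⟨C, hC⟩ := newton_logGammaDiff u
  set ρ : ℕ → ℂ := fun n => logGammaDiff (n + u) - logGammaDiff n - u * Complex.log n
      - u * (u - 1) / 2 * (Complex.log (n + 1) - Complex.log n) with hρ
  have hρ1 : Tendsto (fun n : ℕ => (n : ℂ) * ρ n) atTop (𝓝 0) := by
    refine tendsto_of_norm_le_div_pow (C := C) one_ne_zero ?_
    filter_upwards [hC, eventually_gt_atTop 0] with n hn hn0
    have hn0' : (0 : ℝ) < n := by exact_mod_cast hn0
    rw [norm_mul, Complex.norm_natCast]
    calc _ ≤ (n : ℝ) * (C / (n : ℝ) ^ 2) := by gcongr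
      _ = _ := by field_simp
  have hρ0 : Tendsto ρ atTop (𝓝 0) := tendsto_of_norm_le_div_pow two_ne_zero hC
  have hρ2 : Tendsto (fun n : ℕ => (n : ℂ) * ρ (n + 1)) atTop (𝓝 0) := by
    have := (hρ1.comp (tendsto_add_atTop_nat 1)).sub (hρ0.comp (tendsto_add_atTop_nat 1))
    rw [sub_zero] at this
    refine this.congr fun n => ?_
    simp only [Function.comp]; push_cast; ring
  have cR : ∀ {f : ℕ → ℝ} {x : ℝ}, Tendsto f atTop (𝓝 x) →
      Tendsto (fun n => (f n : ℂ)) atTop (𝓝 (x : ℂ)) := fun h =>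
    (Complex.continuous_ofReal.tendsto _).comp h
  have hS := (cR tendsto_log_factorial_stirling).const_mul u
  have hN := (cR tendsto_nat_mul_log_add_two_sub_log).const_mul (u * (u - 1) / 2)
  have hH := (cR Real.tendsto_harmonic_sub_log_add_one).const_mul (u ^ 2 / 2)
  have hE := ((hS.sub hN).sub hH).sub hρ2
  have hP := ((Complex.continuous_exp.tendsto _).comp hE).mul (tendsto_prod_barnesFactor u)
  have hlim : Complex.exp (u * ((Real.log (2 * Real.pi) / 2 - 1 : ℝ) : ℂ) - u * (u - 1) / 2 * ((1 : ℝ) : ℂ)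
      - u ^ 2 / 2 * (Real.eulerMascheroniConstant : ℂ) - 0) * ∏' k, barnesFactor k u
      = barnesG (1 + u) := by
    have hpi : (2 * Real.pi : ℂ) ≠ 0 := by
      exact_mod_cast (mul_pos two_pos Real.pi_pos).ne'
    rw [barnesG_eq, add_sub_cancel_left, Complex.cpow_def_of_ne_zero hpi, ← Complex.exp_add]
    have : Complex.log (2 * Real.pi) = ((Real.log (2 * Real.pi) : ℝ) : ℂ) := by
      rw [Complex.ofReal_log (by positivity)]; push_cast; rfl
    rw [this]
    congr 2
    push_cast
    ring
  rw [hlim] at hP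
  refine hP.congr' ?_
  filter_upwards [eventually_Gamma_ratio_eq u] with n hn
  rw [barnesSeq, prod_Gamma_ratio hu, hn, ← Complex.exp_nat_mul]
  simp only [barnesFactor, Finset.prod_mul_distrib, ← Complex.exp_sum, Finset.sum_sub_distrib,
    Finset.sum_const, Finset.card_range, nsmul_eq_mul, Function.comp]
  have hsum : ∑ k ∈ Finset.range n, u ^ 2 / (2 * ((k : ℂ) + 1)) = u ^ 2 / 2 * ((harmonic n : ℝ) : ℂ) := by
    simp only [harmonic]
    push_cast
    rw [Finset.mul_sum]
    refine Finset.sum_congr rfl fun k _ => ?_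
    have : (k : ℂ) + 1 ≠ 0 := by exact_mod_cast k.succ_ne_zero
    field_simp
  rw [hsum, mul_left_comm, ← Complex.exp_add, mul_right_comm, ← Complex.exp_add, mul_comm]
  congr 2
  have hl1 : Complex.log ((n + 1 : ℕ) : ℂ) = ((Real.log (n + 1) : ℝ) : ℂ) := by
    rw [← log_nat_add_one]; push_cast; rfl
  have hl2 : Complex.log (((n + 1 : ℕ) : ℂ) + 1) = ((Real.log (n + 2) : ℝ) : ℂ) := by
    rw [log_nat_add_one]; push_cast; ring_nf
  simp only [hρ, hl1, hl2]
  push_cast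
  ring

theorem tendsto_Gamma_ratio (u : ℂ) :
    Tendsto (fun n : ℕ => Complex.Gamma (1 + n) / Complex.Gamma (1 + u + n) *
      Complex.exp (u * Real.log (n + 1))) atTop (𝓝 1) := by
  obtain ⟨C, hC⟩ := newton_logGammaDiff u
  have t1 := tendsto_of_norm_le_div_pow two_ne_zero hC
  have t2 := t1.add (tendsto_log_succ_sub_log.const_mul (u * (u - 1) / 2))
  have t3 := (Complex.continuous_exp.tendsto _).comp ((t2.comp (tendsto_add_atTop_nat 1)).neg)
  simp only [mul_zero, add_zero, neg_zero, Complex.exp_zero] at t3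
  refine t3.congr' ?_
  filter_upwards [eventually_Gamma_ratio_eq u] with n hn
  rw [hn, ← Complex.exp_add]
  simp only [Function.comp]
  congr 1
  have hl1 : Complex.log ((n + 1 : ℕ) : ℂ) = ((Real.log (n + 1) : ℝ) : ℂ) := by
    rw [← log_nat_add_one]; push_cast; rfl
  rw [hl1]
  ring

theorem cexp_log_factorial (n : ℕ) :
    Complex.exp (Real.log n.factorial : ℝ) = Complex.Gamma (1 + n) := by
  rw [← Complex.ofReal_exp, Real.exp_log (by positivity), add_comm, Complex.Gamma_nat_eq_factorial]
  simp

theorem barnesSeq_add_one {u : ℂ} (hu : ∀ m : ℕ, 1 + u + m ≠ 0) (n : ℕ) :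
    barnesSeq (u + 1) n = Complex.Gamma (1 + u) * barnesSeq u n *
      (Complex.Gamma (1 + n) / Complex.Gamma (1 + u + n) * Complex.exp (u * Real.log (n + 1))) := by
  have h1 : ∏ m ∈ Finset.range n, (Complex.Gamma (1 + m) / Complex.Gamma (1 + (u + 1) + m))
      = (∏ m ∈ Finset.range n, (Complex.Gamma (1 + m) / Complex.Gamma (1 + u + m)))
        * (Complex.Gamma (1 + u) / Complex.Gamma (1 + u + n)) := by
    induction n with
    | zero =>
      have := Gamma_ne_zero_of_shift hu 0
      simp only [Nat.cast_zero, add_zero] at this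
      simp [this]
    | succ n ih =>
      have g := Gamma_ne_zero_of_shift hu n
      have e : 1 + (u + 1) + (n : ℂ) = 1 + u + ((n + 1 : ℕ) : ℂ) := by push_cast; ring
      rw [Finset.prod_range_succ, Finset.prod_range_succ, ih, e]
      field_simp
  have h2 : Complex.exp ((u + 1) * Real.log n.factorial + (u + 1) * (u + 1 - 1) / 2 * Real.log (n + 1))
      = Complex.exp (u * Real.log n.factorial + u * (u - 1) / 2 * Real.log (n + 1))
        * (Complex.Gamma (1 + n) * Complex.exp (u * Real.log (n + 1))) := by
    rw [← cexp_log_factorial, ← Complex.exp_add, ← Complex.exp_add]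
    congr 1; ring
  rw [barnesSeq, h1, h2, barnesSeq]
  ring

/-- Limit of the relation between the approximations at u and u + 1, in which the extra Γ-ratio
tends to 1. -/
theorem barnesG_add_one_of_ne {z : ℂ} (hz : ∀ m : ℕ, z ≠ -m) :
    barnesG (z + 1) = Complex.Gamma z * barnesG z := by
  have hu : ∀ m : ℕ, 1 + (z - 1) + m ≠ 0 := fun m h => hz m (by linear_combination h)
  have hu1 : ∀ m : ℕ, 1 + (z - 1 + 1) + m ≠ 0 := fun m h =>
    hz (m + 1) (by push_cast; linear_combination h)
  have t1 := tendsto_barnesSeq hu1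
  have t2 := (tendsto_barnesSeq hu).const_mul (Complex.Gamma (1 + (z - 1)))
  have t3 := t2.mul (tendsto_Gamma_ratio (z - 1))
  have := tendsto_nhds_unique t1 (t3.congr fun n => (barnesSeq_add_one hu n).symm)
  rw [mul_one] at this
  convert this using 2 <;> ring_nf

/-- Written with 1/Γ the relation also holds at the nonpositive integers: G vanishes there, and so
does the right side, since `Complex.Gamma` and its inverse take the value 0. -/
theorem barnesG_eq_inv_Gamma_mul (z : ℂ) : barnesG z = (Complex.Gamma z)⁻¹ * barnesG (z + 1) := by
  by_cases hz : ∀ m : ℕ, z ≠ -m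
  · rw [barnesG_add_one_of_ne hz, inv_mul_cancel_left₀ (Complex.Gamma_ne_zero hz)]
  · push Not at hz
    obtain ⟨m, rfl⟩ := hz
    rw [barnesG_neg_nat, Complex.Gamma_neg_nat_eq_zero]
    simp

/-- Iterating the difference equation n times produces the approximations of G(1+u), and Newton's
asymptotics says that the combination left over tends to 1. The factors √(2π) cancel in the
Γ-ratios; the one in `logGammaDiff` (n+1) = log n! - (log 2π)/2 survives as (2π)^{u/2}. -/
theorem exp_logDoubleGamma_mul_barnesG {z : ℂ} (hz : 0 < z.re) :
    Complex.exp (logDoubleGamma 1 1 z - logDoubleGamma 1 1 1) * barnesG z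
      = Complex.exp ((z - 1) / 2 * Real.log (2 * Real.pi)) := by
  set u := z - 1 with hu_def
  have hzu : z = 1 + u := by rw [hu_def]; ring
  have hre : ∀ m : ℕ, 0 < (1 + u + m).re := fun m => by
    rw [← hzu]; simp; positivity
  have hu : ∀ m : ℕ, 1 + u + m ≠ 0 := fun m h => by
    have := hre m; rw [h] at this; simp at this
  have hre1 : ∀ m : ℕ, 0 < ((1 : ℂ) + m).re := fun m => by simp; positivity
  obtain ⟨C, hC⟩ := newton_logDoubleGamma u
  have t1 := (Complex.continuous_exp.tendsto _).comp
    ((tendsto_of_norm_le_div_pow one_ne_zero hC).comp (tendsto_add_atTop_nat 1))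
  rw [Complex.exp_zero] at t1
  have hc : ((((Real.sqrt (2 * Real.pi))⁻¹ : ℝ)) : ℂ) ≠ 0 := by
    have : 0 < Real.sqrt (2 * Real.pi) := Real.sqrt_pos.2 (by positivity)
    exact_mod_cast (inv_pos.2 this).ne'
  have hprod : ∀ n : ℕ, Complex.exp (logDoubleGamma 1 1 (1 + u + n) - logDoubleGamma 1 1 (1 + n))
      = Complex.exp (logDoubleGamma 1 1 (1 + u) - logDoubleGamma 1 1 1) *
        ∏ m ∈ Finset.range n, (Complex.Gamma (1 + m) / Complex.Gamma (1 + u + m)) := by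
    intro n
    induction n with
    | zero => simp
    | succ n ih =>
      rw [Finset.prod_range_succ, ← mul_assoc, ← ih]
      push_cast
      rw [← add_assoc, ← add_assoc, logDoubleGamma_add_one, logDoubleGamma_add_one,
        show ∀ a b c d : ℂ, a - b - (c - d) = (a - c) + (d - b) by intros; ring,
        Complex.exp_add, Complex.exp_sub (logGammaDiff (1 + n)), exp_logGammaDiff (hre1 n),
        exp_logGammaDiff (hre n), mul_div_mul_left _ _ hc]
  have key : ∀ n : ℕ, Complex.exp (logDoubleGamma 1 1 (((n + 1 : ℕ) : ℂ) + u)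
      - logDoubleGamma 1 1 ((n + 1 : ℕ) : ℂ) + u * logGammaDiff ((n + 1 : ℕ) : ℂ)
      + u * (u - 1) / 2 * Complex.log ((n + 1 : ℕ) : ℂ))
      = Complex.exp (logDoubleGamma 1 1 (1 + u) - logDoubleGamma 1 1 1) * barnesSeq u n
        * Complex.exp (-(u / 2 * Real.log (2 * Real.pi))) := by
    intro n
    have e1 : (((n + 1 : ℕ) : ℂ) + u) = 1 + u + n := by push_cast; ring
    have e2 : ((n + 1 : ℕ) : ℂ) = 1 + n := by push_cast; ring
    have e3 := logGammaDiff_nat_add_one n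
    have e4 := log_nat_add_one n
    rw [add_comm (n : ℂ) 1] at e3 e4
    rw [e1, e2, e3, e4, barnesSeq, add_assoc, Complex.exp_add, hprod n, mul_assoc, mul_assoc,
      mul_assoc, ← Complex.exp_add]
    congr 3
    simp only [Complex.ofReal_sub, Complex.ofReal_div, Complex.ofReal_ofNat]
    ring
  have t2 := ((tendsto_barnesSeq hu).const_mul
    (Complex.exp (logDoubleGamma 1 1 (1 + u) - logDoubleGamma 1 1 1))).mul_const
    (Complex.exp (-(u / 2 * Real.log (2 * Real.pi))))
  have := tendsto_nhds_unique (t1.congr key) t2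
  rw [hzu]
  rw [Complex.exp_neg, eq_comm, mul_inv_eq_one₀ (Complex.exp_ne_zero _)] at this
  exact this

theorem barnesG_ne_zero_of_re_pos {z : ℂ} (hz : 0 < z.re) : barnesG z ≠ 0 := by
  intro h
  have := exp_logDoubleGamma_mul_barnesG hz
  rw [h, mul_zero] at this
  exact Complex.exp_ne_zero _ this.symm

/-- In the right half plane G is an exponential divided by another exponential; the recursion
extends this leftwards strip by strip. -/
theorem barnesG_ne_zero {z : ℂ} (hz : ∀ m : ℕ, z ≠ -m) : barnesG z ≠ 0 := by
  have h : ∀ n : ℕ, ∀ z : ℂ, -(n : ℝ) < z.re → (∀ m : ℕ, z ≠ -m) → barnesG z ≠ 0 := by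
    intro n
    induction n with
    | zero => intro z hz _; exact barnesG_ne_zero_of_re_pos (by simpa using hz)
    | succ n ih =>
      intro z hz hm
      rw [barnesG_eq_inv_Gamma_mul]
      refine mul_ne_zero (inv_ne_zero (Complex.Gamma_ne_zero hm)) (ih (z + 1) ?_ fun m h => ?_)
      · push_cast at hz; simp; linarith
      · exact hm (m + 1) (by push_cast; linear_combination h)
  obtain ⟨n, hn⟩ := exists_nat_gt (-z.re)
  exact h n z (by linarith) hz

/-! ### Zeros and poles of the critical Mellin transform -/

theorem meromorphicOrderAt_eq_zero_of_differentiable {f : ℂ → ℂ} (hf : Differentiable ℂ f) {z : ℂ}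
    (hz : f z ≠ 0) : meromorphicOrderAt f z = 0 := by
  have ha := hf.analyticAt z
  rw [ha.meromorphicOrderAt_eq, ha.analyticOrderAt_eq_zero.2 hz]
  rfl

theorem meromorphicAt_of_differentiable {f : ℂ → ℂ} (hf : Differentiable ℂ f) (z : ℂ) :
    MeromorphicAt f z := (hf.analyticAt z).meromorphicAt

theorem meromorphicOrderAt_inv_Gamma (n : ℕ) :
    meromorphicOrderAt (fun z => (Complex.Gamma z)⁻¹) (-n) = 1 := by
  have hd := Complex.differentiable_one_div_Gamma
  have hd1 : Differentiable ℂ (fun z : ℂ => (Complex.Gamma (z + 1))⁻¹) :=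
    hd.comp (differentiable_id.add_const 1)
  have e : (fun z : ℂ => (Complex.Gamma z)⁻¹) = (fun z : ℂ => z) * fun z => (Complex.Gamma (z + 1))⁻¹ :=
    funext Complex.one_div_Gamma_eq_self_mul_one_div_Gamma_add_one
  induction n with
  | zero =>
    rw [e, meromorphicOrderAt_mul (by fun_prop) (meromorphicAt_of_differentiable hd1 _),
      meromorphicOrderAt_eq_zero_of_differentiable hd1 (by simp), add_zero]
    have := meromorphicOrderAt_pow_id_sub_const (𝕜 := ℂ) (x := 0) (n := 1)
    simpa [Function.id_def] using this
  | succ n ih =>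
    have h0 : -((n + 1 : ℕ) : ℂ) ≠ 0 := neg_ne_zero.2 (by exact_mod_cast n.succ_ne_zero)
    rw [e, meromorphicOrderAt_mul (by fun_prop) (meromorphicAt_of_differentiable hd1 _),
      meromorphicOrderAt_eq_zero_of_differentiable (f := fun z => z) differentiable_fun_id h0, zero_add]
    have := meromorphicOrderAt_comp_add_const_eq_meromorphicOrderAt (x := -((n + 1 : ℕ) : ℂ))
      (c := 1) (f := fun z => (Complex.Gamma z)⁻¹)
    rw [show -((n + 1 : ℕ) : ℂ) + 1 = -n by push_cast; ring, ih] at this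
    exact this

/-- Each step to the left multiplies by 1/Γ, which has a simple zero there; the count starts from
G(1) = 1. -/
theorem meromorphicOrderAt_barnesG_neg (n : ℕ) :
    meromorphicOrderAt barnesG (-n) = ((n + 1 : ℤ) : WithTop ℤ) := by
  have hd1 : Differentiable ℂ (barnesG ∘ (· + 1)) :=
    differentiable_barnesG.comp (differentiable_id.add_const 1)
  have e : barnesG = (fun z => (Complex.Gamma z)⁻¹) * (barnesG ∘ (· + 1)) :=
    funext barnesG_eq_inv_Gamma_mul
  have hstep : ∀ n : ℕ, meromorphicOrderAt barnesG (-n)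
      = 1 + meromorphicOrderAt barnesG (-n + 1) := by
    intro n
    conv_lhs => rw [e]
    rw [meromorphicOrderAt_mul
      (meromorphicAt_of_differentiable Complex.differentiable_one_div_Gamma _)
      (meromorphicAt_of_differentiable hd1 _), meromorphicOrderAt_inv_Gamma,
      meromorphicOrderAt_comp_add_const_eq_meromorphicOrderAt]
  induction n with
  | zero =>
    rw [hstep, meromorphicOrderAt_eq_zero_of_differentiable differentiable_barnesG
      (by simp [barnesG_one])]
    simp
  | succ n ih =>
    rw [hstep, show -((n + 1 : ℕ) : ℂ) + 1 = -n by push_cast; ring, ih]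
    have : (1 : ℤ) + (n + 1) = ((n + 1 : ℕ) : ℤ) + 1 := by push_cast; ring
    rw [← this]
    rfl

theorem meromorphicOrderAt_barnesG_of_ne {z : ℂ} (hz : ∀ m : ℕ, z ≠ -m) :
    meromorphicOrderAt barnesG z = ((0 : ℤ) : WithTop ℤ) :=
  meromorphicOrderAt_eq_zero_of_differentiable differentiable_barnesG (barnesG_ne_zero hz)

theorem meromorphicOrderAt_barnesG_affine (c : ℂ) {d : ℂ} (hd : d ≠ 0) (q : ℂ) :
    meromorphicOrderAt (fun q => barnesG (c - d * q)) q = meromorphicOrderAt barnesG (c - d * q) := by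
  have h : HasDerivAt (fun q => c - d * q) (-d) q := by
    simpa using ((hasDerivAt_id q).const_mul d).const_sub c
  exact meromorphicOrderAt_comp_of_deriv_ne_zero (f := barnesG) (g := fun q => c - d * q)
    (by fun_prop) (by rw [h.deriv]; exact neg_ne_zero.2 hd)

theorem criticalMellin_eq : criticalMellin = (fun q => barnesG (4 - 2 * q)) *
    ((fun q => barnesG (1 - 1 * q)) * (fun q => barnesG (2 - 1 * q)) ^ 2
      * (fun q => barnesG (4 - 1 * q)))⁻¹ := by
  funext q
  simp [criticalMellin, div_eq_mul_inv]

theorem differentiable_barnesG_affine (c d : ℂ) : Differentiable ℂ fun q => barnesG (c - d * q) :=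
  differentiable_barnesG.comp (by fun_prop)

theorem meromorphic_criticalMellin : Meromorphic criticalMellin := by
  intro q
  rw [criticalMellin_eq]
  have h := fun c d => meromorphicAt_of_differentiable (differentiable_barnesG_affine c d) q
  exact (h 4 2).mul ((((h 1 1).mul ((h 2 1).pow 2)).mul (h 4 1)).inv)

theorem meromorphicOrderAt_criticalMellin {q : ℂ} {k₁ k₂ k₃ k₄ : ℤ}
    (h₁ : meromorphicOrderAt barnesG (4 - 2 * q) = k₁)
    (h₂ : meromorphicOrderAt barnesG (1 - 1 * q) = k₂)
    (h₃ : meromorphicOrderAt barnesG (2 - 1 * q) = k₃)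
    (h₄ : meromorphicOrderAt barnesG (4 - 1 * q) = k₄) :
    meromorphicOrderAt criticalMellin q = ((k₁ - (k₂ + 2 * k₃ + k₄) : ℤ) : WithTop ℤ) := by
  rw [criticalMellin_eq]
  have h := fun c d => meromorphicAt_of_differentiable (differentiable_barnesG_affine c d) q
  rw [meromorphicOrderAt_mul (h 4 2) ((((h 1 1).mul ((h 2 1).pow 2)).mul (h 4 1)).inv),
    meromorphicOrderAt_inv, meromorphicOrderAt_mul ((h 1 1).mul ((h 2 1).pow 2)) (h 4 1),
    meromorphicOrderAt_mul (h 1 1) ((h 2 1).pow 2), meromorphicOrderAt_pow (h 2 1),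
    meromorphicOrderAt_barnesG_affine _ two_ne_zero, meromorphicOrderAt_barnesG_affine _ one_ne_zero,
    meromorphicOrderAt_barnesG_affine _ one_ne_zero, meromorphicOrderAt_barnesG_affine _ one_ne_zero,
    h₁, h₂, h₃, h₄]
  rw [sub_eq_add_neg]
  rfl

theorem natCast_ne_neg_natCast {c : ℂ} (hc : 0 < c.re) (m : ℕ) : c ≠ -m := fun h => by
  have := congrArg Complex.re h
  simp at this
  linarith [(Nat.cast_nonneg m : (0 : ℝ) ≤ m)]

/-- Only the numerator vanishes: 4 - 2q = -(2n+1), while the arguments in the denominator are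
half-integers. -/
theorem meromorphicOrderAt_criticalMellin_half (n : ℕ) :
    meromorphicOrderAt criticalMellin ((n : ℂ) + 5 / 2) = ((2 * (n : ℤ) + 2 : ℤ) : WithTop ℤ) := by
  have h : ∀ (j : ℕ) (m : ℕ), (j : ℂ) - 1 * ((n : ℂ) + 5 / 2) ≠ -m := by
    intro j m h
    have h2 : ((2 * j + 2 * m : ℤ) : ℂ) = ((2 * n + 5 : ℤ) : ℂ) := by
      push_cast; linear_combination 2 * h
    have h3 : (2 * j + 2 * m : ℤ) = 2 * n + 5 := by exact_mod_cast h2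
    omega
  have h1 : (4 : ℂ) - 2 * ((n : ℂ) + 5 / 2) = -((2 * n + 1 : ℕ) : ℂ) := by push_cast; ring
  have := meromorphicOrderAt_criticalMellin (q := (n : ℂ) + 5 / 2)
    (by rw [h1]; exact meromorphicOrderAt_barnesG_neg _)
    (meromorphicOrderAt_barnesG_of_ne (by exact_mod_cast h 1))
    (meromorphicOrderAt_barnesG_of_ne (by exact_mod_cast h 2))
    (meromorphicOrderAt_barnesG_of_ne (by exact_mod_cast h 4))
  rw [this]
  congr 1

theorem meromorphicOrderAt_criticalMellin_one :
    meromorphicOrderAt criticalMellin 1 = ((-1 : ℤ) : WithTop ℤ) := by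
  have := meromorphicOrderAt_criticalMellin (q := 1)
    (meromorphicOrderAt_barnesG_of_ne (natCast_ne_neg_natCast (by norm_num)))
    (by rw [show (1 : ℂ) - 1 * 1 = -((0 : ℕ) : ℂ) by norm_num]; exact meromorphicOrderAt_barnesG_neg 0)
    (meromorphicOrderAt_barnesG_of_ne (natCast_ne_neg_natCast (by norm_num)))
    (meromorphicOrderAt_barnesG_of_ne (natCast_ne_neg_natCast (by norm_num)))
  rw [this]; norm_num

theorem meromorphicOrderAt_criticalMellin_two :
    meromorphicOrderAt criticalMellin 2 = ((-3 : ℤ) : WithTop ℤ) := by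
  have := meromorphicOrderAt_criticalMellin (q := 2)
    (by rw [show (4 : ℂ) - 2 * 2 = -((0 : ℕ) : ℂ) by norm_num]; exact meromorphicOrderAt_barnesG_neg 0)
    (by rw [show (1 : ℂ) - 1 * 2 = -((1 : ℕ) : ℂ) by norm_num]; exact meromorphicOrderAt_barnesG_neg 1)
    (by rw [show (2 : ℂ) - 1 * 2 = -((0 : ℕ) : ℂ) by norm_num]; exact meromorphicOrderAt_barnesG_neg 0)
    (meromorphicOrderAt_barnesG_of_ne (natCast_ne_neg_natCast (by norm_num)))
  rw [this]; norm_num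

theorem meromorphicOrderAt_criticalMellin_nat {n : ℕ} (hn : 3 ≤ n) :
    meromorphicOrderAt criticalMellin n = ((-(2 * (n : ℤ) - 2) : ℤ) : WithTop ℤ) := by
  obtain ⟨k, rfl⟩ := Nat.exists_eq_add_of_le hn
  have o1 : meromorphicOrderAt barnesG (4 - 2 * ((3 + k : ℕ) : ℂ)) = ((2 * k + 3 : ℤ) : WithTop ℤ) := by
    rw [show (4 : ℂ) - 2 * ((3 + k : ℕ) : ℂ) = -((2 * k + 2 : ℕ) : ℂ) by push_cast; ring,
      meromorphicOrderAt_barnesG_neg]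
    congr 1
  have o2 : meromorphicOrderAt barnesG (1 - 1 * ((3 + k : ℕ) : ℂ)) = ((k + 3 : ℤ) : WithTop ℤ) := by
    rw [show (1 : ℂ) - 1 * ((3 + k : ℕ) : ℂ) = -((k + 2 : ℕ) : ℂ) by push_cast; ring,
      meromorphicOrderAt_barnesG_neg]
    congr 1
  have o3 : meromorphicOrderAt barnesG (2 - 1 * ((3 + k : ℕ) : ℂ)) = ((k + 2 : ℤ) : WithTop ℤ) := by
    rw [show (2 : ℂ) - 1 * ((3 + k : ℕ) : ℂ) = -((k + 1 : ℕ) : ℂ) by push_cast; ring,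
      meromorphicOrderAt_barnesG_neg]
    congr 1
  -- At q = 3 the argument 4 - q = 1 is not a zero of G; the value k = 0 covers this case, and for k
  -- ≥ 1 the zero at -(k-1) has order k.
  have o4 : meromorphicOrderAt barnesG (4 - 1 * ((3 + k : ℕ) : ℂ)) = ((k : ℤ) : WithTop ℤ) := by
    rcases k with _ | k
    · exact meromorphicOrderAt_barnesG_of_ne (natCast_ne_neg_natCast (by norm_num))
    · rw [show (4 : ℂ) - 1 * ((3 + (k + 1) : ℕ) : ℂ) = -((k : ℕ) : ℂ) by push_cast; ring,
        meromorphicOrderAt_barnesG_neg]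
      congr 1
  rw [meromorphicOrderAt_criticalMellin o1 o2 o3 o4]
  congr 1
  push_cast; ring

theorem meromorphicOrderAt_criticalMellin_eq_zero {q : ℂ} (h1 : ∀ n : ℕ, q ≠ (n : ℂ) + 5 / 2)
    (h2 : ∀ n : ℕ, 1 ≤ n → q ≠ (n : ℂ)) : meromorphicOrderAt criticalMellin q = 0 := by
  have h3 : ∀ j : ℕ, 1 ≤ j → ∀ m : ℕ, (j : ℂ) - 1 * q ≠ -m := fun j hj m h =>
    h2 (j + m) (by omega) (by push_cast; linear_combination -h)
  have h4 : ∀ m : ℕ, (4 : ℂ) - 2 * q ≠ -m := by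
    intro m h
    rcases Nat.even_or_odd' m with ⟨k, rfl | rfl⟩
    · exact h2 (k + 2) (by omega) (by push_cast at h ⊢; linear_combination -h / 2)
    · exact h1 k (by push_cast at h ⊢; linear_combination -h / 2)
  have := meromorphicOrderAt_criticalMellin (meromorphicOrderAt_barnesG_of_ne h4)
    (meromorphicOrderAt_barnesG_of_ne (by exact_mod_cast h3 1 le_rfl))
    (meromorphicOrderAt_barnesG_of_ne (by exact_mod_cast h3 2 (by norm_num)))
    (meromorphicOrderAt_barnesG_of_ne (by exact_mod_cast h3 4 (by norm_num)))
  rw [this]; rfl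

/-! ### Functional equation, negative moments and infinite product -/

theorem ne_neg_natCast_of_two_mul_ne {q : ℂ} (hq : ∀ n : ℕ, 2 * q ≠ (n : ℂ) + 2) {j : ℕ}
    (hj : 1 ≤ j) (m : ℕ) : (j : ℂ) - q ≠ -m := fun h => by
  obtain ⟨k, rfl⟩ := Nat.exists_eq_add_of_le hj
  exact hq (2 * k + 2 * m) (by push_cast at h ⊢; linear_combination -2 * h)

theorem ne_neg_natCast_of_two_mul_ne' {q : ℂ} (hq : ∀ n : ℕ, 2 * q ≠ (n : ℂ) + 2) {j : ℕ}
    (hj : 2 ≤ j) (m : ℕ) : (j : ℂ) - 2 * q ≠ -m := fun h => by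
  obtain ⟨k, rfl⟩ := Nat.exists_eq_add_of_le hj
  exact hq (k + m) (by push_cast at h ⊢; linear_combination -h)

/-- The recursion of G is applied once at 1 - q, 2 - q and 4 - q, and twice starting from 4 - 2q. -/
theorem criticalMellin_functional_equation {q : ℂ} (hq : ∀ n : ℕ, 2 * q ≠ (n : ℂ) + 2) :
    criticalMellin q =
        Complex.Gamma (1 - q) * Complex.Gamma (2 - q) ^ 2 * Complex.Gamma (4 - q) /
          (Complex.Gamma (4 - 2 * q) * Complex.Gamma (5 - 2 * q)) * criticalMellin (q - 1) := by
  have h1 : ∀ m : ℕ, (1 : ℂ) - q ≠ -m := by exact_mod_cast ne_neg_natCast_of_two_mul_ne hq le_rfl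
  have h2 : ∀ m : ℕ, (2 : ℂ) - q ≠ -m := by
    exact_mod_cast ne_neg_natCast_of_two_mul_ne hq (j := 2) (by norm_num)
  have h4 : ∀ m : ℕ, (4 : ℂ) - q ≠ -m := by
    exact_mod_cast ne_neg_natCast_of_two_mul_ne hq (j := 4) (by norm_num)
  have k4 : ∀ m : ℕ, (4 : ℂ) - 2 * q ≠ -m := by
    exact_mod_cast ne_neg_natCast_of_two_mul_ne' hq (j := 4) (by norm_num)
  have k5 : ∀ m : ℕ, (5 : ℂ) - 2 * q ≠ -m := by
    exact_mod_cast ne_neg_natCast_of_two_mul_ne' hq (j := 5) (by norm_num)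
  rw [criticalMellin, criticalMellin, show 4 - 2 * (q - 1) = 5 - 2 * q + 1 by ring,
    show 1 - (q - 1) = 1 - q + 1 by ring, show 2 - (q - 1) = 2 - q + 1 by ring,
    show 4 - (q - 1) = 4 - q + 1 by ring, barnesG_add_one_of_ne h1, barnesG_add_one_of_ne h2,
    barnesG_add_one_of_ne h4, barnesG_add_one_of_ne k5,
    show 5 - 2 * q = 4 - 2 * q + 1 by ring, barnesG_add_one_of_ne k4]
  rw [show 4 - 2 * q + 1 = 5 - 2 * q by ring]
  have := Complex.Gamma_ne_zero h1
  have := Complex.Gamma_ne_zero h2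
  have := Complex.Gamma_ne_zero h4
  have := Complex.Gamma_ne_zero k4
  have := Complex.Gamma_ne_zero k5
  have := barnesG_ne_zero h1
  have := barnesG_ne_zero h2
  have := barnesG_ne_zero h4
  field_simp

theorem barnesG_nat_add_one (n : ℕ) : barnesG (n + 1) = ∏ k ∈ Finset.range n, (k.factorial : ℂ) := by
  induction n with
  | zero => simp [barnesG_one]
  | succ n ih =>
    have : ∀ m : ℕ, ((n + 1 : ℕ) : ℂ) ≠ -m := natCast_ne_neg_natCast (by simp; positivity)
    rw [barnesG_add_one_of_ne this, Finset.prod_range_succ, ← ih]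
    push_cast
    rw [Complex.Gamma_nat_eq_factorial, mul_comm]

/-- G at positive integers is a superfactorial; G(4+2l)/G(4+l) leaves the factorials from (3+l)! to
(2+2l)!. -/
theorem criticalMellin_neg_nat (l : ℕ) : criticalMellin (-l) =
    ((∏ k ∈ Finset.range l, ((Nat.factorial (3 + l + k) : ℝ) /
            ((Nat.factorial (k + 1) : ℝ) ^ 2 * (Nat.factorial k : ℝ))) : ℝ) : ℂ) := by
  have e1 : barnesG (4 - 2 * -(l : ℂ)) = barnesG (4 - -(l : ℂ)) *
      ∏ k ∈ Finset.range l, ((3 + l + k).factorial : ℂ) := by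
    rw [show 4 - 2 * -(l : ℂ) = ((3 + l + l : ℕ) : ℂ) + 1 by push_cast; ring,
      show 4 - -(l : ℂ) = ((3 + l : ℕ) : ℂ) + 1 by push_cast; ring, barnesG_nat_add_one,
      barnesG_nat_add_one, Finset.prod_range_add]
  have e2 : barnesG (2 - -(l : ℂ)) = ∏ k ∈ Finset.range l, ((k + 1).factorial : ℂ) := by
    rw [show 2 - -(l : ℂ) = ((l + 1 : ℕ) : ℂ) + 1 by push_cast; ring, barnesG_nat_add_one,
      Finset.prod_range_succ']
    simp
  have e3 : barnesG (1 - -(l : ℂ)) = ∏ k ∈ Finset.range l, (k.factorial : ℂ) := by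
    rw [show 1 - -(l : ℂ) = (l : ℂ) + 1 by ring, barnesG_nat_add_one]
  have h4 : barnesG (4 - -(l : ℂ)) ≠ 0 := barnesG_ne_zero_of_re_pos (by simp; positivity)
  rw [criticalMellin, e1, e2, e3, mul_comm (barnesG _), mul_div_mul_right _ _ h4]
  push_cast
  rw [Finset.prod_div_distrib, Finset.prod_mul_distrib, Finset.prod_pow]
  ring

/-- The factors of the infinite product for `criticalMellin`. -/
noncomputable def criticalFactor (q : ℂ) (m : ℕ) : ℂ :=
  ((m : ℂ) + 1) ^ (2 * q) *
    (Complex.Gamma (1 - q + (m + 1)) ^ 3 / Complex.Gamma (1 + (m + 1)) ^ 3) *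
    (Complex.Gamma (2 - q + (m + 1)) / Complex.Gamma (2 - 2 * q + (m + 1)))

/-- The factor is expressed through the ratios Γ(1+m)/Γ(1+u+m) with u = 1, 2-2q, 1-q, 2-q, for which
asymptotics and the limit to G are available. -/
theorem criticalFactor_eq (q : ℂ) (m : ℕ) : criticalFactor q m =
    Complex.exp (2 * q * Complex.log ((m : ℂ) + 1)) *
      ((Complex.Gamma (1 + m) / Complex.Gamma (1 + 1 + m)) ^ 3 *
        (Complex.Gamma (1 + m) / Complex.Gamma (1 + (2 - 2 * q) + m)) /
        ((Complex.Gamma (1 + m) / Complex.Gamma (1 + (1 - q) + m)) ^ 3 *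
        (Complex.Gamma (1 + m) / Complex.Gamma (1 + (2 - q) + m)))) := by
  have h0 : (m : ℂ) + 1 ≠ 0 := by exact_mod_cast m.succ_ne_zero
  have hG : Complex.Gamma (1 + m) ≠ 0 := Complex.Gamma_ne_zero_of_re_pos (by simp; positivity)
  rw [criticalFactor, Complex.cpow_def_of_ne_zero h0, mul_comm (Complex.log _),
    show 1 - q + ((m : ℂ) + 1) = 1 + (1 - q) + m by ring,
    show 1 + ((m : ℂ) + 1) = 1 + 1 + m by ring,
    show 2 - q + ((m : ℂ) + 1) = 1 + (2 - q) + m by ring,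
    show 2 - 2 * q + ((m : ℂ) + 1) = 1 + (2 - 2 * q) + m by ring]
  simp only [div_eq_mul_inv, mul_inv, inv_inv, mul_pow]
  field_simp

/-- Counting u = 1 and u = 1-q three times and giving 1-q and 2-q weight -1, the sum of u is 2q,
cancelled by the power of m+1, and the sum of u(u-1)/2 is 0. Only the O(1/(m+1)²) errors remain in
the logarithm. -/
theorem multipliable_criticalFactor (q : ℂ) : Multipliable (criticalFactor q) := by
  have hN : ∀ u : ℂ, ∃ C : ℝ, ∀ᶠ m : ℕ in atTop, ∃ e : ℂ, ‖e‖ ≤ C / ((m + 1 : ℕ) : ℝ) ^ 2 ∧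
      Complex.Gamma (1 + m) / Complex.Gamma (1 + u + m)
        = Complex.exp (-(e + u * Complex.log ((m + 1 : ℕ) : ℂ) + u * (u - 1) / 2 *
          (Complex.log (((m + 1 : ℕ) : ℂ) + 1) - Complex.log ((m + 1 : ℕ) : ℂ)))) := by
    intro u
    obtain ⟨C, hC⟩ := newton_logGammaDiff u
    refine ⟨C, ?_⟩
    filter_upwards [(tendsto_add_atTop_nat 1).eventually hC, eventually_Gamma_ratio_eq u] with m h1 h2
    refine ⟨_, h1, ?_⟩
    rw [h2]
    congr 1
    ring
  obtain ⟨C₁, h₁⟩ := hN 1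
  obtain ⟨C₂, h₂⟩ := hN (2 - 2 * q)
  obtain ⟨C₃, h₃⟩ := hN (1 - q)
  obtain ⟨C₄, h₄⟩ := hN (2 - q)
  have hs := summable_one_div_nat_add_one_sq
  -- The linear bound for e^E - 1 requires an exponent of norm at most 1.
  have hev : ∀ᶠ m : ℕ in atTop,
      (3 * C₁ + C₂ + 3 * C₃ + C₄) * (1 / ((m : ℝ) + 1) ^ 2) ≤ 1 :=
    ((hs.tendsto_atTop_zero.const_mul _).eventually_le_const (by simp))
  have hsum : Summable fun m => criticalFactor q m - 1 := by
    refine Summable.of_norm_bounded_eventually_nat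
      ((hs.mul_left (3 * C₁ + C₂ + 3 * C₃ + C₄)).mul_left 2) ?_
    filter_upwards [h₁, h₂, h₃, h₄, hev] with m ⟨e₁, n₁, g₁⟩ ⟨e₂, n₂, g₂⟩ ⟨e₃, n₃, g₃⟩ ⟨e₄, n₄, g₄⟩ hm
    have hE : criticalFactor q m = Complex.exp (3 * e₃ + e₄ - 3 * e₁ - e₂) := by
      rw [criticalFactor_eq, g₁, g₂, g₃, g₄]
      simp only [← Complex.exp_nat_mul, ← Complex.exp_add, ← Complex.exp_sub]
      congr 1
      push_cast
      ring
    have hb : ‖3 * e₃ + e₄ - 3 * e₁ - e₂‖ ≤ (3 * C₁ + C₂ + 3 * C₃ + C₄) * (1 / ((m : ℝ) + 1) ^ 2) := by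
      have a1 := norm_sub_le (3 * e₃ + e₄ - 3 * e₁) e₂
      have a2 := norm_sub_le (3 * e₃ + e₄) (3 * e₁)
      have a3 := norm_add_le (3 * e₃) e₄
      have a4 : ‖3 * e₃‖ = 3 * ‖e₃‖ := by simp
      have a5 : ‖3 * e₁‖ = 3 * ‖e₁‖ := by simp
      push_cast at n₁ n₂ n₃ n₄
      have : (3 * C₁ + C₂ + 3 * C₃ + C₄) * (1 / ((m : ℝ) + 1) ^ 2) =
        3 * (C₁ / ((m : ℝ) + 1) ^ 2) + C₂ / ((m : ℝ) + 1) ^ 2 + 3 * (C₃ / ((m : ℝ) + 1) ^ 2)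
          + C₄ / ((m : ℝ) + 1) ^ 2 := by ring
      linarith
    rw [hE]
    refine (Complex.norm_exp_sub_one_le (hb.trans hm)).trans ?_
    linarith
  have := multipliable_one_add_of_summable hsum.norm
  simpa using this

theorem prod_criticalFactor (q : ℂ) (n : ℕ) : ∏ m ∈ Finset.range n, criticalFactor q m =
    barnesSeq 1 n ^ 3 * barnesSeq (2 - 2 * q) n /
      (barnesSeq (1 - q) n ^ 3 * barnesSeq (2 - q) n) := by
  have h1 : ∏ m ∈ Finset.range n, Complex.exp (2 * q * Complex.log ((m : ℂ) + 1))
      = Complex.exp (2 * q * Real.log n.factorial) := by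
    rw [← Complex.exp_sum, ← Finset.mul_sum]
    congr 2
    induction n with
    | zero => simp
    | succ n ih =>
      rw [Finset.sum_range_succ, ih, Nat.factorial_succ, Nat.cast_mul, Real.log_mul
        (by positivity) (by positivity), log_nat_add_one]
      rw [Complex.ofReal_add, Nat.cast_succ, add_comm]
  simp only [criticalFactor_eq, Finset.prod_mul_distrib, Finset.prod_div_distrib, Finset.prod_pow]
  simp only [← Finset.prod_div_distrib]
  rw [h1]
  simp only [barnesSeq, mul_pow]
  set A := ∏ m ∈ Finset.range n, (Complex.Gamma (1 + m) / Complex.Gamma (1 + 1 + m))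
  set B := ∏ m ∈ Finset.range n, (Complex.Gamma (1 + m) / Complex.Gamma (1 + (2 - 2 * q) + m))
  set C := ∏ m ∈ Finset.range n, (Complex.Gamma (1 + m) / Complex.Gamma (1 + (1 - q) + m))
  set D := ∏ m ∈ Finset.range n, (Complex.Gamma (1 + m) / Complex.Gamma (1 + (2 - q) + m))
  set l : ℂ := ((Real.log n.factorial : ℝ) : ℂ)
  set k : ℂ := ((Real.log (n + 1) : ℝ) : ℂ)
  have h2 : Complex.exp (2 * q * l) *
      (Complex.exp ((1 - q) * l + (1 - q) * (1 - q - 1) / 2 * k) ^ 3 *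
        Complex.exp ((2 - q) * l + (2 - q) * (2 - q - 1) / 2 * k)) =
      Complex.exp (1 * l + 1 * (1 - 1) / 2 * k) ^ 3 *
        Complex.exp ((2 - 2 * q) * l + (2 - 2 * q) * (2 - 2 * q - 1) / 2 * k) := by
    simp only [← Complex.exp_nat_mul, ← Complex.exp_add]
    congr 1
    push_cast
    ring
  rw [show A ^ 3 * Complex.exp (1 * l + 1 * (1 - 1) / 2 * k) ^ 3 *
    (B * Complex.exp ((2 - 2 * q) * l + (2 - 2 * q) * (2 - 2 * q - 1) / 2 * k))
    = A ^ 3 * B * (Complex.exp (1 * l + 1 * (1 - 1) / 2 * k) ^ 3 *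
        Complex.exp ((2 - 2 * q) * l + (2 - 2 * q) * (2 - 2 * q - 1) / 2 * k)) by ring, ← h2]
  field_simp

/-- The partial products tend to G(2)³ G(3-2q) / (G(2-q)³ G(3-q)); one use of the recursion at each
of 1-q, 3-q and 3-2q turns this into the critical quotient up to the Γ prefactor. -/
theorem criticalMellin_eq_tprod {q : ℂ} (hq : ∀ n : ℕ, 2 * q ≠ (n : ℂ) + 2) :
    criticalMellin q = Complex.Gamma (1 - q) * Complex.Gamma (3 - 2 * q) / Complex.Gamma (3 - q) *
      ∏' m : ℕ, criticalFactor q m := by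
  have h1 : ∀ m : ℕ, (1 : ℂ) - q ≠ -m := by exact_mod_cast ne_neg_natCast_of_two_mul_ne hq le_rfl
  have h2 : ∀ m : ℕ, (2 : ℂ) - q ≠ -m := by
    exact_mod_cast ne_neg_natCast_of_two_mul_ne hq (j := 2) (by norm_num)
  have h3 : ∀ m : ℕ, (3 : ℂ) - q ≠ -m := by
    exact_mod_cast ne_neg_natCast_of_two_mul_ne hq (j := 3) (by norm_num)
  have k3 : ∀ m : ℕ, (3 : ℂ) - 2 * q ≠ -m := by
    exact_mod_cast ne_neg_natCast_of_two_mul_ne' hq (j := 3) (by norm_num)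
  have t1 := tendsto_barnesSeq (u := 1) fun m => by norm_cast; omega
  have t2 := tendsto_barnesSeq (u := 2 - 2 * q) fun m h => k3 m (by linear_combination h)
  have t3 := tendsto_barnesSeq (u := 1 - q) fun m h => h2 m (by linear_combination h)
  have t4 := tendsto_barnesSeq (u := 2 - q) fun m h => h3 m (by linear_combination h)
  rw [show 1 + (2 - 2 * q) = 3 - 2 * q by ring] at t2
  rw [show 1 + (1 - q) = 1 - q + 1 by ring] at t3
  rw [show 1 + (2 - q) = 3 - q by ring] at t4
  have hG2 : barnesG (1 + 1) = 1 := by simpa using barnesG_nat_add_one 1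
  rw [hG2] at t1
  have n2 := barnesG_ne_zero h2
  have n3 := barnesG_ne_zero h3
  have e2 := barnesG_add_one_of_ne h1
  rw [show 1 - q + 1 = 2 - q by ring] at e2 t3
  have t := ((t1.pow 3).mul t2).div ((t3.pow 3).mul t4) (mul_ne_zero (pow_ne_zero _ n2) n3)
  have := tendsto_nhds_unique ((multipliable_criticalFactor q).hasProd.tendsto_prod_nat.congr
    (prod_criticalFactor q)) t
  rw [this, criticalMellin, show 4 - 2 * q = 3 - 2 * q + 1 by ring,
    show 4 - q = 3 - q + 1 by ring, barnesG_add_one_of_ne h3, barnesG_add_one_of_ne k3, e2]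
  have := Complex.Gamma_ne_zero h1
  have := Complex.Gamma_ne_zero h3
  have := barnesG_ne_zero h1
  field_simp

/-! ### Weak limits and compound Poisson laws -/

/-- Lévy's continuity theorem in existence form. Continuity of f at 0 gives tightness, so the laws
have a limit along an ultrafilter; its characteristic function must be f, and then the whole
sequence converges to it. -/
theorem exists_tendsto_of_tendsto_charFun {μ : ℕ → ProbabilityMeasure ℝ} {f : ℝ → ℂ}
    (hf : ContinuousAt f 0) (h : ∀ y, Tendsto (fun n => charFun (μ n : Measure ℝ) y) atTop (𝓝 (f y))) :
    ∃ ρ : ProbabilityMeasure ℝ, (∀ y, charFun (ρ : Measure ℝ) y = f y) ∧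
      Tendsto μ atTop (𝓝 ρ) := by
  have ht : IsTightMeasureSet {((ν : ProbabilityMeasure ℝ) : Measure ℝ) | ν ∈ Set.range μ} := by
    refine (isTightMeasureSet_of_tendsto_charFun hf h).subset ?_
    rintro _ ⟨_, ⟨n, rfl⟩, rfl⟩
    exact ⟨n, rfl⟩
  have hK := isCompact_closure_of_isTightMeasureSet ht
  set 𝒰 : Ultrafilter ℕ := Ultrafilter.of atTop
  obtain ⟨ρ, -, hρ⟩ := hK.ultrafilter_le_nhds (𝒰.map μ)
    (by
      rw [Filter.le_principal_iff]
      exact Filter.mem_map.2 (Filter.univ_mem' fun n => subset_closure ⟨n, rfl⟩))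
  have hρ' : Tendsto μ (𝒰 : Filter ℕ) (𝓝 ρ) := hρ
  have hc : ∀ y, charFun (ρ : Measure ℝ) y = f y := by
    intro y
    refine tendsto_nhds_unique ?_ ((h y).mono_left (Ultrafilter.of_le atTop))
    have := (ProbabilityMeasure.tendsto_iff_forall_integral_rclike_tendsto ℂ).1 hρ'
      (BoundedContinuousFunction.innerProbChar y)
    simpa only [charFun_eq_integral_innerProbChar] using this
  exact ⟨ρ, hc, ProbabilityMeasure.tendsto_iff_tendsto_charFun.2 fun y => by rw [hc]; exact h y⟩

/-- `ρ` is a probability law with characteristic function `φ` and with exponential moments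
bounded by `M`. -/
structure HasTransformBound (ρ : Measure ℝ) (S : Set ℝ) (φ : ℝ → ℂ) (M : ℝ → ℝ) : Prop where
  prob : IsProbabilityMeasure ρ
  charFun_eq : ∀ y, charFun ρ y = φ y
  lintegral_le : ∀ θ ∈ S, ∫⁻ x, ENNReal.ofReal (Real.exp (θ * x)) ∂ρ ≤ ENNReal.ofReal (M θ)

/-- Exponential moments are only lower semicontinuous under weak convergence, hence inequalities in
`HasTransformBound`. They suffice for integrability; equality is recovered later by analytic
continuation from the imaginary axis. -/
theorem exists_hasTransformBound_of_tendsto {S : Set ℝ} {ρ : ℕ → Measure ℝ} {φ : ℕ → ℝ → ℂ}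
    {M : ℕ → ℝ → ℝ} {f : ℝ → ℂ} {B : ℝ → ℝ} (hρ : ∀ n, HasTransformBound (ρ n) S (φ n) (M n))
    (hf : ContinuousAt f 0) (h : ∀ y, Tendsto (fun n => φ n y) atTop (𝓝 (f y)))
    (hM : ∀ θ ∈ S, Tendsto (fun n => M n θ) atTop (𝓝 (B θ))) :
    ∃ ρ, HasTransformBound ρ S f B := by
  set μ : ℕ → ProbabilityMeasure ℝ := fun n => ⟨ρ n, (hρ n).prob⟩ with hμ
  obtain ⟨ν, hν, hlim⟩ := exists_tendsto_of_tendsto_charFun (μ := μ) hf fun y => by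
    simpa [hμ, (hρ _).charFun_eq] using h y
  refine ⟨ν, inferInstance, hν, fun θ hθ => ?_⟩
  have := lintegral_le_liminf_lintegral_of_forall_isOpen_measure_le_liminf_measure
    (μ := (ν : Measure ℝ)) (μs := fun n => (μ n : Measure ℝ)) (f := fun x => Real.exp (θ * x))
    (by fun_prop) (fun x => (Real.exp_pos _).le)
    (fun G hG => ProbabilityMeasure.le_liminf_measure_open_of_tendsto hlim hG)
  refine this.trans ?_
  have ht : Tendsto (fun n => ENNReal.ofReal (M n θ)) atTop (𝓝 (ENNReal.ofReal (B θ))) :=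
    (ENNReal.continuous_ofReal.tendsto _).comp (hM θ hθ)
  rw [← ht.liminf_eq]
  exact liminf_le_liminf (Eventually.of_forall fun n => (hρ n).lintegral_le θ hθ)

theorem HasTransformBound.conv {S : Set ℝ} {ρ₁ ρ₂ : Measure ℝ} {φ₁ φ₂ : ℝ → ℂ} {M₁ M₂ : ℝ → ℝ}
    (h₁ : HasTransformBound ρ₁ S φ₁ M₁) (h₂ : HasTransformBound ρ₂ S φ₂ M₂)
    (hM : ∀ θ ∈ S, 0 ≤ M₁ θ) :
    HasTransformBound (ρ₁ ∗ ρ₂) S (fun y => φ₁ y * φ₂ y) (fun θ => M₁ θ * M₂ θ) := by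
  have := h₁.prob
  have := h₂.prob
  refine ⟨inferInstance, fun y => ?_, fun θ hθ => ?_⟩
  · rw [charFun_conv, h₁.charFun_eq, h₂.charFun_eq]
  · rw [Measure.lintegral_conv (by fun_prop)]
    simp_rw [mul_add, Real.exp_add, ENNReal.ofReal_mul (Real.exp_pos _).le]
    simp_rw [lintegral_const_mul _ (show Measurable fun y => ENNReal.ofReal (Real.exp (θ * y)) by fun_prop)]
    rw [lintegral_mul_const _ (by fun_prop), ENNReal.ofReal_mul (hM θ hθ)]
    exact mul_le_mul' (h₁.lintegral_le θ hθ) (h₂.lintegral_le θ hθ)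

theorem hasTransformBound_dirac (S : Set ℝ) (c : ℝ) :
    HasTransformBound (Measure.dirac c) S (fun y => Complex.exp (y * c * Complex.I))
      (fun θ => Real.exp (θ * c)) := by
  refine ⟨inferInstance, fun y => ?_, fun θ hθ => ?_⟩
  · rw [charFun_dirac]; simp [mul_comm]
  · rw [lintegral_dirac' _ (by fun_prop)]

theorem HasTransformBound.exists_pow {S : Set ℝ} {ρ : Measure ℝ} {φ : ℝ → ℂ} {M : ℝ → ℝ}
    (h : HasTransformBound ρ S φ M) (hM : ∀ θ ∈ S, 0 ≤ M θ) (n : ℕ) :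
    ∃ ρ', HasTransformBound ρ' S (fun y => φ y ^ n) (fun θ => M θ ^ n) := by
  induction n with
  | zero => exact ⟨_, by simpa using hasTransformBound_dirac S 0⟩
  | succ n ih =>
    obtain ⟨ρ', h'⟩ := ih
    exact ⟨_, by simpa [pow_succ] using h'.conv h fun θ hθ => pow_nonneg (hM θ hθ) n⟩

/-- Limit of k-fold convolution powers of (1 - l/k) δ₀ + ν/k, where l is the mass of ν, through (1 +
z/k)^k → e^z for both transforms. -/
theorem exists_compoundPoisson {S : Set ℝ} (ν : Measure ℝ) [IsFiniteMeasure ν]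
    (hν : ∀ θ ∈ S, Integrable (fun t => Real.exp (θ * t)) ν) :
    ∃ ρ, HasTransformBound ρ S
      (fun y => Complex.exp (∫ t, (Complex.exp (y * t * Complex.I) - 1) ∂ν))
      (fun θ => Real.exp (∫ t, (Real.exp (θ * t) - 1) ∂ν)) := by
  set l := ν.real Set.univ with hl
  have hl0 : 0 ≤ l := measureReal_nonneg
  have hint : ∀ y : ℝ, Integrable (fun t : ℝ => Complex.exp (y * t * Complex.I)) ν := fun y =>
    (integrable_const (1 : ℝ)).mono' (by fun_prop)
      (Eventually.of_forall fun t => by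
        rw [← Complex.ofReal_mul, Complex.norm_exp_ofReal_mul_I])
  -- Starting the exponents beyond l keeps the weight 1 - l/k nonnegative from the first term on.
  obtain ⟨N, hN⟩ := exists_nat_gt l
  set k : ℕ → ℝ := fun n => (n : ℝ) + N + 1 with hk
  have hkpos : ∀ n, 0 < k n := fun n => by positivity
  have hkl : ∀ n, l / k n ≤ 1 := fun n => by
    rw [div_le_one (hkpos n)]
    have : (0 : ℝ) ≤ n := Nat.cast_nonneg n
    simp only [hk]; linarith
  set p : ℕ → Measure ℝ := fun n => ENNReal.ofReal (1 - l / k n) • Measure.dirac (0 : ℝ)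
    + ENNReal.ofReal (1 / k n) • ν with hp
  have hpp : ∀ n, HasTransformBound (p n) S
      (fun y => 1 + (∫ t, (Complex.exp (y * t * Complex.I) - 1) ∂ν) / k n)
      (fun θ => 1 + (∫ t, (Real.exp (θ * t) - 1) ∂ν) / k n) := by
    intro n
    have hk0 := hkpos n
    have h1 : 0 ≤ 1 - l / k n := sub_nonneg.2 (hkl n)
    have h2 : 0 ≤ 1 / k n := by positivity
    refine ⟨⟨?_⟩, fun y => ?_, fun θ hθ => ?_⟩
    · simp only [hp, Measure.coe_add, Measure.coe_smul, Pi.add_apply, Pi.smul_apply, measure_univ,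
        smul_eq_mul, mul_one]
      rw [← ofReal_measureReal (μ := ν) (s := Set.univ), ← hl, ← ENNReal.ofReal_mul h2,
        ← ENNReal.ofReal_add h1 (by positivity)]
      rw [show 1 - l / k n + 1 / k n * l = 1 by ring, ENNReal.ofReal_one]
    · have i1 : Integrable (fun t : ℝ => Complex.exp (y * t * Complex.I))
          (ENNReal.ofReal (1 - l / k n) • Measure.dirac (0 : ℝ)) :=
        (integrable_dirac (by simp)).smul_measure ENNReal.ofReal_ne_top
      have i2 : Integrable (fun t : ℝ => Complex.exp (y * t * Complex.I))
          (ENNReal.ofReal (1 / k n) • ν) := (hint y).smul_measure ENNReal.ofReal_ne_top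
      rw [charFun_apply_real, hp, integral_add_measure i1 i2, integral_smul_measure,
        integral_smul_measure, integral_dirac, ENNReal.toReal_ofReal h1, ENNReal.toReal_ofReal h2,
        integral_sub (hint y) (integrable_const _), integral_const, ← hl]
      simp only [Complex.real_smul, Complex.ofReal_zero, mul_zero, zero_mul, Complex.exp_zero]
      push_cast
      ring
    · have i1 := hν θ hθ
      simp only [hp]
      rw [lintegral_add_measure, lintegral_smul_measure, lintegral_smul_measure,
        lintegral_dirac' _ (by fun_prop), ← ofReal_integral_eq_lintegral_ofReal i1
          (Eventually.of_forall fun t => (Real.exp_pos _).le), smul_eq_mul, smul_eq_mul,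
        ← ENNReal.ofReal_mul h1, ← ENNReal.ofReal_mul h2,
        ← ENNReal.ofReal_add (by positivity) (mul_nonneg h2 (integral_nonneg fun t => (Real.exp_pos _).le)),
        integral_sub i1 (integrable_const _), integral_const, ← hl]
      refine ENNReal.ofReal_le_ofReal (le_of_eq ?_)
      simp
      ring
  have hpos : ∀ n, ∀ θ ∈ S, 0 ≤ 1 + (∫ t, (Real.exp (θ * t) - 1) ∂ν) / k n := by
    intro n θ hθ
    rw [integral_sub (hν θ hθ) (integrable_const _), integral_const, ← hl, smul_eq_mul, mul_one, sub_div]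
    have h1 := hkl n
    have h2 : 0 ≤ (∫ t, Real.exp (θ * t) ∂ν) / k n :=
      div_nonneg (integral_nonneg fun t => (Real.exp_pos _).le) (hkpos n).le
    linarith
  choose ρ hρ using fun n => (hpp n).exists_pow (hpos n) (n + N + 1)
  refine exists_hasTransformBound_of_tendsto hρ ?_ (fun y => ?_) (fun θ hθ => ?_)
  · have : Continuous fun y : ℝ => ∫ t, (Complex.exp (y * t * Complex.I) - 1) ∂ν := by
      refine continuous_of_dominated (bound := fun _ => 2) (fun y => by fun_prop)
        (fun y => Eventually.of_forall fun t => ?_) (integrable_const _)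
        (Eventually.of_forall fun t => by fun_prop)
      refine (norm_sub_le _ _).trans ?_
      rw [← Complex.ofReal_mul, Complex.norm_exp_ofReal_mul_I]
      norm_num
    exact (Complex.continuous_exp.comp this).continuousAt
  · have := (Complex.tendsto_one_add_div_pow_exp (∫ t, (Complex.exp (y * t * Complex.I) - 1) ∂ν)).comp
      (tendsto_add_atTop_nat (N + 1))
    refine this.congr fun n => ?_
    simp [hk, add_assoc]
  · have := (Real.tendsto_one_add_div_pow_exp (∫ t, (Real.exp (θ * t) - 1) ∂ν)).comp
      (tendsto_add_atTop_nat (N + 1))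
    refine this.congr fun n => ?_
    simp [hk, add_assoc]

/-! ### Lévy-Khintchine laws with exponential moments -/

/-- The integrand of the Lévy-Khintchine exponent. -/
noncomputable def levyIntegrand (q : ℂ) (t : ℝ) : ℂ :=
  Complex.exp (q * t) - 1 - q * ((1 - Real.exp (-t) : ℝ) : ℂ)

theorem norm_exp_sub_one_sub_id_le_exp (z : ℂ) :
    ‖Complex.exp z - 1 - z‖ ≤ ‖z‖ ^ 2 * Real.exp ‖z‖ := by
  have := Complex.norm_exp_sub_sum_le_norm_mul_exp z 2
  simpa [Finset.sum_range_succ, sub_sub] using this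

/-- With s = 1 - e^{-t}: for t ≤ 1 one has t ≤ 2s and t - s ≤ t², so a second order Taylor bound is
O(s²); for t ≥ 1 one has s ≥ 1/2 and the crude bound suffices. Thus s² takes the role of min(t², 1).
-/
theorem norm_levyIntegrand_le {A θ : ℝ} {q : ℂ} (hq : ‖q‖ ≤ A) (hθ : q.re ≤ θ) {t : ℝ} (ht : 0 < t) :
    ‖levyIntegrand q t‖ ≤ 4 * (A ^ 2 * Real.exp A + A + 2) *
      ((1 - Real.exp (-t)) ^ 2 * Real.exp (θ * t) + (1 - Real.exp (-t)) ^ 2 * Real.exp (0 * t)) := by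
  have hA : 0 ≤ A := (norm_nonneg _).trans hq
  have hE := Real.exp_pos (θ * t)
  have hA2 : 0 ≤ A ^ 2 * Real.exp A := by positivity
  set s := 1 - Real.exp (-t) with hs
  have hs0 : 0 ≤ s := by have : Real.exp (-t) ≤ 1 := Real.exp_le_one_iff.2 (by linarith)
                         linarith
  have hs1 : s ≤ 1 := by have := Real.exp_pos (-t); linarith
  have hst : s ≤ t := by have := Real.add_one_le_exp (-t); linarith
  rw [zero_mul, Real.exp_zero, mul_one]
  have hexp : Real.exp (-t) * (1 + t) ≤ 1 := by
    have h1 := Real.add_one_le_exp t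
    have h2 : Real.exp (-t) * Real.exp t = 1 := by rw [← Real.exp_add]; simp
    nlinarith [Real.exp_pos (-t)]
  rcases le_total t 1 with h1 | h1
  · have hs2 : t / 2 ≤ s := by
      have : Real.exp (-t) ≤ 1 - t / 2 := by nlinarith [Real.exp_pos (-t)]
      linarith
    have hts : t - s ≤ t ^ 2 := by
      have h3 : t * (1 - t) ≤ s := by
        have h4 : Real.exp (-t) ≤ 1 - t * (1 - t) := by
          have : Real.exp (-t) * (1 + t) ≤ (1 - t * (1 - t)) * (1 + t) := by
            have : 0 ≤ t ^ 3 := by positivity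
            nlinarith
          exact le_of_mul_le_mul_right this (by linarith)
        linarith
      nlinarith
    have e : levyIntegrand q t = (Complex.exp (q * t) - 1 - q * t) + q * ((t - s : ℝ) : ℂ) := by
      rw [levyIntegrand, ← hs]; push_cast; ring
    have n1 : ‖q * (t : ℂ)‖ ≤ A * t := by
      rw [norm_mul, Complex.norm_real, Real.norm_of_nonneg ht.le]
      exact mul_le_mul_of_nonneg_right hq ht.le
    have n2 : ‖Complex.exp (q * t) - 1 - q * t‖ ≤ (A * t) ^ 2 * Real.exp A := by
      refine (norm_exp_sub_one_sub_id_le_exp _).trans ?_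
      have : Real.exp ‖q * (t : ℂ)‖ ≤ Real.exp A := Real.exp_le_exp.2 (n1.trans (by nlinarith))
      gcongr
    have n3 : ‖q * ((t - s : ℝ) : ℂ)‖ ≤ A * t ^ 2 := by
      rw [norm_mul, Complex.norm_real, Real.norm_of_nonneg (by linarith)]
      exact mul_le_mul hq hts (by linarith) hA
    have ht2 : t ^ 2 ≤ 4 * s ^ 2 := by nlinarith
    rw [e]
    refine (norm_add_le _ _).trans ((add_le_add n2 n3).trans ?_)
    have : 0 ≤ s ^ 2 * Real.exp (θ * t) := by positivity
    have h5 : (A * t) ^ 2 * Real.exp A + A * t ^ 2 ≤ (A ^ 2 * Real.exp A + A + 2) * (4 * s ^ 2) := by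
      have : (A ^ 2 * Real.exp A + A) * t ^ 2 ≤ (A ^ 2 * Real.exp A + A) * (4 * s ^ 2) := by gcongr
      nlinarith
    nlinarith
  · have hs2 : 1 / 2 ≤ s := by
      have : Real.exp (-t) ≤ 1 / 2 := by nlinarith [Real.exp_pos (-t)]
      linarith
    have n1 : ‖Complex.exp (q * t)‖ ≤ Real.exp (θ * t) := by
      rw [Complex.norm_exp, Complex.re_mul_ofReal]
      exact Real.exp_le_exp.2 (mul_le_mul_of_nonneg_right hθ ht.le)
    have n2 : ‖q * (s : ℂ)‖ ≤ A := by
      rw [norm_mul, Complex.norm_real, Real.norm_of_nonneg hs0]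
      nlinarith [norm_nonneg q]
    have n3 : ‖levyIntegrand q t‖ ≤ Real.exp (θ * t) + 1 + A := by
      rw [levyIntegrand, ← hs]
      refine (norm_sub_le _ _).trans (add_le_add ((norm_sub_le _ _).trans ?_) n2)
      simpa using n1
    have hs4 : 1 ≤ 4 * s ^ 2 := by nlinarith
    have h6 : Real.exp (θ * t) + 1 + A ≤ (A ^ 2 * Real.exp A + A + 2) * (Real.exp (θ * t) + 1) := by
      nlinarith [mul_nonneg hA hE.le, mul_nonneg hA2 hE.le]
    have h7 : 0 ≤ (A ^ 2 * Real.exp A + A + 2) * (Real.exp (θ * t) + 1) := by positivity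
    nlinarith

section LevyMeasure

variable {ν : Measure ℝ} {θ₀ : ℝ}

theorem ae_pos_of_measure_Iic_zero (hν0 : ν (Set.Iic 0) = 0) : ∀ᵐ t ∂ν, 0 < t := by
  rw [ae_iff]; convert hν0 using 2; ext; simp

theorem continuous_levyIntegrand (q : ℂ) : Continuous (levyIntegrand q) := by
  unfold levyIntegrand; fun_prop

theorem integrable_levyIntegrand (hθ₀ : 0 < θ₀) (hν0 : ν (Set.Iic 0) = 0)
    (hν : ∀ θ < θ₀, Integrable (fun t => (1 - Real.exp (-t)) ^ 2 * Real.exp (θ * t)) ν)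
    {q : ℂ} (hq : q.re < θ₀) : Integrable (levyIntegrand q) ν := by
  refine (((hν _ hq).add (hν 0 hθ₀)).const_mul
    (4 * (‖q‖ ^ 2 * Real.exp ‖q‖ + ‖q‖ + 2))).mono'
    (continuous_levyIntegrand q).aestronglyMeasurable ?_
  filter_upwards [ae_pos_of_measure_Iic_zero hν0] with t ht
  exact norm_levyIntegrand_le le_rfl le_rfl ht

theorem differentiableAt_integral_levyIntegrand (hθ₀ : 0 < θ₀) (hν0 : ν (Set.Iic 0) = 0)
    (hν : ∀ θ < θ₀, Integrable (fun t => (1 - Real.exp (-t)) ^ 2 * Real.exp (θ * t)) ν)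
    {q : ℂ} (hq : q.re < θ₀) :
    DifferentiableAt ℂ (fun q => ∫ t, levyIntegrand q t ∂ν) q := by
  obtain ⟨θ, h1, h2⟩ := exists_between hq
  -- Any circle of radius r about a point of the ball of radius r stays in Re ≤ θ, so Cauchy's
  -- estimate bounds the derivative in q by the bound already known for the integrand.
  set r := (θ - q.re) / 2 with hr
  have hr0 : 0 < r := by rw [hr]; linarith
  have hder : ∀ t : ℝ, ∀ z : ℂ, HasDerivAt (fun z => levyIntegrand z t)
      (t * Complex.exp (z * t) - ((1 - Real.exp (-t) : ℝ) : ℂ)) z := by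
    intro t z
    unfold levyIntegrand
    have e1 := ((hasDerivAt_id z).mul_const (t : ℂ)).cexp
    exact ((e1.sub_const 1).sub ((hasDerivAt_id z).mul_const _)).congr_deriv (by simp; ring)
  set A := ‖q‖ + 2 * r
  set bound : ℝ → ℝ := fun t => 4 * (A ^ 2 * Real.exp A + A + 2) *
      ((1 - Real.exp (-t)) ^ 2 * Real.exp (θ * t) + (1 - Real.exp (-t)) ^ 2 * Real.exp (0 * t)) / r
  have := hasDerivAt_integral_of_dominated_loc_of_deriv_le (μ := ν) (F := levyIntegrand)
    (F' := fun z t => t * Complex.exp (z * t) - ((1 - Real.exp (-t) : ℝ) : ℂ)) (x₀ := q)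
    (s := Metric.ball q r) (bound := bound) (Metric.ball_mem_nhds q hr0)
    (Eventually.of_forall fun z => (continuous_levyIntegrand z).aestronglyMeasurable)
    (integrable_levyIntegrand hθ₀ hν0 hν hq) (by fun_prop) ?_
    ((((hν _ h2).add (hν 0 hθ₀)).const_mul _).div_const _)
    (Eventually.of_forall fun t z _ => hder t z)
  · exact this.2.differentiableAt
  · filter_upwards [ae_pos_of_measure_Iic_zero hν0] with t ht z hz
    rw [← (hder t z).deriv]
    refine Complex.norm_deriv_le_of_forall_mem_sphere_norm_le hr0
      (Differentiable.diffContOnCl fun w => (hder t w).differentiableAt) fun w hw => ?_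
    rw [Metric.mem_ball, dist_eq_norm] at hz
    rw [mem_sphere_iff_norm] at hw
    have hwq : ‖w - q‖ ≤ 2 * r := by
      have := norm_add_le (w - z) (z - q)
      rw [sub_add_sub_cancel] at this
      linarith
    refine norm_levyIntegrand_le ?_ ?_ ht
    · have := norm_add_le (w - q) q
      rw [sub_add_cancel] at this
      simp only [A]; linarith
    · have := (abs_le.1 ((Complex.abs_re_le_norm (w - q)).trans hwq)).2
      rw [Complex.sub_re] at this
      rw [hr] at this
      linarith

theorem levyIntegrand_ofReal (θ t : ℝ) :
    levyIntegrand θ t = ((Real.exp (θ * t) - 1 - θ * (1 - Real.exp (-t)) : ℝ) : ℂ) := by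
  rw [levyIntegrand]; push_cast; ring

/-- The restriction of ν to t > 1/(n+1) is finite. The compound Poisson law of the restriction,
shifted by minus the integral of 1 - e^{-t}, has the truncated exponent; the truncations then tend
to the full integral. -/
theorem exists_hasTransformBound_levyKhintchine (hθ₀ : 0 < θ₀) (hν0 : ν (Set.Iic 0) = 0)
    (hν : ∀ θ < θ₀, Integrable (fun t => (1 - Real.exp (-t)) ^ 2 * Real.exp (θ * t)) ν) :
    ∃ ρ, HasTransformBound ρ (Set.Iio θ₀)
      (fun y => Complex.exp (∫ t, levyIntegrand (y * Complex.I) t ∂ν))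
      (fun θ => Real.exp (∫ t, (Real.exp (θ * t) - 1 - θ * (1 - Real.exp (-t))) ∂ν)) := by
  set s : ℕ → Set ℝ := fun n => Set.Ioi (1 / ((n : ℝ) + 1)) with hs
  have hsm : ∀ n, MeasurableSet (s n) := fun n => measurableSet_Ioi
  have hmono : Monotone s := fun m n h => Set.Ioi_subset_Ioi (by gcongr)
  have hunion : ⋃ n, s n = Set.Ioi 0 := by
    ext x
    simp only [hs, Set.mem_iUnion, Set.mem_Ioi]
    exact ⟨fun ⟨n, h⟩ => (by positivity : (0 : ℝ) < 1 / ((n : ℝ) + 1)).trans h, exists_nat_one_div_lt⟩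
  have hbase : ∀ n : ℕ, ∀ θ < θ₀, Integrable (fun t => Real.exp (θ * t)) (ν.restrict (s n)) := by
    intro n θ hθ
    set c := 1 - Real.exp (-(1 / ((n : ℝ) + 1))) with hc
    have hc0 : 0 < c := by
      have : Real.exp (-(1 / ((n : ℝ) + 1))) < 1 := Real.exp_lt_one_iff.2 (by
        have : (0 : ℝ) < 1 / ((n : ℝ) + 1) := by positivity
        linarith)
      linarith
    refine (((hν θ hθ).restrict (s := s n)).const_mul (c ^ 2)⁻¹).mono' (by fun_prop) ?_
    filter_upwards [ae_restrict_mem (hsm n)] with t ht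
    have ht' : 1 / ((n : ℝ) + 1) < t := ht
    have : c ≤ 1 - Real.exp (-t) := by
      have : Real.exp (-t) ≤ Real.exp (-(1 / ((n : ℝ) + 1))) := Real.exp_le_exp.2 (by linarith)
      linarith
    rw [Real.norm_of_nonneg (Real.exp_pos _).le, ← mul_assoc]
    refine le_mul_of_one_le_left (Real.exp_pos _).le ?_
    rw [inv_mul_eq_div, one_le_div (by positivity)]
    gcongr
  have hfin : ∀ n, IsFiniteMeasure (ν.restrict (s n)) := by
    intro n
    have := hbase n 0 hθ₀
    simp only [zero_mul, Real.exp_zero] at this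
    exact (integrable_const_iff_isFiniteMeasure one_ne_zero).1 this
  choose ρ hρ using fun n => exists_compoundPoisson (S := Set.Iio θ₀) (ν.restrict (s n))
    (hbase n)
  have hs1 : ∀ n, Integrable (fun t => 1 - Real.exp (-t)) (ν.restrict (s n)) := fun n => by
    have := (integrable_const (1 : ℝ)).sub (hbase n (-1) (by linarith))
    simpa [Pi.sub_def] using this
  have hconv := fun n => (hρ n).conv (hasTransformBound_dirac _
    (-∫ t in s n, (1 - Real.exp (-t)) ∂ν)) fun θ _ => (Real.exp_pos _).le
  have hlim : ∀ {E : Type} [NormedAddCommGroup E] [NormedSpace ℝ E] (F : ℝ → E), Integrable F ν →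
      Tendsto (fun n => ∫ t in s n, F t ∂ν) atTop (𝓝 (∫ t, F t ∂ν)) := by
    intro E _ _ F hF
    have := tendsto_setIntegral_of_monotone hsm hmono (f := F) (μ := ν) hF.integrableOn
    rwa [hunion, show ν.restrict (Set.Ioi 0) = ν from Measure.restrict_eq_self_of_ae_mem
      (ae_pos_of_measure_Iic_zero hν0)] at this
  refine exists_hasTransformBound_of_tendsto hconv ?_ (fun y => ?_) (fun θ hθ => ?_)
  · have h := (differentiableAt_integral_levyIntegrand hθ₀ hν0 hν (q := ((0 : ℝ) : ℂ) * Complex.I)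
      (by simpa using hθ₀)).continuousAt
    exact (Complex.continuous_exp.continuousAt).comp
      (ContinuousAt.comp (f := fun y : ℝ => (y : ℂ) * Complex.I) h (by fun_prop))
  · have h := hlim _ (integrable_levyIntegrand hθ₀ hν0 hν (q := (y : ℂ) * Complex.I) (by simpa using hθ₀))
    refine ((Complex.continuous_exp.tendsto _).comp h).congr fun n => ?_
    have i1 : Integrable (fun t : ℝ => Complex.exp (y * t * Complex.I) - 1) (ν.restrict (s n)) := by
      refine Integrable.sub ((integrable_const (1 : ℝ)).mono' (by fun_prop)
        (Eventually.of_forall fun t => ?_)) (integrable_const _)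
      rw [← Complex.ofReal_mul, Complex.norm_exp_ofReal_mul_I]
    have i2 : Integrable (fun t : ℝ => y * Complex.I * ((1 - Real.exp (-t) : ℝ) : ℂ)) (ν.restrict (s n)) :=
      ((hs1 n).ofReal).const_mul _
    rw [Function.comp, ← Complex.exp_add]
    congr 1
    have : ∀ t : ℝ, levyIntegrand (y * Complex.I) t = (Complex.exp (y * t * Complex.I) - 1)
        - y * Complex.I * ((1 - Real.exp (-t) : ℝ) : ℂ) := fun t => by
      rw [levyIntegrand]; congr 3; ring_nf
    simp_rw [this]
    rw [integral_sub i1 i2, integral_const_mul, integral_complex_ofReal]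
    push_cast
    ring
  · have hq : ((θ : ℝ) : ℂ).re < θ₀ := by simpa using hθ
    have hi : Integrable (fun t => Real.exp (θ * t) - 1 - θ * (1 - Real.exp (-t))) ν := by
      have := (integrable_levyIntegrand hθ₀ hν0 hν hq).re
      refine this.congr (Eventually.of_forall fun t => ?_)
      simp only [levyIntegrand_ofReal]
      exact Complex.ofReal_re _
    refine ((Real.continuous_exp.tendsto _).comp (hlim _ hi)).congr fun n => ?_
    have i1 : Integrable (fun t => Real.exp (θ * t) - 1) (ν.restrict (s n)) :=
      (hbase n θ hθ).sub (integrable_const _)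
    rw [Function.comp, integral_sub i1 ((hs1 n).const_mul _), integral_const_mul, ← Real.exp_add]
    congr 1
    ring

theorem eqOn_halfPlane_of_eq_mul_I {f g : ℂ → ℂ} (hθ₀ : 0 < θ₀)
    (hf : DifferentiableOn ℂ f {q | q.re < θ₀}) (hg : DifferentiableOn ℂ g {q | q.re < θ₀})
    (h : ∀ y : ℝ, f (y * Complex.I) = g (y * Complex.I)) {q : ℂ} (hq : q.re < θ₀) : f q = g q := by
  have ho : IsOpen {q : ℂ | q.re < θ₀} := isOpen_lt Complex.continuous_re continuous_const
  have hc : IsPreconnected {q : ℂ | q.re < θ₀} := (convex_halfSpace_re_lt θ₀).isPreconnected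
  refine (hf.analyticOnNhd ho).eqOn_of_preconnected_of_frequently_eq (hg.analyticOnNhd ho) hc
    (z₀ := 0) (by simpa using hθ₀) ?_ hq
  have ht : Tendsto (fun n : ℕ => (((1 / ((n : ℝ) + 1) : ℝ) : ℂ) * Complex.I)) atTop (𝓝[≠] 0) := by
    refine tendsto_nhdsWithin_iff.2 ⟨?_, Eventually.of_forall fun n => ?_⟩
    · have := ((Complex.continuous_ofReal.tendsto 0).comp
        (tendsto_one_div_add_atTop_nhds_zero_nat (𝕜 := ℝ))).mul_const Complex.I
      simpa using this
    · have : (0 : ℝ) < 1 / ((n : ℝ) + 1) := by positivity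
      simp only [Set.mem_compl_iff, Set.mem_singleton_iff, mul_eq_zero, Complex.I_ne_zero, or_false]
      exact_mod_cast this.ne'
  exact ht.frequently (Eventually.of_forall fun n => h _).frequently

theorem differentiableOn_integral_cexp {ρ : Measure ℝ}
    (h : ∀ θ < θ₀, Integrable (fun x => Real.exp (θ * x)) ρ) :
    DifferentiableOn ℂ (fun q => ∫ x : ℝ, Complex.exp (q * x) ∂ρ) {q | q.re < θ₀} := by
  refine (differentiableOn_complexMGF (X := id) (μ := ρ)).mono fun q hq => ?_
  exact mem_interior.2 ⟨Set.Iio θ₀, fun θ hθ => h θ hθ, isOpen_Iio, hq⟩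

/-- Both sides are holomorphic on Re q < θ₀ and agree on the imaginary axis, which accumulates at 0.
-/
theorem exists_levyKhintchine (hθ₀ : 0 < θ₀) (hν0 : ν (Set.Iic 0) = 0)
    (hν : ∀ θ < θ₀, Integrable (fun t => (1 - Real.exp (-t)) ^ 2 * Real.exp (θ * t)) ν) :
    ∃ ρ : Measure ℝ, IsProbabilityMeasure ρ ∧ ∀ q : ℂ, q.re < θ₀ →
      Integrable (fun x : ℝ => Complex.exp (q * x)) ρ ∧
      ∫ x : ℝ, Complex.exp (q * x) ∂ρ = Complex.exp (∫ t, levyIntegrand q t ∂ν) := by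
  obtain ⟨ρ, hρ⟩ := exists_hasTransformBound_levyKhintchine hθ₀ hν0 hν
  have hi : ∀ θ < θ₀, Integrable (fun x => Real.exp (θ * x)) ρ := fun θ hθ =>
    ⟨by fun_prop, by
      rw [hasFiniteIntegral_iff_ofReal (Eventually.of_forall fun x => (Real.exp_pos _).le)]
      exact (hρ.lintegral_le θ hθ).trans_lt ENNReal.ofReal_lt_top⟩
  refine ⟨ρ, hρ.prob, fun q hq => ⟨?_, ?_⟩⟩
  · refine (hi _ hq).mono' (by fun_prop) (Eventually.of_forall fun x => ?_)
    rw [Complex.norm_exp, Complex.re_mul_ofReal]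
  · refine eqOn_halfPlane_of_eq_mul_I (f := fun q => ∫ x : ℝ, Complex.exp (q * x) ∂ρ)
      (g := fun q => Complex.exp (∫ t, levyIntegrand q t ∂ν)) hθ₀ (differentiableOn_integral_cexp hi)
      (fun q hq => (differentiableAt_integral_levyIntegrand hθ₀ hν0 hν hq).cexp.differentiableWithinAt)
      (fun y => ?_) hq
    rw [← hρ.charFun_eq y, charFun_apply_real]
    congr with x
    ring_nf

end LevyMeasure

/-! ### Laplace transforms, Gaussian part and infinite divisibility -/

/-- `ρ` is a probability law on `ℝ` with two-sided Laplace transform `F` on `Re q < θ₀`. -/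
structure HasLaplaceTransform (ρ : Measure ℝ) (θ₀ : ℝ) (F : ℂ → ℂ) : Prop where
  prob : IsProbabilityMeasure ρ
  integrable : ∀ q : ℂ, q.re < θ₀ → Integrable (fun x : ℝ => Complex.exp (q * x)) ρ
  integral_eq : ∀ q : ℂ, q.re < θ₀ → ∫ x : ℝ, Complex.exp (q * x) ∂ρ = F q

theorem HasLaplaceTransform.charFun_eq {ρ : Measure ℝ} {θ₀ : ℝ} {F : ℂ → ℂ}
    (h : HasLaplaceTransform ρ θ₀ F) (hθ₀ : 0 < θ₀) (y : ℝ) : charFun ρ y = F (y * Complex.I) := by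
  rw [← h.integral_eq _ (by simpa using hθ₀), charFun_apply_real]
  congr with x
  ring_nf

theorem HasLaplaceTransform.conv {ρ₁ ρ₂ : Measure ℝ} {θ₀ : ℝ} {F₁ F₂ : ℂ → ℂ}
    (h₁ : HasLaplaceTransform ρ₁ θ₀ F₁) (h₂ : HasLaplaceTransform ρ₂ θ₀ F₂) :
    HasLaplaceTransform (ρ₁ ∗ ρ₂) θ₀ (fun q => F₁ q * F₂ q) := by
  have := h₁.prob
  have := h₂.prob
  have e : ∀ q : ℂ, (fun p : ℝ × ℝ => Complex.exp (q * ((p.1 + p.2 : ℝ) : ℂ)))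
      = fun p => Complex.exp (q * p.1) * Complex.exp (q * p.2) := fun q => by
    funext p
    rw [← Complex.exp_add]; push_cast; ring_nf
  refine ⟨inferInstance, fun q hq => ?_, fun q hq => ?_⟩
  · rw [Measure.conv, integrable_map_measure (by fun_prop) (by fun_prop), Function.comp_def, e]
    exact (h₁.integrable q hq).mul_prod (h₂.integrable q hq)
  · rw [Measure.conv, integral_map (by fun_prop) (by fun_prop), e, integral_prod_mul
      (fun x : ℝ => Complex.exp (q * x)) (fun x : ℝ => Complex.exp (q * x)),
      h₁.integral_eq q hq, h₂.integral_eq q hq]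

theorem hasLaplaceTransform_gaussianReal (a : ℝ) (v : NNReal) (θ₀ : ℝ) :
    HasLaplaceTransform (gaussianReal a v) θ₀ (fun q => Complex.exp (q * a + v * q ^ 2 / 2)) := by
  refine ⟨inferInstance, fun q _ => ?_, fun q _ => complexMGF_id_gaussianReal q⟩
  refine (integrable_exp_mul_gaussianReal q.re).mono' (by fun_prop) (Eventually.of_forall fun x => ?_)
  rw [Complex.norm_exp, Complex.re_mul_ofReal]

section LevyMeasure

variable {ν : Measure ℝ} {θ₀ : ℝ}

/-- The Lévy-Khintchine exponent of the triple `(a, v, ν)`. -/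
noncomputable def levyExponent (a v : ℝ) (ν : Measure ℝ) (q : ℂ) : ℂ :=
  a * q + v * q ^ 2 / 2 + ∫ t, levyIntegrand q t ∂ν

/-- Convolution with a Gaussian adds drift and quadratic term; if the Gaussian is nondegenerate, the
convolution inherits its absolute continuity. -/
theorem exists_hasLaplaceTransform_levyExponent (hθ₀ : 0 < θ₀) (hν0 : ν (Set.Iic 0) = 0)
    (hν : ∀ θ < θ₀, Integrable (fun t => (1 - Real.exp (-t)) ^ 2 * Real.exp (θ * t)) ν)
    (a : ℝ) {v : ℝ} (hv : 0 ≤ v) :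
    ∃ ρ : Measure ℝ, HasLaplaceTransform ρ θ₀ (fun q => Complex.exp (levyExponent a v ν q)) ∧
      (0 < v → ρ ≪ volume) := by
  obtain ⟨ρ, hρ, h⟩ := exists_levyKhintchine hθ₀ hν0 hν
  have h' : HasLaplaceTransform ρ θ₀ _ := ⟨hρ, fun q hq => (h q hq).1, fun q hq => (h q hq).2⟩
  refine ⟨ρ ∗ gaussianReal a v.toNNReal, ?_, fun hv => ?_⟩
  · convert h'.conv (hasLaplaceTransform_gaussianReal a v.toNNReal θ₀) using 2 with q
    rw [← Complex.exp_add, levyExponent]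
    congr 1
    have : ((v.toNNReal : ℝ) : ℂ) = v := by rw [Real.coe_toNNReal v hv]
    rw [show ((v.toNNReal : NNReal) : ℂ) = ((v.toNNReal : ℝ) : ℂ) from rfl, this]
    ring
  · exact Measure.conv_absolutelyContinuous
      (gaussianReal_absolutelyContinuous a (Real.toNNReal_pos.2 hv).ne')

/-- The n-th convolution root is the law of the triple (a/n, v/n, ν/n). -/
theorem isInfinitelyDivisible_of_hasLaplaceTransform (hθ₀ : 0 < θ₀) (hν0 : ν (Set.Iic 0) = 0)
    (hν : ∀ θ < θ₀, Integrable (fun t => (1 - Real.exp (-t)) ^ 2 * Real.exp (θ * t)) ν)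
    {a v : ℝ} (hv : 0 ≤ v) {ρ : Measure ℝ}
    (hρ : HasLaplaceTransform ρ θ₀ (fun q => Complex.exp (levyExponent a v ν q))) :
    IsInfinitelyDivisible ρ := by
  intro n hn
  have hn0 : (n : ENNReal) ≠ 0 := by exact_mod_cast (by omega : n ≠ 0)
  have hnC : (n : ℂ) ≠ 0 := by exact_mod_cast (by omega : n ≠ 0)
  obtain ⟨ρ', h', -⟩ := exists_hasLaplaceTransform_levyExponent (ν := (n : ENNReal)⁻¹ • ν) hθ₀
    (by simp [hν0]) (fun θ hθ => (hν θ hθ).smul_measure (ENNReal.inv_ne_top.2 hn0)) (a / n)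
    (v := v / n) (by positivity)
  have := h'.prob
  have := hρ.prob
  have hsum : Measurable fun x : Fin n → ℝ => ∑ i, x i := by fun_prop
  have := Measure.isProbabilityMeasure_map (μ := Measure.pi fun _ : Fin n => ρ') hsum.aemeasurable
  refine ⟨ρ', h'.prob, Measure.ext_of_charFun (funext fun y => ?_)⟩
  rw [hρ.charFun_eq hθ₀, charFun_apply_real, integral_map hsum.aemeasurable (by fun_prop)]
  have e : ∀ x : Fin n → ℝ, Complex.exp (y * ((∑ i, x i : ℝ) : ℂ) * Complex.I)
      = ∏ i, Complex.exp (y * x i * Complex.I) := fun x => by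
    rw [← Complex.exp_sum]; push_cast; rw [Finset.mul_sum, Finset.sum_mul]
  simp_rw [e]
  rw [integral_fintype_prod_eq_pow (fun x : ℝ => Complex.exp (y * x * Complex.I)),
    ← charFun_apply_real, h'.charFun_eq hθ₀, Fintype.card_fin, ← Complex.exp_nat_mul]
  congr 1
  rw [levyExponent, levyExponent, integral_smul_measure]
  simp only [ENNReal.toReal_inv, ENNReal.toReal_natCast, Complex.real_smul]
  push_cast
  field_simp

end LevyMeasure

/-! ### Mellin transforms of laws on the positive half line -/

theorem ofReal_exp_cpow (x : ℝ) (q : ℂ) : ((Real.exp x : ℝ) : ℂ) ^ q = Complex.exp (q * x) := by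
  rw [Complex.cpow_def_of_ne_zero (by exact_mod_cast (Real.exp_pos x).ne'), ← Complex.ofReal_log
    (Real.exp_pos x).le, Real.log_exp, mul_comm]

theorem ofReal_cpow_eq_exp_log {x : ℝ} (hx : 0 < x) (q : ℂ) :
    (x : ℂ) ^ q = Complex.exp (q * Real.log x) := by
  rw [← ofReal_exp_cpow, Real.exp_log hx]

theorem measurable_ofReal_cpow (q : ℂ) : Measurable fun x : ℝ => (x : ℂ) ^ q := by
  fun_prop

theorem ae_pos_of_probabilityMeasure {μ : ProbabilityMeasure ℝ}
    (h : (μ : Measure ℝ) (Set.Iic 0) = 0) : ∀ᵐ x ∂(μ : Measure ℝ), 0 < x :=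
  ae_pos_of_measure_Iic_zero h

/-- The law of `exp X`. -/
noncomputable def expLaw (ρ : Measure ℝ) [IsProbabilityMeasure ρ] : ProbabilityMeasure ℝ :=
  ⟨ρ.map Real.exp, Measure.isProbabilityMeasure_map (by fun_prop)⟩

theorem HasLaplaceTransform.hasMellinOn {ρ : Measure ℝ} [IsProbabilityMeasure ρ] {θ₀ : ℝ} {F : ℂ → ℂ}
    (h : HasLaplaceTransform ρ θ₀ F) : HasMellinOn (expLaw ρ) {q | q.re < θ₀} F := by
  refine ⟨?_, fun q hq => ⟨?_, ?_⟩⟩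
  · change ρ.map Real.exp _ = 0
    rw [Measure.map_apply (by fun_prop) measurableSet_Iic]
    convert measure_empty (μ := ρ)
    ext x
    simp [Real.exp_pos]
  · change Integrable _ (ρ.map Real.exp)
    rw [integrable_map_measure (measurable_ofReal_cpow q).aestronglyMeasurable (by fun_prop),
      Function.comp_def]
    simp_rw [ofReal_exp_cpow]
    exact h.integrable q hq
  · change ∫ x : ℝ, (x : ℂ) ^ q ∂(ρ.map Real.exp) = _
    rw [integral_map (by fun_prop) (measurable_ofReal_cpow q).aestronglyMeasurable]
    simp_rw [ofReal_exp_cpow]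
    exact h.integral_eq q hq

theorem expLaw_map_log (ρ : Measure ℝ) [IsProbabilityMeasure ρ] :
    ((expLaw ρ : ProbabilityMeasure ℝ) : Measure ℝ).map Real.log = ρ := by
  change (ρ.map Real.exp).map Real.log = ρ
  rw [Measure.map_map Real.measurable_log (by fun_prop)]
  simp [Function.comp_def]

/-- The law of `log X`. -/
noncomputable def logLaw (μ : ProbabilityMeasure ℝ) : ProbabilityMeasure ℝ :=
  μ.map Real.measurable_log.aemeasurable

theorem charFun_logLaw {μ : ProbabilityMeasure ℝ} (h : (μ : Measure ℝ) (Set.Iic 0) = 0) (y : ℝ) :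
    charFun (logLaw μ : Measure ℝ) y = mellinOf μ (y * Complex.I) := by
  change charFun ((μ : Measure ℝ).map Real.log) y = _
  rw [charFun_apply_real, integral_map Real.measurable_log.aemeasurable (by fun_prop), mellinOf]
  refine integral_congr_ae ?_
  filter_upwards [ae_pos_of_probabilityMeasure h] with x hx
  rw [ofReal_cpow_eq_exp_log hx]
  ring_nf

theorem map_exp_logLaw {μ : ProbabilityMeasure ℝ} (h : (μ : Measure ℝ) (Set.Iic 0) = 0) :
    (logLaw μ).map (Real.continuous_exp.measurable.aemeasurable) = μ := by
  refine Subtype.ext ?_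
  change ((μ : Measure ℝ).map Real.log).map Real.exp = μ
  rw [Measure.map_map (by fun_prop) Real.measurable_log]
  have : Real.exp ∘ Real.log =ᵐ[(μ : Measure ℝ)] id := by
    filter_upwards [ae_pos_of_probabilityMeasure h] with x hx
    exact Real.exp_log hx
  rw [Measure.map_congr this, Measure.map_id]

/-- On the imaginary axis the Mellin transform of X is the characteristic function of log X. -/
theorem eq_of_mellinOf_eq {μ₁ μ₂ : ProbabilityMeasure ℝ} (h₁ : (μ₁ : Measure ℝ) (Set.Iic 0) = 0)
    (h₂ : (μ₂ : Measure ℝ) (Set.Iic 0) = 0)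
    (h : ∀ y : ℝ, mellinOf μ₁ (y * Complex.I) = mellinOf μ₂ (y * Complex.I)) : μ₁ = μ₂ := by
  have h' : (logLaw μ₁ : Measure ℝ) = logLaw μ₂ := Measure.ext_of_charFun <| funext fun y => by
    rw [charFun_logLaw h₁, charFun_logLaw h₂, h]
  have : logLaw μ₁ = logLaw μ₂ := Subtype.ext h'
  rw [← map_exp_logLaw h₁, ← map_exp_logLaw h₂, this]

/-- The logarithms converge weakly by Lévy's theorem, and exp is continuous. A countably generated
filter allows the reduction to sequences. -/
theorem tendsto_of_tendsto_mellinOf {ι : Type*} {l : Filter ι} [l.IsCountablyGenerated]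
    {μ : ι → ProbabilityMeasure ℝ} {μ₀ : ProbabilityMeasure ℝ}
    (hμ : ∀ᶠ i in l, (μ i : Measure ℝ) (Set.Iic 0) = 0) (hμ₀ : (μ₀ : Measure ℝ) (Set.Iic 0) = 0)
    (h : ∀ y : ℝ, Tendsto (fun i => mellinOf (μ i) (y * Complex.I)) l
      (𝓝 (mellinOf μ₀ (y * Complex.I)))) : Tendsto μ l (𝓝 μ₀) := by
  have ht : Tendsto (fun i => logLaw (μ i)) l (𝓝 (logLaw μ₀)) := by
    refine tendsto_of_seq_tendsto fun u hu => ?_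
    refine ProbabilityMeasure.tendsto_iff_tendsto_charFun.2 fun y => ?_
    rw [charFun_logLaw hμ₀]
    refine ((h y).comp hu).congr' ?_
    filter_upwards [hu.eventually hμ] with n hn
    exact (charFun_logLaw hn y).symm
  have := ProbabilityMeasure.tendsto_map_of_tendsto_of_continuous _ _ ht Real.continuous_exp
  rw [map_exp_logLaw hμ₀] at this
  refine this.congr' ?_
  filter_upwards [hμ] with i hi
  exact map_exp_logLaw hi

theorem HasMellinOn.lawDiv {μ : ProbabilityMeasure ℝ} {S : Set ℂ} {F : ℂ → ℂ}
    (h : HasMellinOn μ S F) {c : ℝ} (hc : 0 < c) :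
    HasMellinOn (lawDiv μ c) S (fun q => F q * (c : ℂ) ^ (-q)) := by
  have hm : Measurable fun x : ℝ => x / c := by fun_prop
  have e : ∀ q : ℂ, ∀ᵐ x : ℝ ∂(μ : Measure ℝ), ((x / c : ℝ) : ℂ) ^ q = (x : ℂ) ^ q * (c : ℂ) ^ (-q) := by
    intro q
    filter_upwards [ae_pos_of_probabilityMeasure h.1] with x hx
    rw [ofReal_cpow_eq_exp_log hx, ofReal_cpow_eq_exp_log hc, ofReal_cpow_eq_exp_log (by positivity),
      ← Complex.exp_add, Real.log_div hx.ne' hc.ne']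
    congr 1
    rw [Complex.ofReal_sub]
    ring
  refine ⟨?_, fun q hq => ⟨?_, ?_⟩⟩
  · change (μ : Measure ℝ).map (fun x => x / c) _ = 0
    rw [Measure.map_apply hm measurableSet_Iic]
    convert h.1 using 2
    ext x
    simp [div_nonpos_iff, hc.le, hc.not_ge]
  · change Integrable _ ((μ : Measure ℝ).map (fun x => x / c))
    rw [integrable_map_measure (measurable_ofReal_cpow q).aestronglyMeasurable hm.aemeasurable]
    refine (((h.2 q hq).1.mul_const ((c : ℂ) ^ (-q))).congr ?_)
    filter_upwards [e q] with x hx using hx.symm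
  · change ∫ x : ℝ, (x : ℂ) ^ q ∂((μ : Measure ℝ).map (fun x => x / c)) = _
    rw [integral_map hm.aemeasurable (measurable_ofReal_cpow q).aestronglyMeasurable,
      integral_congr_ae (e q), integral_mul_const]
    exact congrArg (· * _) (h.2 q hq).2

/-! ### Lévy form of ratios of double gamma functions -/

section GammaRatio

variable {ι : Type*} [Fintype ι]

/-- The Lévy density attached to the ratio `∏ᵢ Γ₂(wᵢ - q | a, b) ^ σᵢ`. -/
noncomputable def gammaLevyDensity (a b : ℝ) (σ w : ι → ℝ) (t : ℝ) : ℝ :=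
  (∑ i, σ i * Real.exp (-w i * t)) / ((1 - Real.exp (-a * t)) * (1 - Real.exp (-b * t))) / t

/-- The Lévy measure attached to the ratio `∏ᵢ Γ₂(wᵢ - q | a, b) ^ σᵢ`. -/
noncomputable def gammaLevyMeasure (a b : ℝ) (σ w : ι → ℝ) : Measure ℝ :=
  (volume.restrict (Set.Ioi 0)).withDensity fun t => ENNReal.ofReal (gammaLevyDensity a b σ w t)

theorem gammaLevyMeasure_Iic_zero (a b : ℝ) (σ w : ι → ℝ) :
    gammaLevyMeasure a b σ w (Set.Iic 0) = 0 := by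
  refine withDensity_absolutelyContinuous _ _ ?_
  rw [Measure.restrict_apply measurableSet_Iic]
  rw [show Set.Iic (0 : ℝ) ∩ Set.Ioi 0 = ∅ by ext x; simp, measure_empty]

theorem measurable_gammaLevyDensity (a b : ℝ) (σ w : ι → ℝ) :
    Measurable (gammaLevyDensity a b σ w) := by
  unfold gammaLevyDensity; fun_prop

theorem zetaKernel_sum_shift (a b : ℝ) (σ w : ι → ℝ) (q : ℂ) (t : ℝ) :
    ∑ i, (σ i : ℂ) * zetaKernel a b (w i - q) t / t
      = Complex.exp (q * t) * (gammaLevyDensity a b σ w t : ℂ) := by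
  rw [gammaLevyDensity]
  push_cast
  rw [Finset.sum_div, Finset.sum_div, Finset.mul_sum]
  refine Finset.sum_congr rfl fun i _ => ?_
  rw [sub_eq_add_neg, zetaKernel_add, zetaKernel, neg_neg]
  ring

/-- The factor (1 - e^{-t})² is a second difference: the weights σᵢ(1, -2, 1) at wᵢ - θ + {0, 1, 2}
annihilate 1 and w, and annihilate w² because Σσᵢ = 0. Integrability is then that of an
unregularized combination. -/
theorem integrableOn_gammaLevyDensity_mul_sq {a b : ℝ} (ha : 0 < a) (hb : 0 < b) {σ w : ι → ℝ}
    (hσ : ∑ i, σ i = 0) {θ : ℝ} (hw : ∀ i, θ < w i) :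
    IntegrableOn (fun t => gammaLevyDensity a b σ w t * ((1 - Real.exp (-t)) ^ 2 * Real.exp (θ * t)))
      (Set.Ioi 0) := by
  have hσ' : ∑ i, (σ i : ℂ) = 0 := by exact_mod_cast hσ
  have h := sum_mul_logDoubleGamma_of_sq (ι := ι × Fin 3) ha hb
    (fun p => (σ p.1 : ℂ) * ![1, -2, 1] p.2)
    (fun p => w p.1 - (θ : ℂ) + ![0, 1, 2] p.2) ?_ ?_ ?_ ?_
  · have h2 := h.1.re
    refine h2.congr (Eventually.of_forall fun t => ?_)
    have e2 : Complex.exp (-2 * t) = Complex.exp (-t) ^ 2 := by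
      rw [← Complex.exp_nat_mul]; push_cast; ring_nf
    have key : (∑ p : ι × Fin 3, (σ p.1 : ℂ) * ![1, -2, 1] p.2 *
        zetaKernel a b (w p.1 - (θ : ℂ) + ![0, 1, 2] p.2) t) / t
        = ((gammaLevyDensity a b σ w t * ((1 - Real.exp (-t)) ^ 2 * Real.exp (θ * t)) : ℝ) : ℂ) := by
      have h3 := zetaKernel_sum_shift a b σ w θ t
      rw [Fintype.sum_prod_type]
      simp only [Fin.sum_univ_three, Matrix.cons_val_zero, Matrix.cons_val_one, Matrix.cons_val,
        zetaKernel_add, e2, neg_one_mul, neg_zero, zero_mul, Complex.exp_zero]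
      push_cast
      rw [mul_comm ((gammaLevyDensity a b σ w t : ℝ) : ℂ), mul_assoc, ← h3, Finset.sum_div, Finset.mul_sum]
      exact Finset.sum_congr rfl fun i _ => by ring
    simp only [key]
    exact Complex.ofReal_re _
  · rintro ⟨i, j⟩
    have := hw i
    fin_cases j <;> simp <;> linarith
  · rw [Fintype.sum_prod_type]
    simp only [Fin.sum_univ_three, Matrix.cons_val_zero, Matrix.cons_val_one, Matrix.cons_val]
    exact Finset.sum_eq_zero fun i _ => by ring
  · rw [Fintype.sum_prod_type]
    simp only [Fin.sum_univ_three, Matrix.cons_val_zero, Matrix.cons_val_one, Matrix.cons_val]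
    exact Finset.sum_eq_zero fun i _ => by ring
  · rw [Fintype.sum_prod_type]
    simp only [Fin.sum_univ_three, Matrix.cons_val_zero, Matrix.cons_val_one, Matrix.cons_val]
    rw [show ∑ i, ((σ i : ℂ) * 1 * (w i - (θ : ℂ) + 0) ^ 2 + σ i * -2 * (w i - (θ : ℂ) + 1) ^ 2
      + σ i * 1 * (w i - (θ : ℂ) + 2) ^ 2) = 2 * ∑ i, (σ i : ℂ) by
        rw [Finset.mul_sum]; exact Finset.sum_congr rfl fun i _ => by ring, hσ', mul_zero]

/-- The weights σᵢ(1, -(1+q), q) at wᵢ - q, wᵢ, wᵢ + 1 annihilate quadratics when Σσᵢ = 0, and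
multiply the density by e^{qt} - 1 - q(1 - e^{-t}). This is the reason for the compensator 1 -
e^{-t} in `levyIntegrand`. -/
theorem sum_mul_logDoubleGamma_sub {a b : ℝ} (ha : 0 < a) (hb : 0 < b) {σ w : ι → ℝ}
    (hσ : ∑ i, σ i = 0) {q : ℂ} (hw : ∀ i, 0 < w i) (hq : ∀ i, q.re < w i) :
    ∑ i, (σ i : ℂ) * logDoubleGamma a b (w i - q) = ∑ i, (σ i : ℂ) * logDoubleGamma a b (w i)
      + q * ∑ i, (σ i : ℂ) * (logDoubleGamma a b (w i) - logDoubleGamma a b (w i + 1))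
      + ∫ t in Set.Ioi (0 : ℝ), (gammaLevyDensity a b σ w t : ℂ) * levyIntegrand q t := by
  have hσ' : ∑ i, (σ i : ℂ) = 0 := by exact_mod_cast hσ
  have h := sum_mul_logDoubleGamma_of_sq (ι := ι × Fin 3) ha hb
    (fun p => (σ p.1 : ℂ) * ![1, -(1 + q), q] p.2)
    (fun p => w p.1 - ![q, 0, -1] p.2) ?_ ?_ ?_ ?_
  · have h2 := h.2
    have key : ∀ t : ℝ, (∑ p : ι × Fin 3, (σ p.1 : ℂ) * ![1, -(1 + q), q] p.2 *
        zetaKernel a b (w p.1 - ![q, 0, -1] p.2) t) / t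
        = (gammaLevyDensity a b σ w t : ℂ) * levyIntegrand q t := by
      intro t
      have h3 := zetaKernel_sum_shift a b σ w q t
      have h4 := zetaKernel_sum_shift a b σ w 0 t
      have h5 := zetaKernel_sum_shift a b σ w (-1) t
      rw [zero_mul, Complex.exp_zero] at h4
      rw [levyIntegrand]
      rw [Fintype.sum_prod_type]
      simp only [Fin.sum_univ_three, Matrix.cons_val_zero, Matrix.cons_val_one, Matrix.cons_val]
      push_cast
      have : (gammaLevyDensity a b σ w t : ℂ) * (Complex.exp (q * t) - 1 - q * (1 - Complex.exp (-t)))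
        = Complex.exp (q * t) * (gammaLevyDensity a b σ w t : ℂ)
          - (1 + q) * (1 * (gammaLevyDensity a b σ w t : ℂ))
          + q * (Complex.exp (-1 * t) * (gammaLevyDensity a b σ w t : ℂ)) := by
        rw [neg_one_mul]; ring
      rw [this, ← h3, ← h4, ← h5, Finset.sum_div, Finset.mul_sum, Finset.mul_sum,
        ← Finset.sum_sub_distrib, ← Finset.sum_add_distrib]
      exact Finset.sum_congr rfl fun i _ => by ring
    simp only [key] at h2
    rw [← h2, Fintype.sum_prod_type]
    simp only [Fin.sum_univ_three, Matrix.cons_val_zero, Matrix.cons_val_one, Matrix.cons_val]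
    rw [Finset.mul_sum, ← Finset.sum_add_distrib, ← Finset.sum_add_distrib]
    refine Finset.sum_congr rfl fun i _ => ?_
    rw [sub_neg_eq_add, sub_zero]
    ring
  · rintro ⟨i, j⟩
    have := hw i
    have := hq i
    fin_cases j <;> simp <;> linarith
  · rw [Fintype.sum_prod_type]
    simp only [Fin.sum_univ_three, Matrix.cons_val_zero, Matrix.cons_val_one, Matrix.cons_val]
    exact Finset.sum_eq_zero fun i _ => by ring
  · rw [Fintype.sum_prod_type]
    simp only [Fin.sum_univ_three, Matrix.cons_val_zero, Matrix.cons_val_one, Matrix.cons_val]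
    exact Finset.sum_eq_zero fun i _ => by ring
  · rw [Fintype.sum_prod_type]
    simp only [Fin.sum_univ_three, Matrix.cons_val_zero, Matrix.cons_val_one, Matrix.cons_val]
    rw [show ∑ i, ((σ i : ℂ) * 1 * (w i - q) ^ 2 + σ i * -(1 + q) * (w i - (0 : ℂ)) ^ 2
      + σ i * q * (w i - (-1 : ℂ)) ^ 2) = (q ^ 2 + q) * ∑ i, (σ i : ℂ) by
        rw [Finset.mul_sum]; exact Finset.sum_congr rfl fun i _ => by ring, hσ', mul_zero]

theorem integrable_gammaLevyMeasure {a b : ℝ} (ha : 0 < a) (hb : 0 < b) {σ w : ι → ℝ}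
    (hσ : ∑ i, σ i = 0) (hpos : ∀ t, 0 < t → 0 ≤ gammaLevyDensity a b σ w t)
    {θ : ℝ} (hw : ∀ i, θ < w i) :
    Integrable (fun t => (1 - Real.exp (-t)) ^ 2 * Real.exp (θ * t)) (gammaLevyMeasure a b σ w) := by
  rw [gammaLevyMeasure, integrable_withDensity_iff_integrable_smul'
    (measurable_gammaLevyDensity a b σ w).ennreal_ofReal (by simp)]
  refine (integrableOn_gammaLevyDensity_mul_sq ha hb hσ hw).congr ?_
  filter_upwards [ae_restrict_mem measurableSet_Ioi] with t ht
  rw [ENNReal.toReal_ofReal (hpos t ht), smul_eq_mul]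

/-- The Lévy-Khintchine form of the logarithm of a ratio of double gamma functions. -/
theorem exists_sum_mul_logDoubleGamma_sub_eq {a b : ℝ} (ha : 0 < a) (hb : 0 < b) {σ w : ι → ℝ}
    (hσ : ∑ i, σ i = 0) (hpos : ∀ t, 0 < t → 0 ≤ gammaLevyDensity a b σ w t)
    (hw : ∀ i, 0 < w i) : ∃ d : ℝ, ∀ q : ℂ,
    (∀ i, q.re < w i) →
    ∑ i, (σ i : ℂ) * logDoubleGamma a b (w i - q) = ∑ i, (σ i : ℂ) * logDoubleGamma a b (w i)
      + d * q + ∫ t, levyIntegrand q t ∂(gammaLevyMeasure a b σ w) := by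
  refine ⟨∑ i, σ i * ((logDoubleGamma a b (w i)).re - (logDoubleGamma a b ((w i + 1 : ℝ))).re),
    fun q hq => ?_⟩
  rw [sum_mul_logDoubleGamma_sub ha hb hσ hw hq, gammaLevyMeasure,
    integral_withDensity_eq_integral_toReal_smul
      (measurable_gammaLevyDensity a b σ w).ennreal_ofReal (by simp)]
  congr 1
  · congr 1
    rw [mul_comm]
    push_cast
    congr 1
    refine Finset.sum_congr rfl fun i _ => ?_
    rw [← logDoubleGamma_ofReal a b (w i), ← Complex.ofReal_one, ← Complex.ofReal_add,
      ← logDoubleGamma_ofReal]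
  · refine setIntegral_congr_fun measurableSet_Ioi fun t ht => ?_
    simp only [ENNReal.toReal_ofReal (hpos t ht), Complex.real_smul]

end GammaRatio

/-! ### The Selberg integral laws -/

/-- The logarithm of the Mellin transform of the Selberg integral distribution, without the
factor `Γ(1 - 1/τ)`. -/
noncomputable def selbergExponent (τ : ℝ) (q : ℂ) : ℂ :=
  q / τ * Real.log τ + q * Real.log (2 * Real.pi)
    + 2 * (logDoubleGamma 1 τ (1 + τ - q) - logDoubleGamma 1 τ (1 + τ))
    + (logDoubleGamma 1 τ (τ - q) - logDoubleGamma 1 τ τ)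
    + (logDoubleGamma 1 τ (2 + 2 * τ - q) - logDoubleGamma 1 τ (2 * (1 + τ - q)))

theorem selbergMellin_eq {τ : ℝ} (hτ : 1 < τ) {q : ℂ} (hq : q.re < τ) :
    selbergMellin τ 0 0 q
      = Complex.exp (selbergExponent τ q) * ((Real.Gamma (1 - 1 / τ) : ℝ) : ℂ) ^ (-q) := by
  have hτ0 : 0 < τ := by linarith
  have hG : ∀ w : ℂ, 0 < w.re → doubleGamma 1 τ w = Complex.exp (logDoubleGamma 1 τ w) :=
    fun w hw => doubleGamma_eq one_pos hτ0 hw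
  have e1 : (τ : ℂ) ^ (q / τ) = Complex.exp (q / τ * Real.log τ) := ofReal_cpow_eq_exp_log hτ0 _
  have e2 : (2 * Real.pi : ℂ) ^ q = Complex.exp (q * Real.log (2 * Real.pi)) := by
    have := ofReal_cpow_eq_exp_log (show (0 : ℝ) < 2 * Real.pi by positivity) q
    rw [← this]; push_cast; rfl
  rw [selbergMellin, e1, e2]
  simp only [Complex.ofReal_zero, add_zero, mul_one]
  rw [show 1 - q + (τ : ℂ) = 1 + τ - q by ring, show -q + (τ : ℂ) = τ - q by ring,
    show 2 - q + (τ : ℂ) * 2 = 2 + 2 * τ - q by ring,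
    show 2 - 2 * q + (τ : ℂ) * 2 = 2 * (1 + τ - q) by ring,
    hG (1 + τ - q) (by simp; linarith), hG (1 + τ) (by simp; linarith), hG (τ - q) (by simp; linarith),
    hG τ (by simpa using hτ0), hG (2 + 2 * τ - q) (by simp; linarith),
    hG (2 * (1 + τ - q)) (by simp; linarith), selbergExponent]
  simp only [← Complex.exp_sub]
  rw [show ∀ A B C D E F H : ℂ, A * B * C * D * E * F * H = A * B * D * E * F * H * C by intros; ring]
  simp only [← Complex.exp_add]
  congr 2
  ring

/-- The exponents in the Lévy density of the Selberg integral distribution. -/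
def selbergSigns : Fin 6 → ℝ := ![1, 1, 1, -1, -1, -1]

/-- The points in the Lévy density of the Selberg integral distribution. -/
noncomputable def selbergPoints (τ : ℝ) : Fin 6 → ℝ :=
  ![1 + τ, τ, 2 + 2 * τ, 1 + τ + 1 / 2, 1 + τ + τ / 2, 1 + τ + (1 + τ) / 2]

theorem le_selbergPoints {τ : ℝ} (hτ : 0 < τ) (i : Fin 6) : τ ≤ selbergPoints τ i := by
  fin_cases i <;> simp [selbergPoints] <;> linarith

/-- In x = e^{-t/2} and y = e^{-τt/2} the numerator is a polynomial which can be written as a sum of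
products of manifestly nonnegative factors on 0 < x, y ≤ 1. -/
theorem gammaLevyDensity_selberg_nonneg {τ : ℝ} (hτ : 0 < τ) {t : ℝ} (ht : 0 < t) :
    0 ≤ gammaLevyDensity 1 τ selbergSigns (selbergPoints τ) t := by
  set x := Real.exp (-(t / 2)) with hx
  set y := Real.exp (-(τ * t / 2)) with hy
  have hx0 : 0 < x := Real.exp_pos _
  have hy0 : 0 < y := Real.exp_pos _
  have hx1 : x ≤ 1 := Real.exp_le_one_iff.2 (by linarith)
  have hy1 : y ≤ 1 := Real.exp_le_one_iff.2 (by have := mul_pos hτ ht; linarith)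
  have hpow : ∀ (m n : ℕ) (w : ℝ), w = m / 2 + n * τ / 2 → Real.exp (-w * t) = x ^ m * y ^ n := by
    intro m n w hw
    rw [hx, hy, ← Real.exp_nat_mul, ← Real.exp_nat_mul, ← Real.exp_add, hw]
    congr 1; ring
  have hN : ∑ i, selbergSigns i * Real.exp (-selbergPoints τ i * t)
      = y ^ 2 * ((1 - x ^ 2 * y) * (1 - x * (x ^ 2 * y)) + ((x ^ 2 * y) ^ 2 + x ^ 2) * (1 - x)) := by
    simp only [selbergSigns, selbergPoints, Fin.sum_univ_six, Matrix.cons_val_zero,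
      Matrix.cons_val_one, Matrix.cons_val]
    rw [hpow 2 2 (1 + τ) (by push_cast; ring), hpow 0 2 τ (by push_cast; ring),
      hpow 4 4 (2 + 2 * τ) (by push_cast; ring), hpow 3 2 (1 + τ + 1 / 2) (by push_cast; ring),
      hpow 2 3 (1 + τ + τ / 2) (by push_cast; ring),
      hpow 3 3 (1 + τ + (1 + τ) / 2) (by push_cast; ring)]
    ring
  have hz1 : x ^ 2 * y ≤ 1 := mul_le_one₀ (pow_le_one₀ hx0.le hx1) hy0.le hy1
  have hz2 : x * (x ^ 2 * y) ≤ 1 := mul_le_one₀ hx1 (by positivity) hz1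
  rw [gammaLevyDensity, hN]
  have h1 : 0 ≤ 1 - Real.exp (-1 * t) := sub_nonneg.2 (Real.exp_le_one_iff.2 (by linarith))
  have h2 : 0 ≤ 1 - Real.exp (-τ * t) := sub_nonneg.2 (Real.exp_le_one_iff.2 (by nlinarith))
  have h3 := sub_nonneg.2 hx1
  have h4 := sub_nonneg.2 hz1
  have h5 := sub_nonneg.2 hz2
  positivity

/-- The Lévy measure of the logarithm of the Selberg integral distribution. -/
noncomputable def selbergLevyMeasure (τ : ℝ) : Measure ℝ :=
  gammaLevyMeasure 1 τ selbergSigns (selbergPoints τ)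

theorem sum_selbergSigns : ∑ i, selbergSigns i = 0 := by
  simp [selbergSigns, Fin.sum_univ_six]

theorem selbergLevyMeasure_integrable {τ : ℝ} (hτ : 0 < τ) {θ : ℝ} (hθ : θ < τ) :
    Integrable (fun t => (1 - Real.exp (-t)) ^ 2 * Real.exp (θ * t)) (selbergLevyMeasure τ) :=
  integrable_gammaLevyMeasure one_pos hτ sum_selbergSigns
    (fun _ => gammaLevyDensity_selberg_nonneg hτ) fun i => hθ.trans_le (le_selbergPoints hτ i)

/-- Duplication at 1 + τ - q cancels one of the two copies of log Γ₂(1+τ-q) and leaves the six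
points of `selbergPoints`. The polynomial multiplying log 2 has quadratic part 2q²/τ, that is,
variance 4 log 2 / τ; its linear part goes into the drift. -/
theorem exists_selbergExponent_eq {τ : ℝ} (hτ : 0 < τ) : ∃ a : ℝ, ∀ q : ℂ, q.re < τ →
    selbergExponent τ q = levyExponent a (4 * Real.log 2 / τ) (selbergLevyMeasure τ) q := by
  obtain ⟨d, hd⟩ := exists_sum_mul_logDoubleGamma_sub_eq one_pos hτ sum_selbergSigns
    (fun _ => gammaLevyDensity_selberg_nonneg hτ) fun i => hτ.trans_le (le_selbergPoints hτ i)
  refine ⟨Real.log τ / τ + Real.log (2 * Real.pi) + d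
    + Real.log 2 * (1 + 1 / τ - 4 * (1 + τ) / τ), fun q hq => ?_⟩
  have hτC : (τ : ℂ) ≠ 0 := by exact_mod_cast hτ.ne'
  have h := hd q fun i => hq.trans_le (le_selbergPoints hτ i)
  have h1 := logDoubleGamma_two_mul one_pos hτ (w := 1 + τ - q) (by simp; linarith)
  have h2 := logDoubleGamma_two_mul one_pos hτ (w := 1 + τ) (by simp; linarith)
  rw [selbergExponent, levyExponent, selbergLevyMeasure]
  generalize ∫ t, levyIntegrand q t ∂gammaLevyMeasure 1 τ selbergSigns (selbergPoints τ) = I at h ⊢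
  simp only [selbergSigns, selbergPoints, Fin.sum_univ_six, Matrix.cons_val_zero,
      Matrix.cons_val_one, Matrix.cons_val] at h
  push_cast at h h1 h2
  rw [show (1 : ℂ) + τ + 1 / 2 - q = 1 + τ - q + 1 / 2 by ring,
    show (1 : ℂ) + τ + τ / 2 - q = 1 + τ - q + τ / 2 by ring,
    show (1 : ℂ) + τ + (1 + τ) / 2 - q = 1 + τ - q + (1 + τ) / 2 by ring] at h
  rw [show (2 : ℂ) * (1 + τ) = 2 + 2 * τ by ring] at h2
  have hz : kernelCoeffZero (1 / 2) (τ / 2) (1 + τ - q) - kernelCoeffZero (1 / 2) (τ / 2) (1 + τ)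
      = 2 / τ * q ^ 2 + (1 + 1 / τ - 4 * (1 + τ) / τ) * q := by
    simp only [kernelCoeffZero]
    push_cast
    field_simp
    ring
  push_cast
  linear_combination h - h1 + h2 + Real.log 2 * hz

theorem exists_hasLaplaceTransform_selbergExponent {τ : ℝ} (hτ : 0 < τ) :
    ∃ ρ : Measure ℝ, HasLaplaceTransform ρ τ (fun q => Complex.exp (selbergExponent τ q)) ∧
      ρ ≪ volume ∧ IsInfinitelyDivisible ρ := by
  obtain ⟨a, ha⟩ := exists_selbergExponent_eq hτ
  have hl := Real.log_pos one_lt_two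
  obtain ⟨ρ, hρ, hac⟩ := exists_hasLaplaceTransform_levyExponent hτ
    (gammaLevyMeasure_Iic_zero 1 τ selbergSigns (selbergPoints τ))
    (fun θ hθ => selbergLevyMeasure_integrable hτ hθ) a (v := 4 * Real.log 2 / τ) (by positivity)
  refine ⟨ρ, ⟨hρ.prob, hρ.integrable, fun q hq => ?_⟩, hac (by positivity),
    isInfinitelyDivisible_of_hasLaplaceTransform hτ
    (gammaLevyMeasure_Iic_zero 1 τ selbergSigns (selbergPoints τ))
    (fun θ hθ => selbergLevyMeasure_integrable hτ hθ) (by positivity) hρ⟩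
  rw [hρ.integral_eq q hq, ha q hq]
  rfl

theorem existsUnique_isSelbergLaw {τ : ℝ} (hτ : 1 < τ) :
    ∃! μ : ProbabilityMeasure ℝ, IsSelbergLaw τ 0 0 μ := by
  have hτ0 : 0 < τ := by linarith
  obtain ⟨ρ, hρ, -, -⟩ := exists_hasLaplaceTransform_selbergExponent hτ0
  have := hρ.prob
  have hΓ : 0 < Real.Gamma (1 - 1 / τ) := Real.Gamma_pos_of_pos (by
    rw [sub_pos, div_lt_one hτ0]; exact hτ)
  refine ⟨lawDiv (expLaw ρ) (Real.Gamma (1 - 1 / τ)), ?_, fun μ hμ => ?_⟩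
  · have h := hρ.hasMellinOn.lawDiv hΓ
    exact ⟨h.1, fun q hq => ⟨(h.2 q hq).1, by rw [(h.2 q hq).2, selbergMellin_eq hτ hq]⟩⟩
  · have h := hρ.hasMellinOn.lawDiv hΓ
    refine eq_of_mellinOf_eq hμ.1 h.1 fun y => ?_
    have hy : ((y : ℂ) * Complex.I) ∈ {q : ℂ | q.re < τ} := by simpa using hτ0
    rw [(hμ.2 _ hy).2, (h.2 _ hy).2, selbergMellin_eq hτ hy]

/-- Each Γ₂ is replaced by its expression through G. The powers of 2π add up to exponent 0 and the
normalizing constants Γ₂(1) cancel. -/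
theorem exp_selbergExponent_one {q : ℂ} (hq : q.re < 1) :
    Complex.exp (selbergExponent 1 q) = criticalMellin q := by
  have h := fun (z : ℂ) (hz : 0 < z.re) => exp_logDoubleGamma_mul_barnesG hz
  have g := fun (z : ℂ) (hz : 0 < z.re) => barnesG_ne_zero_of_re_pos hz
  have h' : ∀ z : ℂ, 0 < z.re → Complex.exp (logDoubleGamma 1 1 z)
      = Complex.exp (logDoubleGamma 1 1 1 + (z - 1) / 2 * Real.log (2 * Real.pi)) / barnesG z := by
    intro z hz
    rw [Complex.exp_add, ← h z hz, ← mul_assoc, ← Complex.exp_add, add_sub_cancel,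
      mul_div_cancel_right₀ _ (g z hz)]
  have hG2 : barnesG 2 = 1 := by simpa [one_add_one_eq_two] using barnesG_nat_add_one 1
  have q1 : 0 < (1 - q).re := by simp; linarith
  have q2 : 0 < (2 - q).re := by simp; linarith
  have q4 : 0 < (4 - q).re := by simp; linarith
  have q5 : 0 < (4 - 2 * q).re := by simp; linarith
  have hexp : Complex.exp (selbergExponent 1 q)
      = Complex.exp (q * Real.log (2 * Real.pi)) * (Complex.exp (logDoubleGamma 1 1 (2 - q)) ^ 2
        / Complex.exp (logDoubleGamma 1 1 2) ^ 2) * (Complex.exp (logDoubleGamma 1 1 (1 - q))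
        / Complex.exp (logDoubleGamma 1 1 1)) * (Complex.exp (logDoubleGamma 1 1 (4 - q)) /
        Complex.exp (logDoubleGamma 1 1 (4 - 2 * q))) := by
    simp only [← Complex.exp_nat_mul, ← Complex.exp_sub, ← Complex.exp_add]
    congr 1
    simp only [selbergExponent, Real.log_one, Complex.ofReal_one, Complex.ofReal_zero]
    rw [show 1 + 1 - q = 2 - q by ring, show (1 : ℂ) + 1 = 2 by norm_num,
      show 2 + 2 * 1 - q = 4 - q by ring, show 2 * (2 - q) = 4 - 2 * q by ring]
    push_cast
    ring
  rw [hexp, h' _ q2, h' _ q1, h' _ q4, h' _ q5, h' 2 (by norm_num), hG2, div_one, criticalMellin]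
  have g1 := g _ q1
  have g2 := g _ q2
  have g4 := g _ q4
  have g5 := g _ q5
  set l : ℂ := ((Real.log (2 * Real.pi) : ℝ) : ℂ)
  set c := logDoubleGamma 1 1 1
  have hE : Complex.exp (q * l) * Complex.exp (c + (2 - q - 1) / 2 * l) ^ 2
      * Complex.exp (c + (1 - q - 1) / 2 * l) * Complex.exp (c + (4 - q - 1) / 2 * l)
      = Complex.exp (c + (2 - 1) / 2 * l) ^ 2 * Complex.exp c * Complex.exp (c + (4 - 2 * q - 1) / 2 * l) := by
    simp only [← Complex.exp_nat_mul, ← Complex.exp_add]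
    congr 1
    push_cast
    ring
  have n1 := Complex.exp_ne_zero (c + (2 - 1) / 2 * l)
  have n2 := Complex.exp_ne_zero (c + (4 - 2 * q - 1) / 2 * l)
  have n3 := Complex.exp_ne_zero c
  generalize Complex.exp (c + (2 - q - 1) / 2 * l) = E₂ at hE ⊢
  generalize Complex.exp (c + (1 - q - 1) / 2 * l) = E₁ at hE ⊢
  generalize Complex.exp (c + (4 - q - 1) / 2 * l) = E₄ at hE ⊢
  generalize Complex.exp (c + (4 - 2 * q - 1) / 2 * l) = E₅ at hE n2 ⊢
  generalize Complex.exp (c + (2 - 1) / 2 * l) = E₀ at hE n1 ⊢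
  generalize Complex.exp c = E₃ at hE n3 ⊢
  generalize Complex.exp (q * l) = E₆ at hE ⊢
  generalize barnesG (4 - 2 * q) = g₅ at g5 ⊢
  field_simp
  linear_combination hE

/-! ### The limit τ ↓ 1 -/

theorem tendsto_logDoubleGamma {l : Filter ℝ} [l.IsCountablyGenerated] (hl : Tendsto id l (𝓝 1))
    {w : ℝ → ℂ} {w₀ : ℂ} (hw : Tendsto w l (𝓝 w₀)) (hw₀ : 0 < w₀.re) :
    Tendsto (fun τ => logDoubleGamma 1 τ (w τ)) l (𝓝 (logDoubleGamma 1 1 w₀)) := by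
  have hl' : Tendsto (fun τ : ℝ => (τ : ℂ)) l (𝓝 ((1 : ℝ) : ℂ)) :=
    (Complex.continuous_ofReal.tendsto 1).comp hl
  have hne : (((1 : ℝ) : ℂ)) ≠ 0 := by simp
  -- For τ near 1 the periods 1 and τ and the point w τ stay in the region described by δ and A,
  -- where the kernel bound is uniform and provides the majorant.
  set δ := min (w₀.re / 2) (1 / 2) with hδ
  have hδ0 : 0 < δ := lt_min (by linarith) (by norm_num)
  set A := max 2 (‖w₀ - 1‖ + 1) with hA
  obtain ⟨K, hK0, hK⟩ := exists_norm_zetaKernelReg_le (A := A) hδ0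
    ((min_le_right _ _).trans (by norm_num)) (le_trans (by norm_num) (le_max_left _ _))
  have e1 : ∀ᶠ τ in l, τ ∈ Set.Icc δ A := by
    have h1 : δ < 1 := (min_le_right _ _).trans_lt (by norm_num)
    have h2 : 1 < A := lt_of_lt_of_le (by norm_num) (le_max_left _ _)
    exact hl.eventually (Icc_mem_nhds h1 h2)
  have e2 : ∀ᶠ τ in l, ‖w τ - 1‖ ≤ A := by
    have := (hw.sub_const 1).norm.eventually_lt_const (lt_add_one ‖w₀ - 1‖)
    filter_upwards [this] with τ hτ using hτ.le.trans (le_max_right _ _)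
  have e3 : ∀ᶠ τ in l, δ ≤ (w τ).re := by
    have := ((Complex.continuous_re.tendsto _).comp hw).eventually_const_lt
      (show δ < w₀.re from (min_le_left _ _).trans_lt (by linarith))
    filter_upwards [this] with τ hτ using hτ.le
  have hker : Tendsto (fun τ => ∫ t in Set.Ioi (0 : ℝ), zetaKernelReg 1 τ (w τ) t / t) l
      (𝓝 (∫ t in Set.Ioi (0 : ℝ), zetaKernelReg 1 1 w₀ t / t)) := by
    refine tendsto_integral_filter_of_dominated_convergence (fun t => K * Real.exp (-δ * t)) ?_ ?_
      (integrableOn_mul_exp_neg hδ0 K) ?_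
    · filter_upwards [e1, e3] with τ h1 h3
      exact (integrableOn_zetaKernelReg_div one_pos (hδ0.trans_le h1.1)
        (hδ0.trans_le h3)).aestronglyMeasurable
    · filter_upwards [e1, e2, e3] with τ h1 h2 h3
      filter_upwards [ae_restrict_mem measurableSet_Ioi] with t ht
      have ht' : 0 < t := ht
      rw [norm_div, Complex.norm_real, Real.norm_of_nonneg ht'.le, div_le_iff₀ ht']
      have := hK 1 ⟨(min_le_right _ _).trans (by norm_num), le_trans (by norm_num) (le_max_left _ _)⟩
        τ h1 (w τ) h2 h3 t ht'
      linarith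
    · filter_upwards [ae_restrict_mem measurableSet_Ioi] with t ht
      refine Tendsto.div_const ?_ _
      have hd : (1 - Complex.exp (-((1 : ℝ) : ℂ) * t)) * (1 - Complex.exp (-((1 : ℝ) : ℂ) * t)) ≠ 0 :=
        mul_ne_zero (one_sub_cexp_neg_ne_zero one_pos ht) (one_sub_cexp_neg_ne_zero one_pos ht)
      have c1 : Tendsto (fun τ : ℝ => Complex.exp (-w τ * t)) l (𝓝 (Complex.exp (-w₀ * t))) :=
        (Complex.continuous_exp.tendsto _).comp (hw.neg.mul_const _)
      have c2 : Tendsto (fun τ : ℝ => Complex.exp (-(τ : ℂ) * t)) l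
          (𝓝 (Complex.exp (-((1 : ℝ) : ℂ) * t))) :=
        (Complex.continuous_exp.tendsto _).comp (hl'.neg.mul_const _)
      have c3 := hl'.inv₀ hne
      simp only [zetaKernelReg, zetaKernel, kernelPolar, kernelCoeffOne, kernelCoeffZero]
      exact (c1.div (tendsto_const_nhds.mul (c2.const_sub 1)) hd).sub
        (((((tendsto_const_nhds.mul c3).div_const _).add
        ((((c3.const_add _).div_const _).sub ((hw.sub_const 1).mul (c3.const_mul _))).div_const _)).add
        ((((((((hw.sub_const 1).pow 2).mul (c3.const_mul _)).div_const 2)).sub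
        (((hw.sub_const 1).mul (c3.const_add _)).div_const 2)).add tendsto_const_nhds).add
        (((c3.const_mul _).add (hl'.mul_const _)).div_const 12))).mul_const _)
  have c3 := hl'.inv₀ hne
  simp only [logDoubleGamma, kernelCoeffOne]
  exact (hker.add ((c3.const_mul _).const_mul _)).sub
    (((c3.const_add _).div_const _).sub ((hw.sub_const 1).mul (c3.const_mul _)))

theorem tendsto_selbergExponent {q : ℂ} (hq : q.re < 1) :
    Tendsto (fun τ => selbergExponent τ q) (𝓝[>] 1) (𝓝 (selbergExponent 1 q)) := by
  have hl : Tendsto id (𝓝[>] (1 : ℝ)) (𝓝 1) := tendsto_nhdsWithin_of_tendsto_nhds tendsto_id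
  have hc : Tendsto (fun τ : ℝ => (τ : ℂ)) (𝓝[>] 1) (𝓝 ((1 : ℝ) : ℂ)) :=
    (Complex.continuous_ofReal.tendsto 1).comp hl
  have hlog : Tendsto (fun τ : ℝ => ((Real.log τ : ℝ) : ℂ)) (𝓝[>] 1) (𝓝 ((Real.log 1 : ℝ) : ℂ)) :=
    (Complex.continuous_ofReal.tendsto _).comp
      ((Real.continuousAt_log one_ne_zero).tendsto.comp hl)
  have hne : (((1 : ℝ) : ℂ)) ≠ 0 := by simp
  have h1 := tendsto_logDoubleGamma hl ((hc.const_add 1).sub_const q) (by simp; linarith)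
  have h2 := tendsto_logDoubleGamma hl (hc.const_add 1) (by simp)
  have h3 := tendsto_logDoubleGamma hl (hc.sub_const q) (by simp; linarith)
  have h4 := tendsto_logDoubleGamma hl hc (by simp)
  have h5 := tendsto_logDoubleGamma hl (((hc.const_mul 2).const_add 2).sub_const q)
    (by simp; linarith)
  have h6 := tendsto_logDoubleGamma hl (((hc.const_add 1).sub_const q).const_mul 2)
    (by simp; linarith)
  exact (((((tendsto_const_nhds.div hc hne).mul hlog).add tendsto_const_nhds).add
    ((h1.sub h2).const_mul 2)).add (h3.sub h4)).add (h5.sub h6)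

/-- Scaling by 1 - 1/τ merges with Γ(1-1/τ) into Γ(2-1/τ)^{-q}, which tends to 1; the remaining
exponent is continuous at τ = 1. -/
theorem tendsto_lawDiv_selberg {M : ℝ → ProbabilityMeasure ℝ}
    (hM : ∀ τ : ℝ, 1 < τ → IsSelbergLaw τ 0 0 (M τ)) {Mc : ProbabilityMeasure ℝ}
    (hMc : HasMellinOn Mc {q : ℂ | q.re < 1} criticalMellin) :
    Tendsto (fun τ : ℝ => lawDiv (M τ) (1 - 1 / τ)) (𝓝[>] 1) (𝓝 Mc) := by
  have hc : ∀ τ : ℝ, 1 < τ → 0 < 1 - 1 / τ := fun τ hτ => by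
    rw [sub_pos, div_lt_one (by linarith)]; exact hτ
  have hlaw := fun τ hτ => (hM τ hτ).lawDiv (hc τ hτ)
  have hev : ∀ᶠ τ : ℝ in 𝓝[>] 1, 1 < τ := self_mem_nhdsWithin
  refine tendsto_of_tendsto_mellinOf (hev.mono fun τ hτ => (hlaw τ hτ).1) hMc.1 fun y => ?_
  set q : ℂ := (y : ℂ) * Complex.I
  have hq : q.re = 0 := by simp [q]
  rw [(hMc.2 q (by simp [hq])).2, ← exp_selbergExponent_one (by simp [hq])]
  have hl : Tendsto id (𝓝[>] (1 : ℝ)) (𝓝 1) := tendsto_nhdsWithin_of_tendsto_nhds tendsto_id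
  have ht1 := (Complex.continuous_exp.tendsto _).comp
    (tendsto_selbergExponent (q := q) (by simp [hq]))
  have hs : Tendsto (fun τ : ℝ => 2 - 1 / τ) (𝓝[>] 1) (𝓝 1) := by
    have := (tendsto_const_nhds (x := (1 : ℝ))).div hl one_ne_zero
    have := this.const_sub 2
    norm_num at this
    simpa using this
  have hG : Tendsto (fun τ : ℝ => Real.log (Real.Gamma (2 - 1 / τ))) (𝓝[>] 1) (𝓝 0) := by
    have h1 : ContinuousAt Real.Gamma 1 :=
      (Real.differentiableAt_Gamma fun m => by
        have : (0 : ℝ) ≤ m := Nat.cast_nonneg m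
        linarith).continuousAt
    have h2 := (h1.tendsto.comp hs).log (by simp)
    simpa using h2
  have ht2 : Tendsto (fun τ : ℝ => Complex.exp (-q * (Real.log (Real.Gamma (2 - 1 / τ)) : ℝ)))
      (𝓝[>] 1) (𝓝 1) := by
    have := (Complex.continuous_exp.tendsto _).comp
      (((Complex.continuous_ofReal.tendsto _).comp hG).const_mul (-q))
    simpa [Function.comp_def] using this
  have ht := ht1.mul ht2
  rw [mul_one] at ht
  refine ht.congr' ?_
  filter_upwards [hev] with τ hτ
  have hτq : q.re < τ := by rw [hq]; linarith
  have hc' := hc τ hτ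
  have hΓ := Real.Gamma_pos_of_pos hc'
  rw [(hlaw τ hτ).2 q hτq |>.2]
  beta_reduce
  rw [selbergMellin_eq hτ hτq, mul_assoc,
    ofReal_cpow_eq_exp_log hΓ, ofReal_cpow_eq_exp_log hc', ← Complex.exp_add, Function.comp,
    show 2 - 1 / τ = 1 - 1 / τ + 1 by ring, Real.Gamma_add_one hc'.ne',
    Real.log_mul hc'.ne' hΓ.ne']
  congr 2
  rw [Complex.ofReal_add]
  ring

/-! ### The Barnes beta law -/

/-- When Σσᵢwᵢ also vanishes, first differences already annihilate quadratics, so neither drift nor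
compensator is needed. Such an exponent is visibly nonpositive at negative real q when the density
is nonnegative. -/
theorem sum_mul_logDoubleGamma_sub_of_sum_mul_eq_zero {ι : Type*} [Fintype ι] {a b : ℝ} (ha : 0 < a)
    (hb : 0 < b) {σ w : ι → ℝ} (hσ : ∑ i, σ i = 0) (hσw : ∑ i, σ i * w i = 0) {q : ℂ}
    (hw : ∀ i, 0 < w i) (hq : ∀ i, q.re < w i) :
    ∑ i, (σ i : ℂ) * logDoubleGamma a b (w i - q) = ∑ i, (σ i : ℂ) * logDoubleGamma a b (w i)
      + ∫ t in Set.Ioi (0 : ℝ), (gammaLevyDensity a b σ w t : ℂ) * (Complex.exp (q * t) - 1) := by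
  have hσ' : ∑ i, (σ i : ℂ) = 0 := by exact_mod_cast hσ
  have hσw' : ∑ i, (σ i : ℂ) * w i = 0 := by exact_mod_cast hσw
  have h := sum_mul_logDoubleGamma_of_sq (ι := ι × Fin 2) ha hb
    (fun p => (σ p.1 : ℂ) * ![1, -1] p.2) (fun p => w p.1 - ![q, 0] p.2) ?_ ?_ ?_ ?_
  · have h2 := h.2
    have key : ∀ t : ℝ, (∑ p : ι × Fin 2, (σ p.1 : ℂ) * ![1, -1] p.2 *
        zetaKernel a b (w p.1 - ![q, 0] p.2) t) / t
        = (gammaLevyDensity a b σ w t : ℂ) * (Complex.exp (q * t) - 1) := by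
      intro t
      have h3 := zetaKernel_sum_shift a b σ w q t
      have h4 := zetaKernel_sum_shift a b σ w 0 t
      rw [zero_mul, Complex.exp_zero] at h4
      rw [Fintype.sum_prod_type]
      simp only [Fin.sum_univ_two, Matrix.cons_val_zero, Matrix.cons_val_one]
      have : (gammaLevyDensity a b σ w t : ℂ) * (Complex.exp (q * t) - 1)
        = Complex.exp (q * t) * (gammaLevyDensity a b σ w t : ℂ)
          - 1 * (gammaLevyDensity a b σ w t : ℂ) := by ring
      rw [this, ← h3, ← h4, Finset.sum_div, ← Finset.sum_sub_distrib]
      exact Finset.sum_congr rfl fun i _ => by ring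
    simp only [key] at h2
    rw [← h2, Fintype.sum_prod_type]
    simp only [Fin.sum_univ_two, Matrix.cons_val_zero, Matrix.cons_val_one]
    rw [← Finset.sum_add_distrib]
    refine Finset.sum_congr rfl fun i _ => ?_
    rw [sub_zero]
    ring
  · rintro ⟨i, j⟩
    have := hw i
    have := hq i
    fin_cases j <;> simp <;> linarith
  · rw [Fintype.sum_prod_type]
    simp only [Fin.sum_univ_two, Matrix.cons_val_zero, Matrix.cons_val_one]
    exact Finset.sum_eq_zero fun i _ => by ring
  · rw [Fintype.sum_prod_type]
    simp only [Fin.sum_univ_two, Matrix.cons_val_zero, Matrix.cons_val_one]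
    rw [show ∑ i, ((σ i : ℂ) * 1 * (w i - q) + σ i * -1 * (w i - (0 : ℂ))) = -q * ∑ i, (σ i : ℂ) by
        rw [Finset.mul_sum]; exact Finset.sum_congr rfl fun i _ => by ring, hσ', mul_zero]
  · rw [Fintype.sum_prod_type]
    simp only [Fin.sum_univ_two, Matrix.cons_val_zero, Matrix.cons_val_one]
    rw [show ∑ i, ((σ i : ℂ) * 1 * (w i - q) ^ 2 + σ i * -1 * (w i - (0 : ℂ)) ^ 2)
      = q ^ 2 * ∑ i, (σ i : ℂ) - 2 * q * ∑ i, (σ i : ℂ) * w i by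
        rw [Finset.mul_sum, Finset.mul_sum, ← Finset.sum_sub_distrib]
        exact Finset.sum_congr rfl fun i _ => by ring, hσ', hσw', mul_zero, mul_zero, sub_zero]

/-- Chernoff's bound gives P(X ≤ -ε) ≤ e^{-nε} for every n. -/
theorem measure_Iio_zero_of_mgf_le_one {ρ : Measure ℝ} [IsProbabilityMeasure ρ]
    (hi : ∀ n : ℕ, Integrable (fun x => Real.exp (-(n : ℝ) * x)) ρ)
    (h : ∀ n : ℕ, mgf id ρ (-(n : ℝ)) ≤ 1) : ρ (Set.Iio 0) = 0 := by
  have hε : ∀ ε : ℝ, 0 < ε → ρ {x | x ≤ -ε} = 0 := by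
    intro ε hε
    rw [← measureReal_eq_zero_iff]
    refine le_antisymm ?_ measureReal_nonneg
    have ht : Tendsto (fun n : ℕ => Real.exp (-ε) ^ n) atTop (𝓝 0) :=
      tendsto_pow_atTop_nhds_zero_of_lt_one (Real.exp_pos _).le
        (Real.exp_lt_one_iff.2 (by linarith))
    refine ge_of_tendsto ht (Eventually.of_forall fun n => ?_)
    have h1 := measure_le_le_exp_mul_mgf (μ := ρ) (X := id) (-ε) (t := -(n : ℝ))
      (by have : (0 : ℝ) ≤ n := Nat.cast_nonneg n
          linarith) (hi n)
    refine h1.trans ?_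
    calc Real.exp (-(-(n : ℝ)) * -ε) * mgf id ρ (-(n : ℝ)) ≤ Real.exp (-(-(n : ℝ)) * -ε) * 1 :=
        mul_le_mul_of_nonneg_left (h n) (Real.exp_pos _).le
      _ = Real.exp (-ε) ^ n := by rw [← Real.exp_nat_mul]; simp
  have hU : Set.Iio (0 : ℝ) = ⋃ n : ℕ, {x | x ≤ -(1 / ((n : ℝ) + 1))} := by
    ext x
    simp only [Set.mem_Iio, Set.mem_iUnion, Set.mem_ofPred_eq]
    constructor
    · intro hx
      obtain ⟨n, hn⟩ := exists_nat_one_div_lt (show (0 : ℝ) < -x by linarith)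
      exact ⟨n, by linarith⟩
    · rintro ⟨n, hn⟩
      have : (0 : ℝ) < 1 / ((n : ℝ) + 1) := by positivity
      linarith
  rw [hU, measure_iUnion_null_iff]
  exact fun n => hε _ (by positivity)

/-- The exponents in the Lévy density of `-log β₂₂(1, 1; 2, 1/2, 1/2)`. -/
def betaSigns : Fin 3 → ℝ := ![1, -2, 1]

/-- The points in the Lévy density of `-log β₂₂(1, 1; 2, 1/2, 1/2)`. -/
noncomputable def betaPoints : Fin 3 → ℝ := ![2, 5 / 2, 3]

theorem two_le_betaPoints (i : Fin 3) : 2 ≤ betaPoints i := by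
  fin_cases i <;> norm_num [betaPoints]

theorem sum_betaSigns : ∑ i, betaSigns i = 0 := by
  simp only [betaSigns, Fin.sum_univ_three, Matrix.cons_val_zero,
    Matrix.cons_val_one, Matrix.cons_val]
  norm_num

theorem sum_betaSigns_mul : ∑ i, betaSigns i * betaPoints i = 0 := by
  simp only [betaSigns, betaPoints, Fin.sum_univ_three, Matrix.cons_val_zero,
    Matrix.cons_val_one, Matrix.cons_val]
  norm_num

theorem gammaLevyDensity_beta_nonneg {t : ℝ} (ht : 0 < t) :
    0 ≤ gammaLevyDensity 1 1 betaSigns betaPoints t := by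
  set x := Real.exp (-(t / 2)) with hx
  have hpow : ∀ (m : ℕ) (w : ℝ), w = m / 2 → Real.exp (-w * t) = x ^ m := by
    intro m w hw
    rw [hx, ← Real.exp_nat_mul, hw]
    congr 1; ring
  have hN : ∑ i, betaSigns i * Real.exp (-betaPoints i * t) = (x ^ 2 * (1 - x)) ^ 2 := by
    simp only [betaSigns, betaPoints, Fin.sum_univ_three, Matrix.cons_val_zero,
      Matrix.cons_val_one, Matrix.cons_val]
    rw [hpow 4 2 (by norm_num), hpow 5 (5 / 2) (by norm_num), hpow 6 3 (by norm_num)]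
    ring
  rw [gammaLevyDensity, hN]
  have h1 : 0 ≤ 1 - Real.exp (-1 * t) := sub_nonneg.2 (Real.exp_le_one_iff.2 (by linarith))
  positivity

/-- The logarithm of the Mellin transform of `β₂₂(1, 1; 2, 1/2, 1/2)`. -/
noncomputable def betaExponent (q : ℂ) : ℂ :=
  (logDoubleGamma 1 1 (2 + q) - logDoubleGamma 1 1 2)
    - 2 * (logDoubleGamma 1 1 (5 / 2 + q) - logDoubleGamma 1 1 (5 / 2))
    + (logDoubleGamma 1 1 (3 + q) - logDoubleGamma 1 1 3)

theorem barnesEta_eq {q : ℂ} (hq : -2 < q.re) :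
    barnesEta 1 1 2 (1 / 2) (1 / 2) q = Complex.exp (betaExponent q) := by
  have hG : ∀ w : ℂ, 0 < w.re → doubleGamma 1 1 w = Complex.exp (logDoubleGamma 1 1 w) :=
    fun w hw => doubleGamma_eq one_pos one_pos hw
  rw [barnesEta]
  push_cast
  rw [show q + 2 + 1 / 2 + 1 / 2 = 3 + q by ring, show q + 2 + 1 / 2 = 5 / 2 + q by ring,
    show q + 2 = 2 + q by ring, show (2 : ℂ) + 1 / 2 + 1 / 2 = 3 by norm_num,
    show (2 : ℂ) + 1 / 2 = 5 / 2 by norm_num, hG (2 + q) (by simp; linarith), hG 2 (by simp),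
    hG (5 / 2) (by simp), hG (5 / 2 + q) (by simp; linarith), hG (3 + q) (by simp; linarith),
    hG 3 (by simp)]
  simp only [← Complex.exp_sub, ← Complex.exp_add]
  rw [betaExponent]
  congr 1
  ring

theorem betaExponent_neg (q : ℂ) : betaExponent (-q) =
    ∑ i, (betaSigns i : ℂ) * logDoubleGamma 1 1 (betaPoints i - q)
      - ∑ i, (betaSigns i : ℂ) * logDoubleGamma 1 1 (betaPoints i) := by
  simp only [betaSigns, betaPoints, Fin.sum_univ_three, Matrix.cons_val_zero,
      Matrix.cons_val_one, Matrix.cons_val, betaExponent]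
  push_cast
  simp only [← sub_eq_add_neg]
  ring

/-- The density is nonnegative because its numerator is a square, so a law with this transform
exists. The uncompensated formula gives E e^{-nX} ≤ 1, hence X ≥ 0; this places e^{-X} in (0, 1]. -/
theorem exists_neg_log_beta : ∃ ρ : Measure ℝ,
    HasLaplaceTransform ρ 2 (fun q => Complex.exp (betaExponent (-q))) ∧ ρ (Set.Iio 0) = 0 := by
  have h0 : ∀ i, 0 < betaPoints i := fun i => two_pos.trans_le (two_le_betaPoints i)
  obtain ⟨d, hd⟩ := exists_sum_mul_logDoubleGamma_sub_eq one_pos one_pos sum_betaSigns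
    (fun _ => gammaLevyDensity_beta_nonneg) h0
  obtain ⟨ρ, hρ, -⟩ := exists_hasLaplaceTransform_levyExponent two_pos
    (gammaLevyMeasure_Iic_zero 1 1 betaSigns betaPoints)
    (fun θ hθ => integrable_gammaLevyMeasure one_pos one_pos sum_betaSigns
      (fun _ => gammaLevyDensity_beta_nonneg) fun i => hθ.trans_le (two_le_betaPoints i)) d
    (v := 0) le_rfl
  have hL : HasLaplaceTransform ρ 2 (fun q => Complex.exp (betaExponent (-q))) := by
    refine ⟨hρ.prob, hρ.integrable, fun q hq => ?_⟩
    rw [hρ.integral_eq q hq, betaExponent_neg,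
      hd q fun i => hq.trans_le (two_le_betaPoints i), levyExponent]
    congr 1
    push_cast
    ring
  have := hL.prob
  have hre : ∀ n : ℕ, ((-(n : ℝ) : ℝ) : ℂ).re < 2 := fun n => by
    rw [Complex.ofReal_re]
    have : (0 : ℝ) ≤ n := Nat.cast_nonneg n
    linarith
  refine ⟨ρ, hL, measure_Iio_zero_of_mgf_le_one (fun n => ?_) fun n => ?_⟩
  · have := (hL.integrable _ (hre n)).norm
    refine this.congr (Eventually.of_forall fun x => ?_)
    simp only [Complex.norm_exp, Complex.re_mul_ofReal, Complex.ofReal_re]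
  · have h1 : ((mgf id ρ (-(n : ℝ)) : ℝ) : ℂ) = Complex.exp (betaExponent (-((-(n : ℝ) : ℝ) : ℂ))) := by
      rw [← hL.integral_eq _ (hre n), ← complexMGF_ofReal]
      rfl
    rw [betaExponent_neg, sum_mul_logDoubleGamma_sub_of_sum_mul_eq_zero one_pos one_pos
      sum_betaSigns sum_betaSigns_mul h0 fun i => (hre n).trans_le (two_le_betaPoints i),
      add_sub_cancel_left] at h1
    have h2 : ∀ t : ℝ, (gammaLevyDensity 1 1 betaSigns betaPoints t : ℂ) *
        (Complex.exp (((-(n : ℝ) : ℝ) : ℂ) * t) - 1) = ((gammaLevyDensity 1 1 betaSigns betaPoints t *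
        (Real.exp (-(n : ℝ) * t) - 1) : ℝ) : ℂ) := fun t => by push_cast; ring
    simp only [h2] at h1
    rw [integral_complex_ofReal, ← Complex.ofReal_exp, Complex.ofReal_inj] at h1
    rw [h1, Real.exp_le_one_iff]
    refine setIntegral_nonpos measurableSet_Ioi fun t ht => ?_
    have ht' : (0 : ℝ) < t := ht
    refine mul_nonpos_of_nonneg_of_nonpos (gammaLevyDensity_beta_nonneg ht')
      (sub_nonpos.2 (Real.exp_le_one_iff.2 ?_))
    have : (0 : ℝ) ≤ n := Nat.cast_nonneg n
    nlinarith

theorem exists_isBarnesBeta : ∃ B : ProbabilityMeasure ℝ, IsBarnesBeta 1 1 2 (1 / 2) (1 / 2) B := by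
  obtain ⟨ρ, hρ, h0⟩ := exists_neg_log_beta
  have := hρ.prob
  have hm : Measurable fun x : ℝ => Real.exp (-x) := by fun_prop
  have e : ∀ (q : ℂ) (x : ℝ), ((Real.exp (-x) : ℝ) : ℂ) ^ q = Complex.exp (-q * x) := fun q x => by
    rw [ofReal_exp_cpow]; push_cast; ring_nf
  refine ⟨⟨ρ.map fun x => Real.exp (-x), Measure.isProbabilityMeasure_map hm.aemeasurable⟩,
    ?_, ?_, fun q hq => ?_⟩
  · change (ρ.map fun x => Real.exp (-x)) _ = 0
    rw [Measure.map_apply hm measurableSet_Ioc.compl]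
    convert h0 using 2
    ext x
    simp [Real.exp_pos]
  · change (ρ.map fun x => Real.exp (-x)) _ = 0
    rw [Measure.map_apply hm measurableSet_Iic]
    convert measure_empty (μ := ρ)
    ext x
    simp [Real.exp_pos]
  · have hq' : -2 < q.re := by simpa using hq
    have hq'' : (-q).re < 2 := by simp; linarith
    constructor
    · change Integrable _ (ρ.map fun x => Real.exp (-x))
      rw [integrable_map_measure (measurable_ofReal_cpow q).aestronglyMeasurable hm.aemeasurable,
        Function.comp_def]
      simp only [e]
      exact hρ.integrable _ hq''
    · change ∫ x : ℝ, (x : ℂ) ^ q ∂(ρ.map fun x => Real.exp (-x)) = _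
      rw [integral_map hm.aemeasurable (measurable_ofReal_cpow q).aestronglyMeasurable]
      simp only [e]
      rw [hρ.integral_eq _ hq'', neg_neg, barnesEta_eq hq']

/-! ### Lognormal, Pareto and Fréchet factors -/

theorem integral_cpow_lognormalLaw (v : ℝ) (hv : 0 ≤ v) (q : ℂ) :
    ∫ x : ℝ, (x : ℂ) ^ q ∂(lognormalLaw v) = Complex.exp (v * q ^ 2 / 2) := by
  rw [lognormalLaw, integral_map (by fun_prop) (measurable_ofReal_cpow q).aestronglyMeasurable]
  simp_rw [ofReal_exp_cpow]
  have := complexMGF_id_gaussianReal (μ := 0) (v := v.toNNReal) q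
  rw [complexMGF] at this
  simp only [id] at this
  rw [this]
  have : ((v.toNNReal : NNReal) : ℂ) = v := by
    rw [show ((v.toNNReal : NNReal) : ℂ) = ((v.toNNReal : ℝ) : ℂ) from rfl, Real.coe_toNNReal v hv]
  rw [this]
  simp

theorem isProbabilityMeasure_lognormalLaw (v : ℝ) : IsProbabilityMeasure (lognormalLaw v) :=
  Measure.isProbabilityMeasure_map (by fun_prop)

theorem ae_pos_lognormalLaw (v : ℝ) : ∀ᵐ x ∂(lognormalLaw v), 0 < x := by
  rw [lognormalLaw, ae_map_iff (by fun_prop) measurableSet_Ioi]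
  exact Eventually.of_forall fun x => Real.exp_pos x

theorem integral_cpow_paretoMeasure {r : ℝ} (hr : 0 < r) {q : ℂ} (hq : q.re < r) :
    ∫ x : ℝ, (x : ℂ) ^ q ∂(paretoMeasure 1 r) = r / (r - q) := by
  have hm : Measurable (paretoPDF 1 r) := (measurable_paretoPDFReal 1 r).ennreal_ofReal
  have e : ∀ x : ℝ, (paretoPDF 1 r x).toReal • (x : ℂ) ^ q
      = (Set.Ici (1 : ℝ)).indicator (fun x : ℝ => (r : ℂ) * (x : ℂ) ^ (q - (r + 1))) x := by
    intro x
    rw [paretoPDF, ENNReal.toReal_ofReal (paretoPDFReal_nonneg zero_le_one hr.le x), paretoPDFReal]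
    by_cases hx : 1 ≤ x
    · have hx0 : 0 < x := by linarith
      rw [if_pos hx, Set.indicator_of_mem (Set.mem_Ici.2 hx), Real.one_rpow, mul_one, Complex.real_smul,
        Complex.ofReal_mul, Complex.ofReal_cpow hx0.le, mul_assoc, ← Complex.cpow_add _ _
        (by exact_mod_cast hx0.ne')]
      congr 2
      push_cast; ring
    · rw [if_neg hx, Set.indicator_of_notMem (mt Set.mem_Ici.1 hx)]; simp
  rw [paretoMeasure, integral_withDensity_eq_integral_toReal_smul hm (by simp [paretoPDF])]
  simp only [e]
  rw [integral_indicator measurableSet_Ici, integral_Ici_eq_integral_Ioi, integral_const_mul,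
    integral_Ioi_cpow_of_lt (by simp; linarith) one_pos, Complex.ofReal_one, Complex.one_cpow]
  have h1 : (r : ℂ) - q ≠ 0 := fun h => by
    have := congrArg Complex.re h
    simp at this
    linarith
  have h2 : q - (r + 1) + 1 = -((r : ℂ) - q) := by ring
  rw [h2, neg_div_neg_eq, mul_one_div]

theorem ae_pos_paretoMeasure (r : ℝ) : ∀ᵐ x ∂(paretoMeasure 1 r), 0 < x := by
  have hm : Measurable (paretoPDF 1 r) := (measurable_paretoPDFReal 1 r).ennreal_ofReal
  rw [paretoMeasure, ae_withDensity_iff hm]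
  refine Eventually.of_forall fun x hx => ?_
  by_contra h
  exact hx (paretoPDF_of_lt (by linarith))

theorem rpow_neg_one_sub_one {x : ℝ} (hx : 0 < x) : |(-1 : ℝ)| * x ^ ((-1 : ℝ) - 1) = 1 / x ^ 2 := by
  rw [show ((-1 : ℝ) - 1) = -(2 : ℕ) by norm_num, Real.rpow_neg hx.le, Real.rpow_natCast]
  simp

theorem isProbabilityMeasure_frechetLaw : IsProbabilityMeasure frechetLaw := by
  have hi : IntegrableOn (fun y : ℝ => 1 / y ^ 2 * Real.exp (-1 / y)) (Set.Ioi 0) ∧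
      ∫ y in Set.Ioi (0 : ℝ), 1 / y ^ 2 * Real.exp (-1 / y) = 1 := by
    have e : Set.EqOn (fun x : ℝ => (|(-1 : ℝ)| * x ^ ((-1 : ℝ) - 1)) • Real.exp (-(x ^ (-1 : ℝ))))
        (fun y : ℝ => 1 / y ^ 2 * Real.exp (-1 / y)) (Set.Ioi 0) := fun x hx => by
      have hx' : (0 : ℝ) < x := hx
      simp only [rpow_neg_one_sub_one hx', Real.rpow_neg_one, smul_eq_mul]
      ring_nf
    constructor
    · rw [← integrableOn_congr_fun e measurableSet_Ioi]
      exact (integrableOn_Ioi_comp_rpow_iff (fun x => Real.exp (-x)) (by norm_num)).2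
        (integrableOn_exp_neg_Ioi 0)
    · rw [← setIntegral_congr_fun measurableSet_Ioi e,
        integral_comp_rpow_Ioi (fun x => Real.exp (-x)) (by norm_num), integral_exp_neg_Ioi_zero]
  refine ⟨?_⟩
  rw [frechetLaw, withDensity_apply _ MeasurableSet.univ, Measure.restrict_univ,
    ← ofReal_integral_eq_lintegral_ofReal hi.1 (Eventually.of_forall fun y => by positivity), hi.2,
    ENNReal.ofReal_one]

/-- The substitution x ↦ 1/x turns the integral into Euler's integral: a Fréchet variable is the
inverse of an exponential one. -/
theorem integral_cpow_frechetLaw {q : ℂ} (hq : q.re < 1) :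
    ∫ x : ℝ, (x : ℂ) ^ q ∂frechetLaw = Complex.Gamma (1 - q) := by
  rw [frechetLaw, integral_withDensity_eq_integral_toReal_smul (by fun_prop) (by simp),
    Complex.Gamma_eq_integral (by simp; linarith), Complex.GammaIntegral,
    ← integral_comp_rpow_Ioi (fun x : ℝ => ((Real.exp (-x) : ℝ) : ℂ) * (x : ℂ) ^ (1 - q - 1))
      (p := -1) (by norm_num)]
  refine setIntegral_congr_fun measurableSet_Ioi fun x hx => ?_
  have hx' : (0 : ℝ) < x := hx
  rw [rpow_neg_one_sub_one hx', Real.rpow_neg_one, ENNReal.toReal_ofReal (by positivity), mul_smul,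
    ofReal_cpow_eq_exp_log hx', ofReal_cpow_eq_exp_log (inv_pos.2 hx'), Real.log_inv,
    Complex.real_smul (x := Real.exp (-1 / x)), Complex.ofReal_neg]
  congr 2
  · rw [neg_div, one_div]
  · ring_nf

theorem ae_pos_frechetLaw : ∀ᵐ x ∂frechetLaw, 0 < x :=
  (withDensity_absolutelyContinuous _ _).ae_le (ae_restrict_mem measurableSet_Ioi)

/-! ### Factorization of the limit law -/

/-- Duplication at 2 - q brings in the beta points 2, 5/2, 3. What is left, log Γ₂ at 1-q and at 4-q
minus twice the value at 3-q, telescopes into three first differences. The quadratic polynomial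
multiplying log 2 is 2q² - 6q plus a constant, whence the lognormal factor and 2π/2⁶ = π/32. -/
theorem selbergExponent_one_sub_betaExponent : ∃ c : ℂ, ∀ q : ℂ, q.re < 1 →
    selbergExponent 1 q = c + betaExponent (-q) + q * Real.log (Real.pi / 32)
      + 2 * Real.log 2 * q ^ 2 + logGammaDiff (1 - q) + logGammaDiff (2 - q) - logGammaDiff (3 - q) := by
  refine ⟨-2 * logDoubleGamma 1 1 2 - logDoubleGamma 1 1 1 + logDoubleGamma 1 1 2
    - 2 * logDoubleGamma 1 1 (5 / 2) + logDoubleGamma 1 1 3 + Real.log 2 * (4 + 5 / 12), fun q hq => ?_⟩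
  have h := logDoubleGamma_two_mul one_pos one_pos (w := 2 - q) (by simp; linarith)
  have hz : kernelCoeffZero (1 / 2) (1 / 2) (2 - q) = 2 * (2 - q) ^ 2 - 2 * (2 - q) + 5 / 12 := by
    simp only [kernelCoeffZero]; push_cast; ring
  have hlog : Real.log (Real.pi / 32) = Real.log (2 * Real.pi) - 6 * Real.log 2 := by
    have : Real.pi / 32 = 2 * Real.pi / 2 ^ 6 := by ring
    rw [this, Real.log_div (by positivity) (by positivity), Real.log_pow]
    norm_num
  rw [hz] at h
  simp only [selbergExponent, betaExponent, logGammaDiff, Real.log_one, hlog]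
  push_cast at h ⊢
  rw [show (2 : ℂ) - q + 1 / 2 = 5 / 2 - q by ring, show (2 : ℂ) - q + (1 + 1) / 2 = 3 - q by ring] at h
  rw [show (1 : ℂ) + 1 - q = 2 - q by ring, show (1 : ℂ) + 1 = 2 by norm_num,
    show (2 : ℂ) + 2 * 1 - q = 4 - q by ring, show (1 : ℂ) - q + 1 = 2 - q by ring,
    show (2 : ℂ) - q + 1 = 3 - q by ring, show (3 : ℂ) - q + 1 = 4 - q by ring,
    show (2 : ℂ) + -q = 2 - q by ring, show (5 / 2 : ℂ) + -q = 5 / 2 - q by ring,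
    show (3 : ℂ) + -q = 3 - q by ring]
  linear_combination -h

/-- The three first differences give Γ(1-q)Γ(2-q)/Γ(3-q) = Γ(1-q)/(2-q), the Fréchet and Pareto
transforms. The multiplicative constant is read off at q = 0, so no value of Γ₂ has to be computed.
-/
theorem criticalMellin_factorization {q : ℂ} (hq : q.re < 1) : criticalMellin q =
    Complex.exp (q * Real.log (Real.pi / 32)) * Complex.exp (2 * Real.log 2 * q ^ 2) *
      Complex.exp (betaExponent (-q)) * (2 / (2 - q)) * Complex.Gamma (1 - q) := by
  obtain ⟨c, hc⟩ := selbergExponent_one_sub_betaExponent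
  have key : ∀ q : ℂ, q.re < 1 → criticalMellin q = Complex.exp c * ((Real.sqrt (2 * Real.pi))⁻¹ : ℝ)
      * (Complex.exp (q * Real.log (Real.pi / 32)) * Complex.exp (2 * Real.log 2 * q ^ 2) *
      Complex.exp (betaExponent (-q)) * (1 / (2 - q)) * Complex.Gamma (1 - q)) := by
    intro q hq
    have h1 : 0 < (1 - q).re := by simp; linarith
    have h2 : 0 < (2 - q).re := by simp; linarith
    have h3 : 0 < (3 - q).re := by simp; linarith
    have n2 : 2 - q ≠ 0 := fun h => by rw [h] at h2; simp at h2
    have g2 := Complex.Gamma_ne_zero_of_re_pos h2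
    have hs : (((Real.sqrt (2 * Real.pi))⁻¹ : ℝ) : ℂ) ≠ 0 := by
      have : 0 < Real.sqrt (2 * Real.pi) := Real.sqrt_pos.2 (by positivity)
      exact_mod_cast (inv_pos.2 this).ne'
    rw [← exp_selbergExponent_one hq, hc q hq]
    simp only [Complex.exp_add, Complex.exp_sub]
    rw [exp_logGammaDiff h1, exp_logGammaDiff h2, exp_logGammaDiff h3,
      show 3 - q = 2 - q + 1 by ring, Complex.Gamma_add_one _ n2]
    field_simp
  have h0 : criticalMellin 0 = 1 := by simpa using criticalMellin_neg_nat 0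
  have k0 := key 0 (by simp)
  rw [h0] at k0
  simp only [zero_mul, Complex.exp_zero, betaExponent, neg_zero, add_zero, sub_self, mul_zero,
    sub_zero, Complex.Gamma_one, ne_eq, OfNat.ofNat_ne_zero, not_false_eq_true, zero_pow, one_mul,
    mul_one] at k0
  have hc2 : Complex.exp c * ((Real.sqrt (2 * Real.pi))⁻¹ : ℝ) = 2 := by
    linear_combination -2 * k0
  rw [key q hq, hc2]
  ring

theorem ae_pos_barnesBeta {b₀ b₁ b₂ : ℝ} {B : ProbabilityMeasure ℝ} (hB : IsBarnesBeta 1 1 b₀ b₁ b₂ B) :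
    ∀ᵐ x ∂((B : Measure ℝ).map fun x : ℝ => x⁻¹), 0 < x := by
  rw [ae_map_iff (by fun_prop) measurableSet_Ioi]
  filter_upwards [ae_pos_of_probabilityMeasure hB.2.1] with x hx using inv_pos.2 hx

theorem integral_cpow_map_inv {B : ProbabilityMeasure ℝ} (hB : (B : Measure ℝ) (Set.Iic 0) = 0) (q : ℂ) :
    ∫ x : ℝ, (x : ℂ) ^ q ∂((B : Measure ℝ).map fun x : ℝ => x⁻¹) = mellinOf B (-q) := by
  rw [integral_map (by fun_prop) (measurable_ofReal_cpow q).aestronglyMeasurable, mellinOf]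
  refine integral_congr_ae ?_
  filter_upwards [ae_pos_of_probabilityMeasure hB] with x hx
  rw [ofReal_cpow_eq_exp_log hx, ofReal_cpow_eq_exp_log (inv_pos.2 hx), Real.log_inv]
  push_cast
  ring_nf

theorem ae_pos_and_integral_cpow_prod_map {μ₁ μ₂ μ₃ μ₄ : Measure ℝ} [IsProbabilityMeasure μ₁]
    [IsProbabilityMeasure μ₂] [IsProbabilityMeasure μ₃] [IsProbabilityMeasure μ₄]
    (h₁ : ∀ᵐ x ∂μ₁, 0 < x) (h₂ : ∀ᵐ x ∂μ₂, 0 < x) (h₃ : ∀ᵐ x ∂μ₃, 0 < x) (h₄ : ∀ᵐ x ∂μ₄, 0 < x)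
    {c : ℝ} (hc : 0 < c) :
    (∀ᵐ x ∂((μ₁.prod (μ₂.prod (μ₃.prod μ₄))).map
      fun p : ℝ × ℝ × ℝ × ℝ => c * p.1 * p.2.1 * p.2.2.1 * p.2.2.2), 0 < x) ∧
    ∀ q : ℂ, ∫ x : ℝ, (x : ℂ) ^ q ∂((μ₁.prod (μ₂.prod (μ₃.prod μ₄))).map
      fun p : ℝ × ℝ × ℝ × ℝ => c * p.1 * p.2.1 * p.2.2.1 * p.2.2.2)
      = (c : ℂ) ^ q * ((∫ x : ℝ, (x : ℂ) ^ q ∂μ₁) * ((∫ x : ℝ, (x : ℂ) ^ q ∂μ₂) *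
        ((∫ x : ℝ, (x : ℂ) ^ q ∂μ₃) * ∫ x : ℝ, (x : ℂ) ^ q ∂μ₄))) := by
  have hm : Measurable fun p : ℝ × ℝ × ℝ × ℝ => c * p.1 * p.2.1 * p.2.2.1 * p.2.2.2 := by fun_prop
  have k34 : ∀ᵐ p ∂(μ₃.prod μ₄), 0 < p.1 ∧ 0 < p.2 :=
    (Measure.quasiMeasurePreserving_fst.ae h₃).and (Measure.quasiMeasurePreserving_snd.ae h₄)
  have k234 : ∀ᵐ p ∂(μ₂.prod (μ₃.prod μ₄)), 0 < p.1 ∧ 0 < p.2.1 ∧ 0 < p.2.2 :=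
    (Measure.quasiMeasurePreserving_fst.ae h₂).and (Measure.quasiMeasurePreserving_snd.ae k34)
  have k : ∀ᵐ p ∂(μ₁.prod (μ₂.prod (μ₃.prod μ₄))), 0 < p.1 ∧ 0 < p.2.1 ∧ 0 < p.2.2.1 ∧ 0 < p.2.2.2 :=
    (Measure.quasiMeasurePreserving_fst.ae h₁).and (Measure.quasiMeasurePreserving_snd.ae k234)
  refine ⟨?_, fun q => ?_⟩
  · rw [ae_map_iff hm.aemeasurable measurableSet_Ioi]
    filter_upwards [k] with p ⟨p1, p2, p3, p4⟩
    positivity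
  · rw [integral_map hm.aemeasurable (measurable_ofReal_cpow q).aestronglyMeasurable]
    rw [← integral_prod_mul (fun x : ℝ => (x : ℂ) ^ q) (fun x : ℝ => (x : ℂ) ^ q),
      ← integral_prod_mul (fun x : ℝ => (x : ℂ) ^ q)
        (fun p : ℝ × ℝ => (p.1 : ℂ) ^ q * (p.2 : ℂ) ^ q),
      ← integral_prod_mul (fun x : ℝ => (x : ℂ) ^ q)
        (fun p : ℝ × ℝ × ℝ => (p.1 : ℂ) ^ q * ((p.2.1 : ℂ) ^ q * (p.2.2 : ℂ) ^ q)),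
      ← integral_const_mul]
    refine integral_congr_ae ?_
    filter_upwards [k] with p ⟨p1, p2, p3, p4⟩
    rw [Complex.ofReal_mul, Complex.mul_cpow_ofReal_nonneg (by positivity) p4.le,
      Complex.ofReal_mul, Complex.mul_cpow_ofReal_nonneg (by positivity) p3.le,
      Complex.ofReal_mul, Complex.mul_cpow_ofReal_nonneg (by positivity) p2.le,
      Complex.ofReal_mul, Complex.mul_cpow_ofReal_nonneg hc.le p1.le]
    ring

theorem eq_map_prod_of_hasMellinOn {Mc B : ProbabilityMeasure ℝ}
    (hMc : HasMellinOn Mc {q : ℂ | q.re < 1} criticalMellin)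
    (hB : IsBarnesBeta 1 1 2 (1 / 2) (1 / 2) B) :
    (Mc : Measure ℝ) =
      ((lognormalLaw (4 * Real.log 2)).prod
        (((B : Measure ℝ).map (fun x : ℝ => x⁻¹)).prod ((paretoMeasure 1 2).prod frechetLaw))).map
          (fun p : ℝ × ℝ × ℝ × ℝ => Real.pi / 32 * p.1 * p.2.1 * p.2.2.1 * p.2.2.2) := by
  have := isProbabilityMeasure_lognormalLaw (4 * Real.log 2)
  have := isProbabilityMeasure_paretoMeasure one_pos two_pos
  have := isProbabilityMeasure_frechetLaw
  have : IsProbabilityMeasure ((B : Measure ℝ).map (fun x : ℝ => x⁻¹)) :=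
    Measure.isProbabilityMeasure_map (by fun_prop)
  obtain ⟨hp, hmel⟩ := ae_pos_and_integral_cpow_prod_map (ae_pos_lognormalLaw (4 * Real.log 2))
    (ae_pos_barnesBeta hB) (ae_pos_paretoMeasure 2) ae_pos_frechetLaw
    (c := Real.pi / 32) (by positivity)
  set P := ((lognormalLaw (4 * Real.log 2)).prod
        (((B : Measure ℝ).map (fun x : ℝ => x⁻¹)).prod ((paretoMeasure 1 2).prod frechetLaw))).map
          (fun p : ℝ × ℝ × ℝ × ℝ => Real.pi / 32 * p.1 * p.2.1 * p.2.2.1 * p.2.2.2)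
  have hP : IsProbabilityMeasure P := Measure.isProbabilityMeasure_map
    (show Measurable fun p : ℝ × ℝ × ℝ × ℝ => Real.pi / 32 * p.1 * p.2.1 * p.2.2.1 * p.2.2.2 by
      fun_prop).aemeasurable
  refine congrArg (fun μ : ProbabilityMeasure ℝ => (μ : Measure ℝ))
    (eq_of_mellinOf_eq (μ₂ := ⟨P, hP⟩) hMc.1 ?_ fun y => ?_)
  · change P (Set.Iic 0) = 0
    rw [ae_iff] at hp
    convert hp using 2
    ext x
    simp
  · set q : ℂ := (y : ℂ) * Complex.I
    have hq : q.re = 0 := by simp [q]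
    have hl : 0 < Real.log 2 := Real.log_pos one_lt_two
    rw [(hMc.2 q (by simp [hq])).2]
    change _ = ∫ x : ℝ, (x : ℂ) ^ q ∂P
    rw [hmel q, integral_cpow_lognormalLaw _ (by positivity), integral_cpow_map_inv hB.2.1,
      (hB.2.2 (-q) (by simp [hq])).2, integral_cpow_paretoMeasure two_pos (by simp [hq]),
      integral_cpow_frechetLaw (by simp [hq]), barnesEta_eq (by simp [hq]),
      ofReal_cpow_eq_exp_log (by positivity), criticalMellin_factorization (by simp [hq])]
    rw [show ((4 * Real.log 2 : ℝ) : ℂ) * q ^ 2 / 2 = 2 * Real.log 2 * q ^ 2 by push_cast; ring]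
    push_cast
    ring

/-! ### Assembly -/

theorem mainTheorem10 :
    -- the laws `M_{(τ,0,0)}`, `τ > 1`, exist and are determined by their Mellin transforms
    (∀ τ : ℝ, 1 < τ → ∃! μ : ProbabilityMeasure ℝ, IsSelbergLaw τ 0 0 μ) ∧
    ∀ M : ℝ → ProbabilityMeasure ℝ, (∀ τ : ℝ, 1 < τ → IsSelbergLaw τ 0 0 (M τ)) →
    ∃ Mc : ProbabilityMeasure ℝ,
      -- `Mc` is the weak limit of `M_{(τ,0,0)} / (1 - 1/τ)` as `τ ↓ 1`
      Tendsto (fun τ : ℝ => lawDiv (M τ) (1 - 1 / τ)) (𝓝[>] 1) (𝓝 Mc) ∧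
      -- its Mellin transform, and the meromorphic continuation thereof
      HasMellinOn Mc {q : ℂ | q.re < 1} criticalMellin ∧
      Meromorphic criticalMellin ∧
      -- zeros and poles with multiplicities
      (∀ n : ℕ, meromorphicOrderAt criticalMellin ((n : ℂ) + 5 / 2) =
        ((2 * (n : ℤ) + 2 : ℤ) : WithTop ℤ)) ∧
      meromorphicOrderAt criticalMellin 1 = ((-1 : ℤ) : WithTop ℤ) ∧
      meromorphicOrderAt criticalMellin 2 = ((-3 : ℤ) : WithTop ℤ) ∧
      (∀ n : ℕ, 3 ≤ n → meromorphicOrderAt criticalMellin (n : ℂ) =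
        ((-(2 * (n : ℤ) - 2) : ℤ) : WithTop ℤ)) ∧
      (∀ q : ℂ, (∀ n : ℕ, q ≠ (n : ℂ) + 5 / 2) → (∀ n : ℕ, 1 ≤ n → q ≠ (n : ℂ)) →
        meromorphicOrderAt criticalMellin q = 0) ∧
      -- functional equation, for the Mellin transform and for its continuation
      (∀ q : ℂ, q.re < 1 → mellinOf Mc q =
        Complex.Gamma (1 - q) * Complex.Gamma (2 - q) ^ 2 * Complex.Gamma (4 - q) /
          (Complex.Gamma (4 - 2 * q) * Complex.Gamma (5 - 2 * q)) * mellinOf Mc (q - 1)) ∧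
      (∀ q : ℂ, (∀ n : ℕ, 2 * q ≠ (n : ℂ) + 2) → criticalMellin q =
        Complex.Gamma (1 - q) * Complex.Gamma (2 - q) ^ 2 * Complex.Gamma (4 - q) /
          (Complex.Gamma (4 - 2 * q) * Complex.Gamma (5 - 2 * q)) * criticalMellin (q - 1)) ∧
      -- infinite product, for the Mellin transform and for its continuation
      (∀ q : ℂ, (∀ n : ℕ, 2 * q ≠ (n : ℂ) + 2) →
        Multipliable (fun m : ℕ => ((m : ℂ) + 1) ^ (2 * q) *
          (Complex.Gamma (1 - q + (m + 1)) ^ 3 / Complex.Gamma (1 + (m + 1)) ^ 3) *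
          (Complex.Gamma (2 - q + (m + 1)) / Complex.Gamma (2 - 2 * q + (m + 1)))) ∧
        criticalMellin q =
          Complex.Gamma (1 - q) * Complex.Gamma (3 - 2 * q) / Complex.Gamma (3 - q) *
          ∏' m : ℕ, (((m : ℂ) + 1) ^ (2 * q) *
            (Complex.Gamma (1 - q + (m + 1)) ^ 3 / Complex.Gamma (1 + (m + 1)) ^ 3) *
            (Complex.Gamma (2 - q + (m + 1)) / Complex.Gamma (2 - 2 * q + (m + 1))))) ∧
      (∀ q : ℂ, q.re < 1 → mellinOf Mc q =
          Complex.Gamma (1 - q) * Complex.Gamma (3 - 2 * q) / Complex.Gamma (3 - q) *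
          ∏' m : ℕ, (((m : ℂ) + 1) ^ (2 * q) *
            (Complex.Gamma (1 - q + (m + 1)) ^ 3 / Complex.Gamma (1 + (m + 1)) ^ 3) *
            (Complex.Gamma (2 - q + (m + 1)) / Complex.Gamma (2 - 2 * q + (m + 1))))) ∧
      -- negative moments
      (∀ l : ℕ, Integrable (fun x : ℝ => x ^ (-(l : ℤ))) (Mc : Measure ℝ) ∧
        ∫ x : ℝ, x ^ (-(l : ℤ)) ∂(Mc : Measure ℝ) =
          ∏ k ∈ Finset.range l, ((Nat.factorial (3 + l + k) : ℝ) /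
            ((Nat.factorial (k + 1) : ℝ) ^ 2 * (Nat.factorial k : ℝ)))) ∧
      -- factorization `Mc = (π/32) L X₂ X₃ Y` with independent factors, `X₂ = β_{2,2}⁻¹`
      -- (the Pareto law `paretoMeasure 1 2` has density `2 y⁻³`, `y > 1`)
      IsProbabilityMeasure (lognormalLaw (4 * Real.log 2)) ∧
      IsProbabilityMeasure (paretoMeasure 1 2) ∧ IsProbabilityMeasure frechetLaw ∧
      (∃ B : ProbabilityMeasure ℝ, IsBarnesBeta 1 1 2 (1 / 2) (1 / 2) B ∧
        (Mc : Measure ℝ) =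
          ((lognormalLaw (4 * Real.log 2)).prod
            (((B : Measure ℝ).map (fun x : ℝ => x⁻¹)).prod ((paretoMeasure 1 2).prod frechetLaw))).map
              (fun p : ℝ × ℝ × ℝ × ℝ =>
                Real.pi / 32 * p.1 * p.2.1 * p.2.2.1 * p.2.2.2)) ∧
      -- the law of `log Mc`
      IsInfinitelyDivisible ((Mc : Measure ℝ).map Real.log) ∧
      (Mc : Measure ℝ).map Real.log ≪ volume := by
  refine ⟨fun τ hτ => existsUnique_isSelbergLaw hτ, fun M hM => ?_⟩
  -- The Lévy-Khintchine construction works at τ = 1 itself and gives the law of log of the limit,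
  -- so divisibility and absolute continuity need no passage to the limit.
  obtain ⟨ρ, hρ, hac, hdiv⟩ := exists_hasLaplaceTransform_selbergExponent one_pos
  have := hρ.prob
  have hMc : HasMellinOn (expLaw ρ) {q : ℂ | q.re < 1} criticalMellin :=
    ⟨hρ.hasMellinOn.1, fun q hq => ⟨(hρ.hasMellinOn.2 q hq).1,
      (hρ.hasMellinOn.2 q hq).2.trans (exp_selbergExponent_one hq)⟩⟩
  -- The half plane Re q < 1 contains none of the excluded points 2q = 2, 3, 4, …
  have hre : ∀ q : ℂ, q.re < 1 → ∀ n : ℕ, 2 * q ≠ (n : ℂ) + 2 := fun q hq n h => by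
    have h1 := congrArg Complex.re h
    have h2 : (0 : ℝ) ≤ n := Nat.cast_nonneg n
    simp at h1
    linarith
  obtain ⟨B, hB⟩ := exists_isBarnesBeta
  refine ⟨expLaw ρ, tendsto_lawDiv_selberg hM hMc, hMc, meromorphic_criticalMellin,
    meromorphicOrderAt_criticalMellin_half, meromorphicOrderAt_criticalMellin_one,
    meromorphicOrderAt_criticalMellin_two, fun n hn => meromorphicOrderAt_criticalMellin_nat hn,
    fun q h1 h2 => meromorphicOrderAt_criticalMellin_eq_zero h1 h2, fun q hq => ?_,
    fun q hq => criticalMellin_functional_equation hq,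
    fun q hq => ⟨multipliable_criticalFactor q, criticalMellin_eq_tprod hq⟩, fun q hq => ?_,
    fun l => ?_, isProbabilityMeasure_lognormalLaw _,
    isProbabilityMeasure_paretoMeasure one_pos two_pos, isProbabilityMeasure_frechetLaw,
    ⟨B, hB, eq_map_prod_of_hasMellinOn hMc hB⟩, ?_, ?_⟩
  · rw [(hMc.2 q hq).2, (hMc.2 (q - 1) (by
      have : q.re < 1 := hq
      simp; linarith)).2]
    exact criticalMellin_functional_equation (hre q hq)
  · rw [(hMc.2 q hq).2]
    exact criticalMellin_eq_tprod (hre q hq)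
  · have hl : (-(l : ℂ)) ∈ {q : ℂ | q.re < 1} := by
      have : (0 : ℝ) ≤ l := Nat.cast_nonneg l
      simp; linarith
    have e : ∀ x : ℝ, (x : ℂ) ^ (-(l : ℂ)) = ((x ^ (-(l : ℤ)) : ℝ) : ℂ) := fun x => by
      rw [Complex.ofReal_zpow, ← Complex.cpow_intCast]
      push_cast
      rfl
    obtain ⟨h1, h2⟩ := hMc.2 _ hl
    rw [mellinOf] at h2
    simp only [e] at h1 h2
    rw [criticalMellin_neg_nat, integral_complex_ofReal] at h2
    refine ⟨h1.re.congr (Eventually.of_forall fun x => Complex.ofReal_re _), ?_⟩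
    exact_mod_cast h2
  · rw [expLaw_map_log]; exact hdiv
  · rw [expLaw_map_log]; exact hac
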